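/- **Setting.** Let $G=(V,E)$ be a finite, connected, simple, bipartite plane graph with vertices coloured white and black, embedded in the plane with a distinguished external face. Let $\bar\partial=(x_0,\dots,x_{n-1})$ be a (possibly empty) list of distinct vertices that are consecutive, in clockwise order, on the boundary of the external face, and let $\partial\subset\bar\partial$. The folded graph $G^\times$ has vertex set $V^\times=\partial\cup\big((V\setminus\partial)\times\{1,2\}\big)$; with $p:V^\times\to V$ the projection ($p(w)=w$ for $w\in\partial$, $p(u,i)=u$), $x,y\in V^\times$ are adjacent iff $\{p(x),p(y)\}\in E$. A dimer configuration of $G^\times$ is a set $m$ of edges such that every vertex lies on exactly one edge of $m$, and $\Omega$ is the set of all $p(m)\subset E$. The connected components of $\omega\in\Omega$ are loops (cycles of length $>2$) and doubled edges (single edges), both contained in $V\setminus\partial$, and arcs (paths joining two distinct vertices of $\partial$, with all other vertices in $V\setminus\partial$). Let $\Phi$ be an $\mathrm{SL}_2(\mathbb C)$ connection on the bulk: matrices $\phi_{u,v}\in \mathrm{SL}_2(\mathbb C)$ for directed edges $uv$ with $u,v\in V\setminus\partial$, with $\phi_{v,u}=\phi_{u,v}^{-1}$; and let $\psi_{\{u,w\}}\in\mathbb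 C^2$ for each edge with $u\in V\setminus\partial$, $w\in\partial$. Put $\nu_{\{(u,i),(v,j)\}}=(\phi_{u,v})_{i,j}$ for $u$ white and $v$ black, $\nu_{\{(u,i),w\}}=(\psi_{\{u,w\}})_i$, and $\nu_{\{w,w'\}}=1$ for $w,w'\in\partial$. Given numbers $\xi_e$ ($e\in E$), let $K$ be the antisymmetric matrix indexed by $V^\times$ with $K_{x,y}=\xi_{\{p(x),p(y)\}}\,\nu_{\{x,y\}}$ if $x$ is white, $y$ is black and $x,y$ are adjacent in $G^\times$, and with all entries between non-adjacent vertices equal to $0$. Its Pfaffian is $$\mathrm{Pf}\,K=\sum_{\pi}(-1)^{k(\pi)}\prod_{\{x,y\}\in\pi,\ x<y}K_{x,y},$$ the sum being over all pairings $\pi$ of $V^\times$, where $k(\pi)$ is the number of crossings of the pairs of $\pi$ drawn as chords of a circle, and where $V^\times$ is ordered as follows: first $\partial$, in the order of $\bar\partial$; then the white vertices of $(V\setminus\partial)\times\{1,2\}$, then the black ones, each $(u,1)$ being directly followed by $(u,2)$. Kasteleyn phases are numbers $\xi_e\in\mathbb C$ with $|\xi_e|=1$ such that for every bounded face, with successive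 boundary edges $e_1,\dots,e_{2n}$, $$\frac{\xi_{e_1}\xi_{e_3}\cdots\xi_{e_{2n-1}}}{\xi_{e_2}\xi_{e_4}\cdots\xi_{e_{2n}}}=(-1)^{n+1}.$$ Real Kasteleyn phases alternate along $\bar\partial$ if, for each $i$, $\xi_{\{x_i,x_{i+1}\}}$ is $1$ when $x_i$ is white and $-1$ when $x_i$ is black. **Proposition (Kenyon's formula with arcs).** (a) If the colours alternate along $\partial$ (in the order of $\bar\partial$), then for every $\omega\in\Omega$ the two endpoints of each arc of $\omega$ have different colours. Assume from now on that for every $\omega\in\Omega$ the two endpoints of each arc have different colours, and set $$Z(\Phi,\psi)=\sum_{\omega\in\Omega}\ \prod_{\text{loops }C}\mathrm{tr}(\phi_C)\prod_{\text{arcs }A}\psi_{w_A}^{\intercal}\,\phi_A\,\psi_{b_A}.$$ Here $\phi_C$ is the product of $\Phi$ along the successive edges of the loop $C$; $w_A$ and $b_A$ are the white and the black endpoint of $A$, $\psi_{w_A}$ and $\psi_{b_A}$ are the vectors $\psi$ of the edges of $A$ at $w_A$ and at $b_A$, and $\phi_A=\phi_{e_1}\cdots\phi_{e_k}$ for the bulk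 edges $e_1,\dots,e_k$ of $A$ directed and ordered from $w_A$ towards $b_A$; the factor of an arc that is a single edge is $1$. (b) For all real Kasteleyn phases $\xi$ that alternate along $\bar\partial$, and all $\Phi$ and $\psi$, $$\mathrm{Pf}\,K=(-1)^{\lfloor |V\setminus\partial|/2\rfloor}\,Z(\Phi,\psi).$$ In particular $\mathrm{Pf}\,K=Z(\Phi,\psi)$ when $|V\setminus\partial|$ is divisible by $4$. (c) If $G$ is, with its embedding, a subgraph of $\mathbb Z^2\subset\mathbb C$ that is simply connected (all its bounded faces are unit squares), then there is $c\in\mathbb C$ with $|c|=1$, not depending on $\Phi$ and $\psi$, such that for the matrix $K$ defined with the phases $\zeta_{\{w,b\}}=b-w$ ($w$ white, $b$ black) in place of $\xi$ one has $\mathrm{Pf}\,K=c\,Z(\Phi,\psi)$ for all $\Phi$ and $\psi$. -/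

import Mathlib

noncomputable section

namespace FoldedDimer

/-! ### Pfaffians -/

section Pfaffian

variable {α R : Type*} [Fintype α] [LinearOrder α] [CommRing R]

/-- A pairing of the index set, as an involution without fixed points. -/
def IsPairing (π : Equiv.Perm α) : Prop :=
  ∀ x, π (π x) = x ∧ π x ≠ x

/-- The number of crossings of the pairing `π`, when the indices are placed in order on a circle
and partners are joined by chords: the chords `{x, π x}` and `{y, π y}` with `x < π x`, `y < π y`
and `x < y` cross if and only if `x < y < π x < π y`. -/
def crossings (π : Equiv.Perm α) : ℕ :=
  (Finset.univ.filter fun q : α × α => q.1 < q.2 ∧ q.2 < π q.1 ∧ π q.1 < π q.2).card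

open Classical in
/-- The Pfaffian, as the signed sum over all pairings of the (linearly ordered) index set. -/
def pfaffian (A : Matrix α α R) : R :=
  ∑ π ∈ Finset.univ.filter (fun π : Equiv.Perm α => IsPairing π),
    (-1) ^ crossings π * ∏ x ∈ Finset.univ.filter (fun x => x < π x), A x (π x)

end Pfaffian

/-! ### Plane graphs, as combinatorial maps of genus zero -/

/-- The two colour classes of a bipartite graph. -/
inductive Colour
  | white
  | black
  deriving DecidableEq

variable {V : Type*}

/-- The permutation of the darts generated by a rotation system `rot`, where `rot d` is the dart
that follows `d` in counterclockwise order around the origin of `d`.  It sends a dart to the next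
dart on the boundary of the face that lies to its left. -/
def facePermOf {G : SimpleGraph V} (rot : Equiv.Perm G.Dart) : Equiv.Perm G.Dart :=
  (Function.Involutive.toPerm _ SimpleGraph.Dart.symm_involutive).trans rot.symm

/-- A plane embedding of the connected finite graph `G`, up to orientation preserving
homeomorphism, with a distinguished external face.  The embedding is given by the counterclockwise
cyclic order of the darts around each vertex; the faces are the orbits of the induced permutation
of the darts (a graph without edges has a single face, which is not seen by any dart), and planarity
is Euler's formula. -/
structure PlaneEmbedding [Fintype V] (G : SimpleGraph V) where
  /-- The next dart, counterclockwise, with the same origin. -/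
  rot : Equiv.Perm G.Dart
  rot_fst : ∀ d, (rot d).fst = d.fst
  rot_sameCycle : ∀ d d' : G.Dart, d.fst = d'.fst → rot.SameCycle d d'
  euler : Fintype.card V
      + max 1 (Nat.card (Quotient (Equiv.Perm.SameCycle.setoid (facePermOf rot))))
    = Nat.card G.edgeSet + 2
  /-- The darts that have the external face on their left. -/
  outer : Set G.Dart
  outer_isFace : ∀ d ∈ outer, ∀ d', d' ∈ outer ↔ (facePermOf rot).SameCycle d d'
  outer_nonempty : Nonempty G.Dart → outer.Nonempty

/-- The next dart along the boundary of the face on the left.  Bounded faces are run through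
counterclockwise, and the boundary of the external face clockwise. -/
def PlaneEmbedding.next [Fintype V] {G : SimpleGraph V} (M : PlaneEmbedding G) :
    Equiv.Perm G.Dart :=
  facePermOf M.rot

/-- The vertices `bd 0, bd 1, …` are distinct and are consecutive, in clockwise order, on the
boundary of the external face; here `e i` is the boundary dart that starts from `bd i`. -/
def IsBoundaryPath [Fintype V] {G : SimpleGraph V} (M : PlaneEmbedding G) {n : ℕ}
    (bd : Fin n → V) : Prop :=
  Function.Injective bd ∧
    ∃ e : Fin n → G.Dart, (∀ i, e i ∈ M.outer) ∧ (∀ i, (e i).fst = bd i) ∧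
      ∀ i j : Fin n, (j : ℕ) = i + 1 → e j = M.next (e i)

/-! ### Kasteleyn phases

Phases are given as a function `ξ : V → V → ℂ`, where `ξ w b` is the phase of the edge `{w, b}`
with `w` white and `b` black; the other values of `ξ` are never used. -/

/-- The phase of the (undirected) edge `{u, v}`. -/
def edgePhase {G : SimpleGraph V} (col : G.Coloring Colour) (ξ : V → V → ℂ) (u v : V) : ℂ :=
  if col u = Colour.white then ξ u v else ξ v u

/-- Kasteleyn phases: unit complex numbers on the edges such that, if `e₁, …, e₂ₙ` are the
successive edges of the boundary of a bounded face, then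
`(ξ e₁ * ξ e₃ * ⋯) / (ξ e₂ * ξ e₄ * ⋯) = (-1) ^ (n + 1)`. -/
def IsKasteleyn [Fintype V] {G : SimpleGraph V} (M : PlaneEmbedding G) (col : G.Coloring Colour)
    (ξ : V → V → ℂ) : Prop :=
  (∀ u v, G.Adj u v → ‖edgePhase col ξ u v‖ = 1) ∧
    ∀ d : G.Dart, d ∉ M.outer → ∀ n : ℕ, Function.minimalPeriod M.next d = 2 * n →
      ∏ k ∈ Finset.range n,
        (edgePhase col ξ ((M.next ^ (2 * k)) d).fst ((M.next ^ (2 * k)) d).snd /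
          edgePhase col ξ ((M.next ^ (2 * k + 1)) d).fst ((M.next ^ (2 * k + 1)) d).snd)
        = (-1) ^ (n + 1)

/-- The phases are real. -/
def IsRealPhase {G : SimpleGraph V} (col : G.Coloring Colour) (ξ : V → V → ℂ) : Prop :=
  ∀ u v, G.Adj u v → edgePhase col ξ u v = 1 ∨ edgePhase col ξ u v = -1

/-- Along the boundary path the phases are `1` on the edges from white to black and `-1` on the
edges from black to white. -/
def AlternatesAlong {G : SimpleGraph V} (col : G.Coloring Colour) (ξ : V → V → ℂ) {n : ℕ}
    (bd : Fin n → V) : Prop :=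
  ∀ i j : Fin n, (j : ℕ) = i + 1 →
    edgePhase col ξ (bd i) (bd j) = if col (bd i) = Colour.white then 1 else -1

/-! ### The folded graph and its dimer configurations -/

/-- The vertices of the folded graph: one copy of each vertex of `S`, and two copies of each other
vertex.  The copies `1` and `2` are indexed here by `0` and `1`. -/
inductive DoubledVertex (S : Finset V)
  | boundary (v : V) (hv : v ∈ S)
  | bulk (v : V) (hv : v ∉ S) (i : Fin 2)

/-- The projection of the folded graph to the graph. -/
def DoubledVertex.proj {S : Finset V} : DoubledVertex S → V
  | .boundary v _ => v
  | .bulk v _ _ => v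

/-- The copy to which a vertex belongs, if it is not on the boundary. -/
def DoubledVertex.copy {S : Finset V} : DoubledVertex S → Option (Fin 2)
  | .boundary _ _ => none
  | .bulk _ _ i => some i

instance [Fintype V] (S : Finset V) : Fintype (DoubledVertex S) :=
  Fintype.ofInjective (fun x : DoubledVertex S => (x.proj, x.copy)) (by
    rintro (⟨v, hv⟩ | ⟨v, hv, i⟩) (⟨w, hw⟩ | ⟨w, hw, j⟩) h <;>
      simp_all [DoubledVertex.proj, DoubledVertex.copy])

/-- The folded graph: two of its vertices are adjacent if and only if their projections are. -/
def doubledGraph (G : SimpleGraph V) (S : Finset V) : SimpleGraph (DoubledVertex S) :=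
  G.comap DoubledVertex.proj

/-- A dimer configuration: a set of edges such that each vertex lies on exactly one of them. -/
def IsDimerConfig {W : Type*} (H : SimpleGraph W) (m : Set (Sym2 W)) : Prop :=
  m ⊆ H.edgeSet ∧ ∀ x, ∃! e, e ∈ m ∧ x ∈ e

/-- The configurations of loops, doubled edges and arcs: the projections of the dimer
configurations of the folded graph. -/
def configs [Fintype V] (G : SimpleGraph V) (S : Finset V) : Finset (Set (Sym2 V)) :=
  (Set.toFinite {ω : Set (Sym2 V) |
    ∃ m, IsDimerConfig (doubledGraph G S) m ∧ ω = Sym2.map DoubledVertex.proj '' m}).toFinset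

/-- The connected components of a configuration, that is, its loops, doubled edges and arcs. -/
abbrev Component (ω : Set (Sym2 V)) : Type _ :=
  (SimpleGraph.fromEdgeSet ω).ConnectedComponent

/-- `l` lists the vertices met by going once around the loop `c`, in one of the two directions,
from one of its vertices back to that vertex (which is listed twice). -/
def IsLoopTraversal (ω : Set (Sym2 V)) (c : Component ω) (l : List V) : Prop :=
  ∃ v, ∃ p : (SimpleGraph.fromEdgeSet ω).Walk v v, p.IsCycle ∧ v ∈ c.supp ∧ p.support = l

/-- The loops (of length greater than two) of a configuration. -/
def loops [Fintype V] (ω : Set (Sym2 V)) : Finset (Component ω) :=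
  (Set.toFinite {c : Component ω | ∃ l, IsLoopTraversal ω c l}).toFinset

/-- The arcs of a configuration: the components that meet the boundary set. -/
def arcs [Fintype V] (S : Finset V) (ω : Set (Sym2 V)) : Finset (Component ω) :=
  (Set.toFinite {c : Component ω | ∃ v ∈ S, v ∈ c.supp}).toFinset

/-- The arc `c` runs from its white endpoint `w` through the vertices of `s` to its black
endpoint `b`. -/
def IsArcTraversal {G : SimpleGraph V} (col : G.Coloring Colour) (S : Finset V)
    (ω : Set (Sym2 V)) (c : Component ω) (w : V) (s : List V) (b : V) : Prop :=
  w ∈ S ∧ b ∈ S ∧ col w = Colour.white ∧ col b = Colour.black ∧ w ∈ c.supp ∧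
    ∃ p : (SimpleGraph.fromEdgeSet ω).Walk w b, p.IsPath ∧ p.support = w :: (s ++ [b])

/-- In every configuration, the two endpoints of each arc have different colours. -/
def ArcsBicoloured [Fintype V] {G : SimpleGraph V} (col : G.Coloring Colour) (S : Finset V) :
    Prop :=
  ∀ ω ∈ configs G S, ∀ x ∈ S, ∀ y ∈ S, x ≠ y →
    (SimpleGraph.fromEdgeSet ω).Reachable x y → col x ≠ col y

/-- The colours alternate along `S`: two vertices of `S` that follow each other, among the vertices
of `S`, on the path `bd` have different colours. -/
def ColoursAlternate {G : SimpleGraph V} (col : G.Coloring Colour) (S : Finset V) {n : ℕ}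
    (bd : Fin n → V) : Prop :=
  ∀ i j : Fin n, i < j → bd i ∈ S → bd j ∈ S → (∀ k, i < k → k < j → bd k ∉ S) →
    col (bd i) ≠ col (bd j)

/-! ### Connections, weights and the Kasteleyn matrix -/

/-- An `SL₂(ℂ)` connection on the bulk `V \ S`.  Only its values on the directed bulk edges are
ever used. -/
structure Connection (G : SimpleGraph V) (S : Finset V) where
  toFun : V → V → Matrix.SpecialLinearGroup (Fin 2) ℂ
  symm : ∀ u v, u ∉ S → v ∉ S → G.Adj u v → toFun v u = (toFun u v)⁻¹

/-- The matrix `φ_{u,v}`. -/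
def Connection.mat {G : SimpleGraph V} {S : Finset V} (Φ : Connection G S) (u v : V) :
    Matrix (Fin 2) (Fin 2) ℂ :=
  (Φ.toFun u v).1

/-- The ordered product of the connection along the edges of a path given by its vertices. -/
def Connection.transport {G : SimpleGraph V} {S : Finset V} (Φ : Connection G S) :
    List V → Matrix (Fin 2) (Fin 2) ℂ
  | [] => 1
  | [_] => 1
  | u :: v :: l => Φ.mat u v * Φ.transport (v :: l)

open Classical in
/-- The trace of the monodromy around a loop.  It depends neither on the starting point nor on the
direction of the traversal. -/
def loopWeight {G : SimpleGraph V} {S : Finset V} (Φ : Connection G S) (ω : Set (Sym2 V))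
    (c : Component ω) : ℂ :=
  if h : ∃ l, IsLoopTraversal ω c l then (Φ.transport h.choose).trace else 1

/-- `ψ_wᵀ φ ψ_b` for the arc from `w` to `b` through the bulk vertices `s`, where `ψ u x` is the
vector of the edge from the bulk vertex `u` to the boundary vertex `x`, and `φ` is the product of
the connection along the bulk edges directed towards `b`; it is `1` for an arc that is a single
edge. -/
def arcValue {G : SimpleGraph V} {S : Finset V} (Φ : Connection G S) (ψ : V → V → Fin 2 → ℂ)
    (w : V) (s : List V) (b : V) : ℂ :=
  if h : s = [] then 1
  else dotProduct (ψ (s.head h) w) ((Φ.transport s).mulVec (ψ (s.getLast h) b))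

open Classical in
/-- The weight of an arc (an arc whose endpoints have the same colour gets the value zero; there
are none when `ArcsBicoloured` holds). -/
def arcWeight {G : SimpleGraph V} (col : G.Coloring Colour) {S : Finset V} (Φ : Connection G S)
    (ψ : V → V → Fin 2 → ℂ) (ω : Set (Sym2 V)) (c : Component ω) : ℂ :=
  if h : ∃ t : V × List V × V, IsArcTraversal col S ω c t.1 t.2.1 t.2.2 then
    arcValue Φ ψ h.choose.1 h.choose.2.1 h.choose.2.2
  else 0

/-- The sum over configurations of the product of the weights of the loops and of the arcs. -/
def loopArcSum [Fintype V] {G : SimpleGraph V} (col : G.Coloring Colour) {S : Finset V}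
    (Φ : Connection G S) (ψ : V → V → Fin 2 → ℂ) : ℂ :=
  ∑ ω ∈ configs G S,
    (∏ c ∈ loops ω, loopWeight Φ ω c) * ∏ c ∈ arcs S ω, arcWeight col Φ ψ ω c

/-- The weight of the edge of the folded graph from the white vertex `x` to the black vertex `y`. -/
def edgeWeight {G : SimpleGraph V} {S : Finset V} (Φ : Connection G S) (ψ : V → V → Fin 2 → ℂ) :
    DoubledVertex S → DoubledVertex S → ℂ
  | .bulk u _ i, .bulk v _ j => Φ.mat u v i j
  | .bulk u _ i, .boundary x _ => ψ u x i
  | .boundary x _, .bulk u _ i => ψ u x i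
  | .boundary _ _, .boundary _ _ => 1

open Classical in
/-- The Kasteleyn matrix of the folded graph: antisymmetric, supported on the edges, and equal to
phase times weight from white to black. -/
def kasteleynMatrix {G : SimpleGraph V} (col : G.Coloring Colour) {S : Finset V}
    (ξ : V → V → ℂ) (Φ : Connection G S) (ψ : V → V → Fin 2 → ℂ) :
    Matrix (DoubledVertex S) (DoubledVertex S) ℂ :=
  fun x y =>
    if (doubledGraph G S).Adj x y then
      if col x.proj = Colour.white then ξ x.proj y.proj * edgeWeight Φ ψ x y
      else -(ξ y.proj x.proj * edgeWeight Φ ψ y x)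
    else 0

/-- The orders used for the Pfaffian: first the boundary vertices, in the order of `bd`, then the
white bulk vertices, then the black ones, where the first copy of a vertex is directly followed by
its second copy. -/
structure IsFoldedOrder {G : SimpleGraph V} (col : G.Coloring Colour) (S : Finset V) {n : ℕ}
    (bd : Fin n → V) [LinearOrder (DoubledVertex S)] : Prop where
  boundary_lt_boundary : ∀ (i j : Fin n) (hi : bd i ∈ S) (hj : bd j ∈ S), i < j →
    DoubledVertex.boundary (bd i) hi < DoubledVertex.boundary (bd j) hj
  boundary_lt_bulk : ∀ (v : V) (hv : v ∈ S) (u : V) (hu : u ∉ S) (i : Fin 2),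
    DoubledVertex.boundary v hv < DoubledVertex.bulk u hu i
  white_lt_black : ∀ (u : V) (hu : u ∉ S) (v : V) (hv : v ∉ S) (i j : Fin 2),
    col u = Colour.white → col v = Colour.black →
      DoubledVertex.bulk u hu i < DoubledVertex.bulk v hv j
  copies_covBy : ∀ (u : V) (hu : u ∉ S),
    DoubledVertex.bulk u hu 0 ⋖ DoubledVertex.bulk u hu 1

/-! ### Subgraphs of the square lattice, with the lattice `ℤ²` as the Gaussian integers -/

/-- The direction of a dart. -/
def direction {G : SimpleGraph V} (pos : V → GaussianInt) (d : G.Dart) : GaussianInt :=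
  pos d.snd - pos d.fst

/-- The imaginary unit. -/
def gaussI : GaussianInt := ⟨0, 1⟩

/-- `G` is a subgraph of the square lattice, through the positions `pos` of its vertices, and the
plane embedding is the one that it inherits: the dart that follows `d` is the first one met by
turning counterclockwise from `d` by positive multiples of a right angle. -/
structure IsLatticeEmbedding [Fintype V] {G : SimpleGraph V} (M : PlaneEmbedding G)
    (pos : V → GaussianInt) : Prop where
  injective : Function.Injective pos
  adj : ∀ u v, G.Adj u v → Zsqrtd.norm (pos v - pos u) = 1
  rot : ∀ d : G.Dart, ∃ k : ℕ, 1 ≤ k ∧ k ≤ 4 ∧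
    direction pos (M.rot d) = gaussI ^ k * direction pos d ∧
    ∀ j : ℕ, 1 ≤ j → j < k → ∀ d' : G.Dart, d'.fst = d.fst →
      direction pos d' ≠ gaussI ^ j * direction pos d

/-- A subgraph of the square lattice is simply connected if all its bounded faces are unit squares,
that is, if their boundaries, run through counterclockwise, turn left at each step. -/
def IsSimplyConnectedLattice [Fintype V] {G : SimpleGraph V} (M : PlaneEmbedding G)
    (pos : V → GaussianInt) : Prop :=
  ∀ d : G.Dart, d ∉ M.outer → direction pos (M.next d) = gaussI * direction pos d

/-- The phases of discrete holomorphy, `b - w` on the edge from the white vertex `w` to the black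
vertex `b`. -/
def holomorphyPhase (pos : V → GaussianInt) (w b : V) : ℂ :=
  GaussianInt.toComplex (pos b) - GaussianInt.toComplex (pos w)

end FoldedDimer

end

/-! Fix a configuration `ω`. Run through each loop and doubled edge cyclically, and through each arc
from its white to its black end, from where one returns to the white end. This gives a permutation
`τ` of the vertices that exchanges the colours (`IsCirculation`). A dimer pairing over `ω` amounts
to a label in `Fin 2` at each vertex: the labelled copy lies on the edge that `τ` runs through from
white to black, the other copy on the edge run through from black to white (`labelPairing`,
`exists_labelPairing_eq`). The entries of the inverse of a matrix of `SL₂` are, up to sign, its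
complementary entries (`Connection.mat_swap`). So the weights on both kinds of edges become entries
of the connection taken in the direction of `τ`, and the sum over the labels multiplies these
matrices along the components: it yields the trace on a loop, `ψᵀ φ ψ` on an arc and `1` on a
doubled edge (`exists_circulation`).

It remains to see that all terms, for all `ω`, carry the same sign (`labelPairing_term`). Up to a
constant, the sign of a pairing of white with black points is the sign of a bijection
(`exists_bicolouredSign_eq`), hence multiplicative. Changing a label exchanges two copies and
changes the sign, which cancels the signs from `Connection.mat_swap`. With all labels zero, the
pairing differs from the one that joins equal copies along the steps from black to white by `τ²` on
the white vertices, whose sign is a product of `(-1) ^ (m + 1)` over the components of length `2 *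
m` (`sign_whiteSquare`). The pairing of equal copies has an explicit sign
(`bicolouredSign_backwardPairing`): one factor `-1` for each white bulk vertex, and a factor for
each arc that records which of its ends comes first. If this last factor is taken as the phase of a
chord closing the arc, then the phases along a component also multiply to `(-1) ^ (m + 1)`
(`prod_stepSign`), and everything cancels except `-1` to the number of white bulk vertices, which is
half the size of the bulk.

The phases are handled by Kasteleyn's argument (`IsSimpleCycle.prod_phase`): along a simple cycle of
length `2 * m` with interior vertices `U` they multiply to `(-1) ^ (m + 1 + #U)`. Here `#U` is even
because `τ` maps `U` to itself and exchanges the colours. The interior of a cycle is found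
homologically. By Euler's formula the vertices, edges and bounded faces form a complex that has
modulo two the homology of a disc (`DiscComplex`); a simple cycle bounds a unique chain of faces,
and a rank computation gives Euler's formula inside it. An arc is closed by a chord drawn in the
external face, which together with the boundary path bounds one more face. The same construction
shows that arcs do not cross (`IsArcGraph.noncrossing`). Hence the boundary vertices between the
ends of an arc are joined in pairs, which gives (a).

For (c), powers of `i` depending on the height of a vertex turn `b - w` into real Kasteleyn phases,
and signs at the vertices make them alternate along the path. Such vertex factors rescale rows and
columns, so they multiply the Pfaffian by a constant. -/

noncomputable section

namespace FoldedDimer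

/-! ### Signs of bicoloured pairings -/

section BipartiteSign

variable {α : Type*} [LinearOrder α]

/-- The sign of the difference of two elements of a linear order. -/
def orderSign (x y : α) : ℤ := if x < y then 1 else if y < x then -1 else 0

lemma orderSign_antisymm (x y : α) : orderSign x y = -orderSign y x := by
  unfold orderSign
  rcases lt_trichotomy x y with h | h | h
  · simp [h, h.not_gt]
  · simp [h]
  · simp [h, h.not_gt]

lemma orderSign_mul_self {x y : α} (h : x ≠ y) : orderSign x y * orderSign x y = 1 := by
  unfold orderSign
  rcases lt_trichotomy x y with h' | h' | h'
  · simp [h']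
  · exact absurd h' h
  · simp [h', h'.not_gt]

/-- The chords `{x, π x}` and `{y, π y}` cross. -/
def ChordsCross (π : Equiv.Perm α) (x y : α) : Prop :=
  (min x (π x) < min y (π y) ∧ min y (π y) < max x (π x) ∧ max x (π x) < max y (π y)) ∨
  (min y (π y) < min x (π x) ∧ min x (π x) < max y (π y) ∧ max y (π y) < max x (π x))

lemma ChordsCross.symm {π : Equiv.Perm α} {x y : α} (h : ChordsCross π x y) :
    ChordsCross π y x := Or.symm h

/-- Among the four comparisons of an end of one chord with an end of the other, an odd number is
negative exactly when the ends interleave; for nested or separate chords the number is even. -/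
lemma orderSign_chords {a b c d : α} (hac : a ≠ c) (had : a ≠ d) (hbc : b ≠ c)
    (hbd : b ≠ d) [Decidable ((min a b < min c d ∧ min c d < max a b ∧ max a b < max c d) ∨
      (min c d < min a b ∧ min a b < max c d ∧ max c d < max a b))] :
    orderSign a c * orderSign a d * orderSign b c * orderSign b d =
      if (min a b < min c d ∧ min c d < max a b ∧ max a b < max c d) ∨
      (min c d < min a b ∧ min a b < max c d ∧ max c d < max a b) then -1 else 1 := by
  unfold orderSign
  rcases le_total a b with h1 | h1 <;> rcases le_total c d with h2 | h2 <;>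
  simp only [h1, h2, min_eq_left, min_eq_right, max_eq_left, max_eq_right] <;>
  rcases lt_or_gt_of_ne hac with h3 | h3 <;> rcases lt_or_gt_of_ne had with h4 | h4 <;>
  rcases lt_or_gt_of_ne hbc with h5 | h5 <;> rcases lt_or_gt_of_ne hbd with h6 | h6 <;>
  simp only [h3, h4, h5, h6, h3.not_gt, h4.not_gt, h5.not_gt, h6.not_gt] <;> first
    | (exfalso; order)
    | simp

variable [Fintype α] (W : α → Prop)

/-- A pairing that matches elements in the class `W` with elements outside of it. -/
def IsBicoloured (π : Equiv.Perm α) : Prop :=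
  IsPairing π ∧ ∀ x, W (π x) ↔ ¬ W x

open Classical in
/-- The sign with which a bicoloured pairing contributes to the Pfaffian of an antisymmetric matrix
whose entries are prescribed from `W` to its complement. -/
def bicolouredSign (π : Equiv.Perm α) : ℤ :=
  (-1) ^ crossings π * ∏ x ∈ Finset.univ.filter (fun x => x < π x), if W x then 1 else -1

variable {W}

open Classical in
-- A chord is known by its end in `W`, so crossings can be counted over pairs of elements of `W`,
-- where `orderSign_chords` detects them, instead of over pairs of left ends.
lemma crossings_sign {π : Equiv.Perm α} (hπ : IsBicoloured W π) {N : ℕ}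
    (e : Fin N ≃ {x // W x}) :
    (-1 : ℤ) ^ crossings π = ∏ q ∈ Finset.univ.filter (fun q : Fin N × Fin N => q.1 < q.2),
      (orderSign (e q.1).1 (e q.2).1 * orderSign (e q.1).1 (π (e q.2).1) *
        orderSign (π (e q.1).1) (e q.2).1 * orderSign (π (e q.1).1) (π (e q.2).1)) := by
  obtain ⟨hpair, hcol⟩ := hπ
  have hinv : ∀ x, π (π x) = x := fun x => (hpair x).1
  have hW : ∀ x, ¬ W x → W (π x) := fun x h => (hcol x).2 h
  -- The end in `W` of the chord through a given point.
  set wh : α → {x // W x} := fun x => if h : W x then ⟨x, h⟩ else ⟨π x, hW x h⟩ with hwh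
  have whval : ∀ x, (wh x).1 = x ∨ (wh x).1 = π x := by
    intro x; by_cases h : W x <;> simp [hwh, h]
  have whW : ∀ w : {x // W x}, wh w.1 = w := by
    intro w; simp [hwh, w.2]
  have whπW : ∀ w : {x // W x}, wh (π w.1) = w := by
    intro w
    have : ¬ W (π w.1) := by rw [hcol]; simpa using w.2
    simp [hwh, this, hinv]
  have lowh : ∀ x, min (wh x).1 (π (wh x).1) = min x (π x) := by
    intro x
    rcases whval x with h | h
    · rw [h]
    · rw [h, hinv, min_comm]
  have hiwh : ∀ x, max (wh x).1 (π (wh x).1) = max x (π x) := by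
    intro x
    rcases whval x with h | h
    · rw [h]
    · rw [h, hinv, max_comm]
  have whlo : ∀ w : {x // W x}, wh (min w.1 (π w.1)) = w := by
    intro w
    rcases min_choice w.1 (π w.1) with h | h <;> rw [h]
    · exact whW w
    · exact whπW w
  have πlo : ∀ x, π (min x (π x)) = max x (π x) := by
    intro x
    rcases le_total x (π x) with h | h
    · simp [h]
    · simp [h, hinv]
  set A := Finset.univ.filter (fun q : α × α => q.1 < q.2 ∧ q.2 < π q.1 ∧ π q.1 < π q.2) with hA
  set T := Finset.univ.filter (fun q : Fin N × Fin N => q.1 < q.2) with hT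
  have hterm : ∀ q ∈ T, (orderSign (e q.1).1 (e q.2).1 * orderSign (e q.1).1 (π (e q.2).1) *
        orderSign (π (e q.1).1) (e q.2).1 * orderSign (π (e q.1).1) (π (e q.2).1)) =
        if ChordsCross π (e q.1).1 (e q.2).1 then -1 else 1 := by
    intro q hq
    have hne : (e q.1).1 ≠ (e q.2).1 := by
      intro h
      have := e.injective (Subtype.ext h)
      simp only [hT, Finset.mem_filter] at hq
      exact hq.2.ne this
    have h1 : (e q.1).1 ≠ π (e q.2).1 := by
      intro h
      have := (hcol (e q.2).1)
      rw [← h] at this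
      exact this.1 (e q.1).2 (e q.2).2
    have h2 : π (e q.1).1 ≠ (e q.2).1 := by
      intro h
      have := (hcol (e q.1).1)
      rw [h] at this
      exact this.1 (e q.2).2 (e q.1).2
    rw [orderSign_chords hne h1 h2 (fun h => hne (π.injective h))]
    unfold ChordsCross
    congr
  rw [Finset.prod_congr rfl hterm, Finset.prod_ite]
  simp only [Finset.prod_const, one_pow, mul_one]
  congr 1
  change A.card = _
  have lox : ∀ q ∈ A, min q.1 (π q.1) = q.1 ∧ min q.2 (π q.2) = q.2 ∧
      max q.1 (π q.1) = π q.1 ∧ max q.2 (π q.2) = π q.2 := by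
    intro q hq
    simp only [hA, Finset.mem_filter, Finset.mem_univ, true_and] at hq
    obtain ⟨h1, h2, h3⟩ := hq
    have h4 := (h1.trans h2).le
    have h5 := (h2.trans h3).le
    simp [h4, h5]
  have crA : ∀ q ∈ A, ChordsCross π (wh q.1).1 (wh q.2).1 := by
    intro q hq
    obtain ⟨a1, a2, a3, a4⟩ := lox q hq
    unfold ChordsCross
    rw [lowh, lowh, hiwh, hiwh, a1, a2, a3, a4]
    simp only [hA, Finset.mem_filter, Finset.mem_univ, true_and] at hq
    exact Or.inl hq
  have whne : ∀ q ∈ A, wh q.1 ≠ wh q.2 := by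
    intro q hq h
    have h1 := lowh q.1
    rw [h, lowh, (lox q hq).1, (lox q hq).2.1] at h1
    simp only [hA, Finset.mem_filter] at hq
    exact hq.2.1.ne h1.symm
  -- The order of the left ends and the order of the indices of the ends in `W` are unrelated, so
  -- both maps of the bijection sort the pair that they return.
  let i : α × α → Fin N × Fin N := fun q =>
    if e.symm (wh q.1) < e.symm (wh q.2) then (e.symm (wh q.1), e.symm (wh q.2))
    else (e.symm (wh q.2), e.symm (wh q.1))
  let lo : Fin N → α := fun k => min (e k).1 (π (e k).1)
  let j : Fin N × Fin N → α × α := fun q =>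
    if lo q.1 < lo q.2 then (lo q.1, lo q.2) else (lo q.2, lo q.1)
  refine Finset.card_nbij' i j ?_ ?_ ?_ ?_
  · intro q hq
    have hq' : q ∈ A := hq
    simp only [i]
    split_ifs with h
    · simp [hT, h, crA q hq']
    · have : e.symm (wh q.2) < e.symm (wh q.1) := by
        refine lt_of_le_of_ne (not_lt.1 h) (fun h' => whne q hq' ?_)
        exact (e.symm.injective h').symm
      simp [hT, this, (crA q hq').symm]
  · intro q hq
    simp only [Finset.coe_filter, Set.mem_ofPred_eq, hT, Finset.mem_filter, Finset.mem_univ,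
      true_and] at hq
    obtain ⟨hlt, hc⟩ := hq
    simp only [j, hA, lo]
    rcases hc with hc | hc
    · rw [if_pos hc.1]
      simp [πlo]
      simpa using hc
    · rw [if_neg hc.1.not_gt]
      simp [πlo]
      simpa using hc
  · intro q hq
    have hq' : q ∈ A := hq
    have l1 : lo (e.symm (wh q.1)) = q.1 := by simp [lo, lowh, (lox q hq').1]
    have l2 : lo (e.symm (wh q.2)) = q.2 := by simp [lo, lowh, (lox q hq').2.1]
    have hlt : q.1 < q.2 := by
      simp only [hA, Finset.mem_filter] at hq'
      exact hq'.2.1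
    simp only [i]
    split_ifs with h
    · simp only [j, l1, l2, hlt, if_true]
    · simp only [j, l1, l2, hlt.not_gt, if_false]
  · intro q hq
    simp only [Finset.coe_filter, Set.mem_ofPred_eq, hT, Finset.mem_filter, Finset.mem_univ,
      true_and] at hq
    have w1 : ∀ k, e.symm (wh (lo k)) = k := by intro k; simp [lo, whlo]
    simp only [j]
    split_ifs with h
    · simp only [i, w1, hq.1, if_true]
    · simp only [i, w1, hq.1.not_gt, if_false]

lemma prod_offDiag_eq {N : ℕ} (f : Fin N → Fin N → ℤ) :
    ∏ i, ∏ j, f i j = (∏ q ∈ Finset.univ.filter (fun q : Fin N × Fin N => q.1 < q.2),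
      f q.1 q.2 * f q.2 q.1) * ∏ i, f i i := by
  have split : ∀ q : Fin N × Fin N, f q.1 q.2 = (if q.1 < q.2 then f q.1 q.2 else 1) *
      (if q.2 < q.1 then f q.1 q.2 else 1) * (if q.1 = q.2 then f q.1 q.2 else 1) := by
    intro q
    rcases lt_trichotomy q.1 q.2 with h | h | h
    · simp [h, h.not_gt, h.ne]
    · simp [h]
    · simp [h, h.not_gt, h.ne']
  rw [← Fintype.prod_prod_type', Fintype.prod_congr _ _ split, Finset.prod_mul_distrib,
    Finset.prod_mul_distrib, Finset.prod_mul_distrib, ← Finset.prod_filter, ← Finset.prod_filter]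
  congr 1
  · congr 1
    refine Finset.prod_nbij' Prod.swap Prod.swap ?_ ?_ ?_ ?_ ?_ <;> simp
  · rw [Fintype.prod_prod_type]
    simp

open Classical in
-- The chords whose left end is outside `W` are those for which `π w < w` at their end `w` in `W`.
lemma prod_left_eq {π : Equiv.Perm α} (hπ : IsBicoloured W π) :
    (∏ x ∈ Finset.univ.filter (fun x => x < π x), if W x then (1 : ℤ) else -1) =
      ∏ w : {x // W x}, orderSign w.1 (π w.1) := by
  obtain ⟨hpair, hcol⟩ := hπ
  have hs : ∀ w : {x // W x}, orderSign w.1 (π w.1) = if π w.1 < w.1 then -1 else 1 := by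
    intro w
    have := (hpair w.1).2
    unfold orderSign
    rcases lt_or_gt_of_ne this with h | h
    · simp [h, h.not_gt]
    · simp [h, h.not_gt]
  simp_rw [hs]
  rw [Finset.prod_ite, Finset.prod_ite]
  simp only [Finset.prod_const, one_pow, mul_one, one_mul]
  congr 1
  refine Finset.card_bij' (fun x hx => ⟨π x, (hcol x).2 (by simp at hx; exact hx.2)⟩)
    (fun w _ => π w.1) ?_ ?_ ?_ ?_
  · intro x hx
    simp at hx ⊢
    rw [(hpair x).1]; exact hx.1
  · intro w hw
    simp at hw ⊢
    refine ⟨by rw [(hpair w.1).1]; exact hw, ?_⟩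
    rw [hcol]; simpa using w.2
  · intro x hx; exact (hpair x).1
  · intro w hw; exact Subtype.ext (hpair w.1).1

open Classical in
/-- Up to a factor that does not depend on the pairing, the sign of a bicoloured pairing is the
sign of the bijection from `W` to its complement. -/
lemma exists_bicolouredSign_eq {N : ℕ} (e : Fin N ≃ {x // W x}) :
    ∃ κ : ℤ, ∀ π : Equiv.Perm α, IsBicoloured W π → bicolouredSign W π =
      κ * ∏ q ∈ Finset.univ.filter (fun q : Fin N × Fin N => q.1 < q.2),
        orderSign (π (e q.1).1) (π (e q.2).1) := by
  set T := Finset.univ.filter (fun q : Fin N × Fin N => q.1 < q.2) with hT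
  -- The mixed comparisons in the crossing product concern pairs of distinct chords. The comparison
  -- of the two ends of one chord, which comes from the colours of the left ends, supplies the
  -- missing diagonal. Together they run over all pairs in `W` times its complement, so they do not
  -- depend on `π`; the power of `-1` comes from reversing one mixed comparison for each pair of
  -- chords.
  refine ⟨(∏ q ∈ T, orderSign (e q.1).1 (e q.2).1) * (-1) ^ T.card *
    ∏ i, ∏ b : {x // ¬ W x}, orderSign (e i).1 b.1, ?_⟩
  intro π hπ
  have hb : ∀ i, ∏ b : {x // ¬ W x}, orderSign (e i).1 b.1 =
      ∏ j, orderSign (e i).1 (π (e j).1) := by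
    intro i
    symm
    refine Fintype.prod_equiv (e.trans ⟨fun w => ⟨π w.1, by rw [hπ.2]; simpa using w.2⟩,
      fun b => ⟨π b.1, (hπ.2 b.1).2 b.2⟩, fun w => Subtype.ext (hπ.1 w.1).1,
      fun b => Subtype.ext (hπ.1 b.1).1⟩) _ _ ?_
    intro j
    rfl
  have hd : ∀ i, orderSign (e i).1 (π (e i).1) * orderSign (e i).1 (π (e i).1) = 1 := fun i =>
    orderSign_mul_self ((hπ.1 _).2.symm)
  have hdd : (∏ i, orderSign (e i).1 (π (e i).1)) * ∏ i, orderSign (e i).1 (π (e i).1) = 1 := by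
    rw [← Finset.prod_mul_distrib]; exact Finset.prod_eq_one fun i _ => hd i
  rw [bicolouredSign, prod_left_eq hπ, crossings_sign hπ e,
    ← Fintype.prod_equiv e (fun i => orderSign (e i).1 (π (e i).1)) _ (fun i => rfl)]
  simp_rw [hb]
  rw [prod_offDiag_eq]
  have hsw : ∏ q ∈ T, (orderSign (e q.1).1 (π (e q.2).1) * orderSign (e q.2).1 (π (e q.1).1)) =
      (-1) ^ T.card * ∏ q ∈ T, (orderSign (e q.1).1 (π (e q.2).1) *
        orderSign (π (e q.1).1) (e q.2).1) := by
    rw [← Finset.prod_const, ← Finset.prod_mul_distrib]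
    refine Finset.prod_congr rfl fun q _ => ?_
    rw [orderSign_antisymm (π (e q.1).1) (e q.2).1]; ring
  rw [hsw]
  simp only [Finset.prod_mul_distrib]
  have h1 : ((-1 : ℤ) ^ T.card) * (-1) ^ T.card = 1 := by
    rw [← mul_pow]; simp
  linear_combination (-(∏ q ∈ T, orderSign (e q.1).1 (e q.2).1) *
    (∏ q ∈ T, orderSign (e q.1).1 (π (e q.2).1)) *
    (∏ q ∈ T, orderSign (π (e q.1).1) (e q.2).1) *
    (∏ q ∈ T, orderSign (π (e q.1).1) (π (e q.2).1)) *
    (∏ i, orderSign (e i).1 (π (e i).1))) * h1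

open Classical in
/-- Precomposing a bicoloured pairing with a permutation of one class multiplies its sign by the
sign of the permutation. -/
lemma bicolouredSign_comp {π π' : Equiv.Perm α} (hπ : IsBicoloured W π) (hπ' : IsBicoloured W π')
    (ρ : Equiv.Perm {x // W x}) (h : ∀ w, π (ρ w).1 = π' w.1) :
    bicolouredSign W π' = (Equiv.Perm.sign ρ : ℤ) * bicolouredSign W π := by
  let e := (Fintype.equivFin {x // W x}).symm
  obtain ⟨κ, hκ⟩ := exists_bicolouredSign_eq e
  rw [hκ π hπ, hκ π' hπ']
  let σ : Equiv.Perm (Fin _) := (e.trans ρ).trans e.symm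
  have hσ : Equiv.Perm.sign σ = Equiv.Perm.sign ρ := Equiv.Perm.sign_trans_trans_symm ρ e
  -- Only the comparisons among the partners depend on the pairing, and an antisymmetric product
  -- over pairs is multiplied by the sign of a reindexing.
  have key := σ.prod_Iio_comp_eq_sign_mul_prod
    (f := fun i j => orderSign (π (e i).1) (π (e j).1)) (fun i j => orderSign_antisymm _ _)
  have conv : ∀ f : Fin _ → Fin _ → ℤ, ∏ j, ∏ i ∈ Finset.Iio j, f i j =
      ∏ q ∈ Finset.univ.filter (fun q : Fin (Fintype.card {x // W x}) × Fin _ => q.1 < q.2),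
        f q.1 q.2 := by
    intro f
    rw [Finset.prod_filter, Fintype.prod_prod_type_right]
    refine Finset.prod_congr rfl fun j _ => ?_
    rw [← Finset.prod_filter]
    refine Finset.prod_congr ?_ fun _ _ => rfl
    ext i; simp
  rw [conv, conv, hσ] at key
  have hl : ∀ i, π (e (σ i)).1 = π' (e i).1 := by
    intro i; simp [σ, h]
  simp only [hl] at key
  rw [key]; push_cast; ring

open Classical in
/-- A term of the Pfaffian of an antisymmetric matrix, rewritten in terms of the entries from `W`
to its complement. -/
lemma pfaffian_term_eq {π : Equiv.Perm α} (hπ : IsBicoloured W π) (A : Matrix α α ℂ)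
    (hA : ∀ x y, A x y = -A y x) :
    (-1) ^ crossings π * ∏ x ∈ Finset.univ.filter (fun x => x < π x), A x (π x) =
      (bicolouredSign W π : ℂ) * ∏ w : {x // W x}, A w.1 (π w.1) := by
  have h1 : ∏ x ∈ Finset.univ.filter (fun x => x < π x), A x (π x) =
      (∏ x ∈ Finset.univ.filter (fun x => x < π x), if W x then (1 : ℂ) else -1) *
      ∏ x ∈ Finset.univ.filter (fun x => x < π x), if W x then A x (π x) else A (π x) x := by
    rw [← Finset.prod_mul_distrib]
    refine Finset.prod_congr rfl fun x _ => ?_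
    split_ifs
    · simp
    · rw [hA]; ring
  have h2 : (∏ x ∈ Finset.univ.filter (fun x => x < π x),
      if W x then A x (π x) else A (π x) x) = ∏ w : {x // W x}, A w.1 (π w.1) := by
    have lo : ∀ x, x < π x → ¬ W x → W (π x) := fun x _ h => (hπ.2 x).2 h
    refine Finset.prod_bij' (fun x _ => if h : W x then ⟨x, h⟩ else ⟨π x, (hπ.2 x).2 h⟩)
      (fun w _ => if w.1 < π w.1 then w.1 else π w.1) ?_ ?_ ?_ ?_ ?_
    · intro x _; exact Finset.mem_univ _
    · intro w _
      have := (hπ.1 w.1).2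
      simp only [Finset.mem_filter, Finset.mem_univ, true_and]
      split_ifs with h
      · exact h
      · rw [(hπ.1 w.1).1]; exact lt_of_le_of_ne (not_lt.1 h) this
    · intro x hx
      simp only [Finset.mem_filter, Finset.mem_univ, true_and] at hx
      by_cases h : W x
      · simp [h, hx]
      · simp [h, (hπ.1 x).1, hx.not_gt]
    · intro w _
      have hnW : ¬ W (π w.1) := by rw [hπ.2]; simpa using w.2
      have h2 : π (π w.1) = w.1 := (hπ.1 w.1).1
      by_cases h : w.1 < π w.1
      · have := w.2
        simp [h, this]
      · simp only [h, if_false]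
        rw [dif_neg hnW]
        exact Subtype.ext h2
    · intro x _
      by_cases h : W x
      · simp [h]
      · simp [h, (hπ.1 x).1]
  rw [h1, h2, bicolouredSign]
  push_cast
  ring

end BipartiteSign

/-! ### Cellular decompositions of a disc -/

section Disc

open Classical in
/-- The incidence of a vertex and an edge, modulo two. -/
def endInc {V E : Type*} (ends : E → Sym2 V) (v : V) (e : E) : ZMod 2 :=
  if v ∈ ends e then 1 else 0

lemma sum_endInc {V E : Type*} [Fintype V] {ends : E → Sym2 V} {e : E} {u v : V}
    (he : ends e = s(u, v)) (huv : u ≠ v) (h : V → ZMod 2) :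
    ∑ w, endInc ends w e * h w = h u + h v := by
  classical
  have : ∀ w, endInc ends w e * h w = (if w = u then h w else 0) + (if w = v then h w else 0) := by
    intro w
    unfold endInc
    rw [he]
    by_cases h1 : w = u
    · subst h1; simp [huv]
    · by_cases h2 : w = v
      · subst h2; simp [h1]
      · simp [h1, h2]
  simp [this, Finset.sum_add_distrib]

/-- A finite cell complex with the homology modulo two of a disc; `b e F` is the number of sides of
the edge `e` that lie on the bounded face `F`. -/
structure DiscComplex (V E F : Type*) [Fintype V] [Fintype E] [Fintype F] where
  /-- The endpoints of an edge. -/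
  ends : E → Sym2 V
  /-- The number of sides of an edge on a face. -/
  b : E → F → ℕ
  ends_ne : ∀ e, ¬ (ends e).IsDiag
  sum_le : ∀ e, ∑ f, b e f ≤ 2
  closed : ∀ f v, ∑ e, endInc ends v e * (b e f : ZMod 2) = 0
  -- The next four conditions are the vanishing of the first and second homology and of the first
  -- cohomology, and connectedness, all with coefficients in `ZMod 2`.
  exact : ∀ z : E → ZMod 2, (∀ v, ∑ e, endInc ends v e * z e = 0) →
    ∃ k : F → ZMod 2, ∀ e, ∑ f, (b e f : ZMod 2) * k f = z e
  inj : ∀ k : F → ZMod 2, (∀ e, ∑ f, (b e f : ZMod 2) * k f = 0) → k = 0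
  coexact : ∀ g : E → ZMod 2, (∀ f, ∑ e, (b e f : ZMod 2) * g e = 0) →
    ∃ h : V → ZMod 2, ∀ e, g e = ∑ v, endInc ends v e * h v
  conn : ∀ h : V → ZMod 2, (∀ e, ∑ v, endInc ends v e * h v = 0) → ∀ u v, h u = h v
  /-- The faces around a vertex are separated, in a region, only by edges of its boundary. -/
  link : ∀ (D : Finset F) v, (∀ e, v ∈ ends e → ∑ f ∈ D, b e f ≠ 1) →
    (∀ e, v ∈ ends e → ∑ f ∈ D, b e f = 2) ∨ (∀ e, v ∈ ends e → ∑ f ∈ D, b e f = 0)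

namespace DiscComplex

variable {V E F : Type*} [Fintype V] [Fintype E] [Fintype F] (K : DiscComplex V E F)

/-- The number of sides of an edge in a region. -/
def sides (D : Finset F) (e : E) : ℕ := ∑ f ∈ D, K.b e f

lemma sides_le (D : Finset F) (e : E) : K.sides D e ≤ 2 :=
  (Finset.sum_le_sum_of_subset (Finset.subset_univ D)).trans (K.sum_le e)

lemma b_eq_zero_of_sides {D : Finset F} {e : E} (h : K.sides D e = 2) {f : F} (hf : f ∉ D) :
    K.b e f = 0 := by
  classical
  have h1 : ∑ f' ∈ insert f D, K.b e f' ≤ 2 :=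
    (Finset.sum_le_sum_of_subset (Finset.subset_univ _)).trans (K.sum_le e)
  rw [Finset.sum_insert hf] at h1
  unfold sides at h
  omega

lemma exists_ends (e : E) : ∃ u v, u ≠ v ∧ K.ends e = s(u, v) := by
  have := K.ends_ne e
  induction h : K.ends e with
  | h u v =>
    rw [h] at this
    exact ⟨u, v, by simpa using this, rfl⟩

/-- A set of vertices `U` and the set of faces `D` of a region bounded by a simple cycle through
the vertices `C`, where `U` consists of the interior vertices. -/
structure IsRegion (D : Finset F) (U C : Finset V) : Prop where
  nonempty : D.Nonempty
  -- Edges with two, one or no sides in `D` are interior, boundary or exterior. That the boundary is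
  -- a single cycle is expressed algebraically: it is connected, and the only cycles supported on it
  -- are zero and itself.
  simple : ∀ z : E → ZMod 2, (∀ e, K.sides D e ≠ 1 → z e = 0) →
    (∀ v, ∑ e, endInc K.ends v e * z e = 0) → (∀ e, z e = 0) ∨ (∀ e, K.sides D e = 1 → z e = 1)
  connected : ∀ h : V → ZMod 2,
    (∀ e, K.sides D e = 1 → ∑ v, endInc K.ends v e * h v = 0) → ∀ u ∈ C, ∀ v ∈ C, h u = h v
  cycle_nonempty : C.Nonempty
  disjoint : Disjoint U C
  outside : ∀ e v, v ∈ K.ends e → K.sides D e ≠ 2 → v ∉ U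
  inside : ∀ e v, v ∈ K.ends e → K.sides D e = 2 → v ∈ U ∨ v ∈ C

variable {K}

lemma sum_subtype_of_eq_zero {ι : Type*} [Fintype ι] {p : ι → Prop} [Fintype {i // p i}]
    {w : ι → ZMod 2} (hw : ∀ i, ¬ p i → w i = 0) : ∑ i : {i // p i}, w i.1 = ∑ i, w i := by
  classical
  have h0 : ∑ i ∈ Finset.univ.filter p, w i = ∑ i : {i // p i}, w i.1 :=
    Finset.sum_subtype _ (by simp) _
  rw [← h0, Finset.sum_filter]
  refine Finset.sum_congr rfl fun i _ => ?_
  split_ifs with h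
  · rfl
  · exact (hw i h).symm

open Classical in
/-- The extension by zero of a function on a subtype. -/
def extendZero {ι : Type*} {p : ι → Prop} (k : {i // p i} → ZMod 2) (i : ι) : ZMod 2 :=
  if h : p i then k ⟨i, h⟩ else 0

lemma extendZero_coe {ι : Type*} {p : ι → Prop} (k : {i // p i} → ZMod 2) (i : {i // p i}) :
    extendZero k i.1 = k i := by simp [extendZero, i.2]

lemma extendZero_of_not {ι : Type*} {p : ι → Prop} (k : {i // p i} → ZMod 2) {i : ι}
    (hi : ¬ p i) : extendZero k i = 0 := by simp [extendZero, hi]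

lemma sum_mul_extendZero {ι : Type*} [Fintype ι] {p : ι → Prop} [Fintype {i // p i}]
    (k : {i // p i} → ZMod 2) (w : ι → ZMod 2) :
    ∑ i, w i * extendZero k i = ∑ i : {i // p i}, w i.1 * k i := by
  rw [← sum_subtype_of_eq_zero (p := p) (fun i hi => by rw [extendZero_of_not k hi, mul_zero])]
  simp only [extendZero_coe]

open Classical in
-- A chain on `D` with no boundary on the interior edges has as boundary a cycle supported on the
-- boundary of `D`. By simplicity this is zero or the whole boundary, and as chains are determined
-- by their boundaries the chain is zero or all of `D`.
lemma finrank_ker_sides {D : Finset F} {U C : Finset V} (hR : K.IsRegion D U C) :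
    Module.finrank (ZMod 2) (LinearMap.ker (Matrix.mulVecLin
      (Matrix.of fun (e : {e // K.sides D e = 2}) (f : {f // f ∈ D}) => (K.b e f : ZMod 2)))) =
      1 := by
  have hker : LinearMap.ker (Matrix.mulVecLin
      (Matrix.of fun (e : {e // K.sides D e = 2}) (f : {f // f ∈ D}) => (K.b e f : ZMod 2))) =
      Submodule.span (ZMod 2) {fun _ => 1} := by
    apply le_antisymm
    · intro k hk
      have hk' : ∀ e, K.sides D e = 2 → ∑ f : {f // f ∈ D}, (K.b e f : ZMod 2) * k f = 0 := by
        intro e he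
        have := congrFun (LinearMap.mem_ker.1 hk) ⟨e, he⟩
        simpa [Matrix.mulVec, dotProduct] using this
      set kx : F → ZMod 2 := extendZero k with hkx
      have hz : ∀ e, ∑ f, (K.b e f : ZMod 2) * kx f =
          ∑ f : {f // f ∈ D}, (K.b e f : ZMod 2) * k f := fun e =>
        sum_mul_extendZero k (fun f => (K.b e f : ZMod 2))
      have hone : ∀ e, ∑ f : {f // f ∈ D}, (K.b e f : ZMod 2) = (K.sides D e : ZMod 2) := by
        intro e
        unfold sides
        rw [Nat.cast_sum, Finset.sum_coe_sort D (fun f => (K.b e f : ZMod 2))]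
      have hcyc := hR.simple (fun e => ∑ f, (K.b e f : ZMod 2) * kx f) ?_ ?_
      rcases hcyc with h | h
      · have h0 := K.inj kx h
        have : k = 0 := by
          ext f
          rw [← extendZero_coe k f]
          exact congrFun h0 f.1
        rw [this]; exact Submodule.zero_mem _
      · have h0 := K.inj (fun f => kx f + if f ∈ D then 1 else 0) ?_
        · have : k = fun _ => 1 := by
            ext f
            have := congrFun h0 f.1
            simp only [hkx, extendZero_coe, f.2, if_true, Pi.zero_apply] at this
            rwa [CharTwo.add_eq_zero] at this
          rw [this]; exact Submodule.subset_span rfl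
        · intro e
          have e1 : ∑ f, (K.b e f : ZMod 2) * (kx f + if f ∈ D then 1 else 0) =
              ∑ f, (K.b e f : ZMod 2) * kx f + (K.sides D e : ZMod 2) := by
            simp only [mul_add, Finset.sum_add_distrib]
            congr 1
            simp [sides]
          rw [e1]
          have hle := K.sides_le D e
          have hc : K.sides D e = 0 ∨ K.sides D e = 1 ∨ K.sides D e = 2 := by omega
          rcases hc with hc | hc | hc
          · rw [hc, hz]
            have : ∀ f ∈ D, K.b e f = 0 := by
              intro f hf
              unfold sides at hc
              exact Finset.sum_eq_zero_iff.1 hc f hf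
            simp [this]
          · rw [h e hc, hc]; rfl
          · rw [hz, hk' e hc, hc]; rfl
      · intro e he
        have hle := K.sides_le D e
        have hc : K.sides D e = 0 ∨ K.sides D e = 2 := by omega
        change ∑ f, (K.b e f : ZMod 2) * kx f = 0
        rw [hz]
        rcases hc with hc | hc
        · have : ∀ f ∈ D, K.b e f = 0 := by
            intro f hf
            unfold sides at hc
            exact Finset.sum_eq_zero_iff.1 hc f hf
          simp [this]
        · exact hk' e hc
      · intro v
        simp_rw [Finset.mul_sum]
        rw [Finset.sum_comm]
        refine Finset.sum_eq_zero fun f _ => ?_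
        simp_rw [← mul_assoc]
        rw [← Finset.sum_mul, K.closed, zero_mul]
    · rw [Submodule.span_le, Set.singleton_subset_iff]
      refine LinearMap.mem_ker.2 ?_
      ext e
      have := e.2
      unfold sides at this
      simp only [Matrix.mulVecLin_apply, Matrix.mulVec, dotProduct, Matrix.of_apply, mul_one,
        Pi.zero_apply]
      rw [Finset.sum_coe_sort D (fun f => (K.b e f : ZMod 2)), ← Nat.cast_sum, this]
      rfl
  rw [hker, finrank_span_singleton]
  obtain ⟨f, hf⟩ := hR.nonempty
  intro h
  exact one_ne_zero (congrFun h ⟨f, hf⟩)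

open Classical in
-- The kernel consists of the coboundaries of functions on `U`. An element, extended by zero, is a
-- cocycle of the whole complex, since faces outside `D` do not meet interior edges; so it is the
-- coboundary of a potential, which is constant on `C` and can be taken to vanish outside `U`.
lemma finrank_ker_sides_transpose {D : Finset F} {U C : Finset V} (hR : K.IsRegion D U C) :
    Module.finrank (ZMod 2) (LinearMap.ker (Matrix.mulVecLin
      (Matrix.of fun (e : {e // K.sides D e = 2}) (f : {f // f ∈ D}) =>
        (K.b e f : ZMod 2)).transpose)) = U.card := by
  set J : ({u // u ∈ U} → ZMod 2) →ₗ[ZMod 2] ({e // K.sides D e = 2} → ZMod 2) :=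
    Matrix.mulVecLin (Matrix.of fun e u => endInc K.ends u.1 e.1) with hJ
  have Jap : ∀ h e, J h e = ∑ u : {u // u ∈ U}, endInc K.ends u.1 e.1 * h u := by
    intro h e; simp [hJ, Matrix.mulVec, dotProduct]
  obtain ⟨v0, hv0⟩ := hR.cycle_nonempty
  have hv0U : v0 ∉ U := fun h => Finset.disjoint_left.1 hR.disjoint h hv0
  have hinj : Function.Injective J := by
    rw [← LinearMap.ker_eq_bot, LinearMap.ker_eq_bot']
    intro h hh
    have hc := K.conn (extendZero h) ?_
    · ext u
      have := hc u.1 v0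
      rwa [extendZero_coe, extendZero_of_not h hv0U] at this
    · intro e
      by_cases he : K.sides D e = 2
      · have := congrFun hh ⟨e, he⟩
        rw [Jap] at this
        rw [sum_mul_extendZero h (fun v => endInc K.ends v e)]
        exact this
      · refine Finset.sum_eq_zero fun v _ => ?_
        by_cases hv : v ∈ K.ends e
        · rw [extendZero_of_not h (hR.outside e v hv he), mul_zero]
        · simp [endInc, hv]
  have hrange : LinearMap.range J = LinearMap.ker (Matrix.mulVecLin
      (Matrix.of fun (e : {e // K.sides D e = 2}) (f : {f // f ∈ D}) =>
        (K.b e f : ZMod 2)).transpose) := by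
    apply le_antisymm
    · rintro _ ⟨h, rfl⟩
      refine LinearMap.mem_ker.2 ?_
      ext f
      simp only [Matrix.mulVecLin_apply, Matrix.mulVec, dotProduct, Matrix.of_apply,
        Matrix.transpose_apply, Pi.zero_apply, Jap]
      simp_rw [Finset.mul_sum]
      rw [Finset.sum_comm]
      refine Finset.sum_eq_zero fun u _ => ?_
      have h1 : ∑ e : {e // K.sides D e = 2}, endInc K.ends u.1 e.1 * (K.b e f : ZMod 2) = 0 := by
        rw [← K.closed f.1 u.1]
        refine sum_subtype_of_eq_zero (p := fun e => K.sides D e = 2)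
          (w := fun e => endInc K.ends u.1 e * (K.b e f.1 : ZMod 2)) fun e he => ?_
        have : u.1 ∉ K.ends e := fun h => hR.outside e u.1 h he u.2
        simp [endInc, this]
      rw [← zero_mul (h u), ← h1, Finset.sum_mul]
      exact Finset.sum_congr rfl fun e _ => by ring
    · intro g hg
      have hg' : ∀ f ∈ D, ∑ e : {e // K.sides D e = 2}, (K.b e f : ZMod 2) * g e = 0 := by
        intro f hf
        exact congrFun (LinearMap.mem_ker.1 hg) ⟨f, hf⟩
      obtain ⟨h0, hh0⟩ := K.coexact (extendZero g) (by
        intro f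
        rw [sum_mul_extendZero g (fun e => (K.b e f : ZMod 2))]
        by_cases hf : f ∈ D
        · exact hg' f hf
        · refine Finset.sum_eq_zero fun e _ => ?_
          rw [K.b_eq_zero_of_sides e.2 hf]; simp)
      set h : V → ZMod 2 := fun v => h0 v + h0 v0 with hh
      have hsum : ∀ e, ∑ v, endInc K.ends v e * h v = extendZero g e := by
        intro e
        obtain ⟨u, v, huv, he⟩ := K.exists_ends e
        rw [hh0, sum_endInc he huv, sum_endInc he huv]
        simp only [hh]
        have := CharTwo.add_self_eq_zero (h0 v0)
        linear_combination this
      have hC : ∀ v ∈ C, h v = 0 := by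
        intro v hv
        rw [hR.connected h (fun e he => by
          rw [hsum, extendZero_of_not g (by omega)]) v hv v0 hv0]
        exact CharTwo.add_self_eq_zero (h0 v0)
      -- The potential, cut off to zero on `U ∪ C`, has no coboundary: an interior edge has both
      -- ends in `U ∪ C`, and at the ends of the other edges the cut-off changes nothing.
      have hconst := K.conn (fun v => if v ∈ U ∨ v ∈ C then 0 else h v) (by
        intro e
        by_cases he : K.sides D e = 2
        · refine Finset.sum_eq_zero fun v _ => ?_
          by_cases hv : v ∈ K.ends e
          · simp [hR.inside e v hv he]
          · simp [endInc, hv]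
        · refine (Finset.sum_congr rfl fun v _ => ?_).trans
            ((hsum e).trans (extendZero_of_not g he))
          by_cases hv : v ∈ K.ends e
          · have h1 := hR.outside e v hv he
            by_cases h2 : v ∈ C
            · simp [h2, hC v h2]
            · simp [h1, h2]
          · simp [endInc, hv])
      have hU : ∀ v, v ∉ U → h v = 0 := by
        intro v hv
        by_cases h2 : v ∈ C
        · exact hC v h2
        · have := hconst v v0
          simpa [hv, h2, hv0] using this
      refine ⟨fun u => h u.1, ?_⟩
      ext e
      rw [Jap, ← extendZero_coe g e, ← hsum]
      exact sum_subtype_of_eq_zero (p := fun v => v ∈ U)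
        (w := fun v => endInc K.ends v e.1 * h v) fun v hv => by rw [hU v hv, mul_zero]
  rw [← hrange, LinearMap.finrank_range_of_inj hinj]
  simp

open Classical in
/-- Euler's formula for the interior of a simple cycle. -/
theorem IsRegion.card_add_card {D : Finset F} {U C : Finset V} (hR : K.IsRegion D U C) :
    U.card + D.card = (Finset.univ.filter fun e => K.sides D e = 2).card + 1 := by
  set M := (Matrix.of fun (e : {e // K.sides D e = 2}) (f : {f // f ∈ D}) =>
    (K.b e f : ZMod 2)) with hM
  have h1 := LinearMap.finrank_range_add_finrank_ker (Matrix.mulVecLin M)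
  have h2 := LinearMap.finrank_range_add_finrank_ker (Matrix.mulVecLin M.transpose)
  rw [finrank_ker_sides hR] at h1
  rw [finrank_ker_sides_transpose hR] at h2
  -- Row rank equals column rank: the number of faces minus one is the number of interior edges
  -- minus that of interior vertices.
  have h3 := Matrix.rank_transpose M
  unfold Matrix.rank at h3
  rw [h3] at h2
  simp only [Module.finrank_fintype_fun_eq_card, Fintype.card_coe] at h1 h2
  rw [Fintype.card_subtype] at h2
  omega

end DiscComplex
end Disc
-- Simple cycles, their interiors, and Kasteleyn's lemma.
namespace DiscComplex

variable {V E F : Type*} [Fintype V] [Fintype E] [Fintype F] {K : DiscComplex V E F}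

/-- A simple cycle of length `L`, with vertices `c 0, …, c L = c 0` and edges `ε 0, …, ε (L - 1)`. -/
structure IsSimpleCycle (K : DiscComplex V E F) (L : ℕ) (c : ℕ → V) (ε : ℕ → E) : Prop where
  -- Length two is needed: it occurs when a chord is parallel to an edge of the graph.
  two_le : 2 ≤ L
  vertex_inj : ∀ i < L, ∀ j < L, c i = c j → i = j
  edge_inj : ∀ i < L, ∀ j < L, ε i = ε j → i = j
  closes : c L = c 0
  ends_eq : ∀ k < L, K.ends (ε k) = s(c k, c (k + 1))

namespace IsSimpleCycle

variable {L : ℕ} {c : ℕ → V} {ε : ℕ → E}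

lemma succ_ne (hc : K.IsSimpleCycle L c ε) {k : ℕ} (hk : k < L) : c k ≠ c (k + 1) := by
  have := K.ends_ne (ε k)
  rw [hc.ends_eq k hk] at this
  simpa using this

open Classical in
lemma endInc_eq (hc : K.IsSimpleCycle L c ε) {k : ℕ} (hk : k < L) (v : V) :
    endInc K.ends v (ε k) = (if c k = v then 1 else 0) + (if c (k + 1) = v then 1 else 0) := by
  have hne := hc.succ_ne hk
  unfold endInc
  rw [hc.ends_eq k hk]
  by_cases h1 : c k = v
  · subst h1; simp [hne.symm]
  · by_cases h2 : c (k + 1) = v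
    · subst h2; simp [hne]
    · simp [h1, h2, Ne.symm h1, Ne.symm h2]

open Classical in
lemma sum_edges (hc : K.IsSimpleCycle L c ε) {M : Type*} [AddCommMonoid M] {z : E → M}
    (hz : ∀ e, (¬ ∃ k < L, ε k = e) → z e = 0) : ∑ e, z e = ∑ k ∈ Finset.range L, z (ε k) := by
  have h1 : ∑ e ∈ (Finset.range L).image ε, z e = ∑ k ∈ Finset.range L, z (ε k) := by
    rw [Finset.sum_image]
    intro i hi j hj h
    exact hc.edge_inj i (by simpa using hi) j (by simpa using hj) h
  rw [← h1]
  symm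
  apply Finset.sum_subset (Finset.subset_univ _)
  intro e _ he
  apply hz
  rintro ⟨k, hk, rfl⟩
  exact he (Finset.mem_image_of_mem _ (Finset.mem_range.2 hk))

open Classical in
lemma sum_endInc_mul (hc : K.IsSimpleCycle L c ε) {z : E → ZMod 2}
    (hz : ∀ e, (¬ ∃ k < L, ε k = e) → z e = 0) (v : V) :
    ∑ e, endInc K.ends v e * z e = (∑ k ∈ Finset.range L, if c k = v then z (ε k) else 0) +
      ∑ k ∈ Finset.range L, if c (k + 1) = v then z (ε k) else 0 := by
  rw [hc.sum_edges (fun e he => by rw [hz e he, mul_zero]), ← Finset.sum_add_distrib]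
  refine Finset.sum_congr rfl fun k hk => ?_
  rw [hc.endInc_eq (Finset.mem_range.1 hk), add_mul, ite_mul, ite_mul]
  simp only [one_mul, zero_mul]

open Classical in
-- Modulo two the cycle bounds a chain of faces, and `D` is its support. An edge has at most two
-- sides, so an odd number of sides in `D` means one.
lemma exists_sides (hc : K.IsSimpleCycle L c ε) :
    ∃ D : Finset F, ∀ e, K.sides D e = 1 ↔ ∃ k < L, ε k = e := by
  obtain ⟨k, hk⟩ := K.exact (fun e => if ∃ k < L, ε k = e then 1 else 0) (by
    intro v
    rw [hc.sum_endInc_mul (by intro e he; rw [if_neg he])]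
    have h1 : ∀ k ∈ Finset.range L, (if ∃ k' < L, ε k' = ε k then (1 : ZMod 2) else 0) = 1 := by
      intro k hk
      rw [if_pos ⟨k, Finset.mem_range.1 hk, rfl⟩]
    have h2 : ∀ p : ℕ → Prop, ∑ k ∈ Finset.range L,
        (if p k then (if ∃ k' < L, ε k' = ε k then (1 : ZMod 2) else 0) else 0) =
        ∑ k ∈ Finset.range L, (if p k then 1 else 0) := by
      intro p
      exact Finset.sum_congr rfl fun k hk => by rw [h1 k hk]
    rw [h2, h2]
    have h3 := Finset.sum_range_succ (fun k => if c k = v then (1 : ZMod 2) else 0) L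
    rw [Finset.sum_range_succ', hc.closes] at h3
    rw [← add_right_cancel h3]
    exact CharTwo.add_self_eq_zero _)
  refine ⟨Finset.univ.filter fun f => k f = 1, fun e => ?_⟩
  have h1 : (K.sides (Finset.univ.filter fun f => k f = 1) e : ZMod 2) =
      if ∃ k < L, ε k = e then 1 else 0 := by
    rw [← hk e]
    unfold sides
    rw [Nat.cast_sum, Finset.sum_filter]
    refine Finset.sum_congr rfl fun f _ => ?_
    have h01 : ∀ a : ZMod 2, a = 0 ∨ a = 1 := by decide
    rcases h01 (k f) with h | h <;> simp [h]
  have hle := K.sides_le (Finset.univ.filter fun f => k f = 1) e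
  generalize K.sides (Finset.univ.filter fun f => k f = 1) e = s at *
  split_ifs at h1 with h
  · refine ⟨fun _ => h, fun _ => ?_⟩
    interval_cases s
    · exact absurd h1 (by decide)
    · rfl
    · exact absurd h1 (by decide)
  · refine ⟨fun hs => ?_, fun h' => absurd h' h⟩
    subst hs
    exact absurd h1 (by decide)

open Classical in
/-- The interior of a simple cycle. -/
theorem exists_region (hc : K.IsSimpleCycle L c ε) :
    ∃ (D : Finset F) (U : Finset V), (∀ e, K.sides D e = 1 ↔ ∃ k < L, ε k = e) ∧
      K.IsRegion D U ((Finset.range L).image c) := by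
  obtain ⟨D, hD⟩ := hc.exists_sides
  have hL : 0 < L := by have := hc.two_le; omega
  -- The interior vertices are those off the cycle that meet an interior edge. By the link condition
  -- all edges at such a vertex are interior.
  refine ⟨D, Finset.univ.filter fun v => v ∉ (Finset.range L).image c ∧
    ∃ e, v ∈ K.ends e ∧ K.sides D e = 2, hD, ?_⟩
  have hlink : ∀ v, v ∉ (Finset.range L).image c →
      (∀ e, v ∈ K.ends e → K.sides D e = 2) ∨ (∀ e, v ∈ K.ends e → K.sides D e = 0) := by
    intro v hv
    refine K.link D v fun e he h1 => ?_
    obtain ⟨k, hk, rfl⟩ := (hD e).1 h1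
    rw [hc.ends_eq k hk] at he
    rcases Sym2.mem_iff.1 he with rfl | rfl
    · exact hv (Finset.mem_image_of_mem _ (Finset.mem_range.2 hk))
    · by_cases hk' : k + 1 < L
      · exact hv (Finset.mem_image_of_mem _ (Finset.mem_range.2 hk'))
      · have : k + 1 = L := by omega
        rw [this, hc.closes] at hv
        exact hv (Finset.mem_image_of_mem _ (Finset.mem_range.2 hL))
  refine ⟨?_, ?_, ?_, ?_, ?_, ?_, ?_⟩
  · have := (hD (ε 0)).2 ⟨0, hL, rfl⟩
    by_contra hne
    rw [Finset.not_nonempty_iff_eq_empty] at hne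
    simp [sides, hne] at this
  · intro z hz hcyc
    have hz' : ∀ e, (¬ ∃ k < L, ε k = e) → z e = 0 := fun e he =>
      hz e (fun h => he ((hD e).1 h))
    -- At a vertex of the cycle exactly two of its edges meet, so a cycle supported on it has the
    -- same coefficient on both.
    have hconst : ∀ k < L, z (ε k) = z (ε 0) := by
      intro k
      induction k with
      | zero => intro _; rfl
      | succ k ih =>
        intro hk
        have h := hcyc (c (k + 1))
        rw [hc.sum_endInc_mul hz'] at h
        have e1 : (∑ j ∈ Finset.range L, if c j = c (k + 1) then z (ε j) else 0) =
            z (ε (k + 1)) := by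
          rw [Finset.sum_eq_single (k + 1)]
          · simp
          · intro j hj hjk
            rw [if_neg]
            intro h'
            exact hjk (hc.vertex_inj j (Finset.mem_range.1 hj) _ hk h')
          · intro h'; exact absurd (Finset.mem_range.2 hk) h'
        have e2 : (∑ j ∈ Finset.range L, if c (j + 1) = c (k + 1) then z (ε j) else 0) =
            z (ε k) := by
          rw [Finset.sum_eq_single k]
          · simp
          · intro j hj hjk
            rw [if_neg]
            intro h'
            have hj := Finset.mem_range.1 hj
            by_cases hj' : j + 1 < L
            · have := hc.vertex_inj _ hj' _ hk h'; omega
            · have : j + 1 = L := by omega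
              rw [this, hc.closes] at h'
              have := hc.vertex_inj _ hL _ hk h'; omega
          · intro h'; exact absurd (Finset.mem_range.2 (by omega)) h'
        rw [e1, e2, CharTwo.add_eq_zero] at h
        rw [h, ih (by omega)]
    have h01 : ∀ a : ZMod 2, a = 0 ∨ a = 1 := by decide
    rcases h01 (z (ε 0)) with h | h
    · left
      intro e
      by_cases he : ∃ k < L, ε k = e
      · obtain ⟨k, hk, rfl⟩ := he
        rw [hconst k hk, h]
      · exact hz' e he
    · right
      intro e he
      obtain ⟨k, hk, rfl⟩ := (hD e).1 he
      rw [hconst k hk, h]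
  · intro h hh
    have hconst : ∀ k < L, h (c k) = h (c 0) := by
      intro k
      induction k with
      | zero => intro _; rfl
      | succ k ih =>
        intro hk
        have := hh (ε k) ((hD _).2 ⟨k, by omega, rfl⟩)
        rw [sum_endInc (hc.ends_eq k (by omega)) (hc.succ_ne (by omega)),
          CharTwo.add_eq_zero] at this
        rw [← this, ih (by omega)]
    intro u hu v hv
    obtain ⟨i, hi, rfl⟩ := Finset.mem_image.1 hu
    obtain ⟨j, hj, rfl⟩ := Finset.mem_image.1 hv
    rw [hconst i (Finset.mem_range.1 hi), hconst j (Finset.mem_range.1 hj)]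
  · exact ⟨c 0, Finset.mem_image_of_mem _ (Finset.mem_range.2 hL)⟩
  · rw [Finset.disjoint_left]
    intro v hv
    exact (Finset.mem_filter.1 hv).2.1
  · intro e v he hs hv
    obtain ⟨hvC, e', he', hs'⟩ := (Finset.mem_filter.1 hv).2
    rcases hlink v hvC with h | h
    · exact hs (h e he)
    · have := h e' he'; omega
  · intro e v he hs
    by_cases hv : v ∈ (Finset.range L).image c
    · exact Or.inr hv
    · exact Or.inl (Finset.mem_filter.2 ⟨Finset.mem_univ _, hv, e, he, hs⟩)

open Classical in
/-- The product of Kasteleyn signs along a simple cycle, in terms of the number of vertices in its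
interior. -/
theorem prod_phase (hc : K.IsSimpleCycle L c ε) {D : Finset F} {U : Finset V}
    (hD : ∀ e, K.sides D e = 1 ↔ ∃ k < L, ε k = e)
    (hR : K.IsRegion D U ((Finset.range L).image c)) {m : ℕ} (hm : L = 2 * m)
    (x : E → ℤˣ) (n : F → ℕ) (hn : ∀ f, ∑ e, K.b e f = 2 * n f)
    (hx : ∀ f, ∏ e, x e ^ K.b e f = (-1) ^ (n f + 1)) :
    ∏ k ∈ Finset.range L, x (ε k) = (-1) ^ (m + 1 + U.card) := by
  have hinj : Set.InjOn ε (Finset.range L) := by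
    intro i hi j hj h
    exact hc.edge_inj i (by simpa using hi) j (by simpa using hj) h
  have himg : Finset.univ.filter (fun e => K.sides D e = 1) = (Finset.range L).image ε := by
    ext e; simp [hD]
  -- In the product of the face conditions over `D`, interior edges occur squared and only the cycle
  -- remains.
  have h1 : ∏ f ∈ D, ∏ e, x e ^ K.b e f = ∏ k ∈ Finset.range L, x (ε k) := by
    rw [Finset.prod_comm, ← Finset.prod_image hinj, ← himg, Finset.prod_filter]
    refine Finset.prod_congr rfl fun e _ => ?_
    rw [Finset.prod_pow_eq_pow_sum]
    have hle := K.sides_le D e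
    change x e ^ K.sides D e = _
    generalize K.sides D e = s at *
    interval_cases s
    · simp
    · simp
    · simp [Int.units_sq]
  -- Both sides count the sides of the faces of `D`: once for each edge of the cycle, twice for each
  -- interior edge.
  have h2 : 2 * ∑ f ∈ D, n f = L + 2 * (Finset.univ.filter fun e => K.sides D e = 2).card := by
    rw [Finset.mul_sum]
    have : ∑ f ∈ D, 2 * n f = ∑ e, K.sides D e := by
      unfold sides
      rw [Finset.sum_comm]
      exact Finset.sum_congr rfl fun f _ => (hn f).symm
    rw [this]
    have hL : L = (Finset.univ.filter (fun e => K.sides D e = 1)).card := by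
      rw [himg, Finset.card_image_of_injOn hinj, Finset.card_range]
    conv_rhs => rw [hL]
    rw [Finset.card_filter, Finset.card_filter, Finset.mul_sum, ← Finset.sum_add_distrib]
    refine Finset.sum_congr rfl fun e _ => ?_
    have hle := K.sides_le D e
    generalize K.sides D e = s at *
    interval_cases s <;> simp
  rw [← h1, Finset.prod_congr rfl fun f _ => hx f, Finset.prod_pow_eq_pow_sum,
    Finset.sum_add_distrib, Finset.sum_const, smul_eq_mul, mul_one]
  have h3 := hR.card_add_card
  -- Euler's formula for the interior trades the faces for the interior vertices, up to an even
  -- number.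
  have h4 : (∑ f ∈ D, n f) + D.card + 2 * U.card =
      m + 1 + U.card + 2 * (Finset.univ.filter fun e => K.sides D e = 2).card := by
    convert (show (∑ f ∈ D, n f) + D.card + 2 * U.card =
      m + 1 + U.card + 2 * (Finset.univ.filter fun e => K.sides D e = 2).card from by omega)
  have h5 : ∀ a b : ℕ, (-1 : ℤˣ) ^ (a + 2 * b) = (-1) ^ a := by
    intro a b
    rw [pow_add, pow_mul]; simp
  rw [← h5 _ U.card, h4, h5]

end IsSimpleCycle
end DiscComplex

/-! ### The disc complex of a plane embedding -/

section PlaneComplex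

set_option linter.unusedSectionVars false

open scoped Classical

variable {V : Type*} [Fintype V] {G : SimpleGraph V}

/-- The edge of a dart, as an element of the edge set. -/
def edgeOf (d : G.Dart) : G.edgeSet := ⟨d.edge, d.edge_mem⟩

lemma edgeOf_symm (d : G.Dart) : edgeOf d.symm = edgeOf d := Subtype.ext d.edge_symm

lemma exists_edgeOf (e : G.edgeSet) : ∃ d : G.Dart, edgeOf d = e := by
  obtain ⟨e, he⟩ := e
  induction e with
  | h u v => exact ⟨⟨(u, v), he⟩, rfl⟩

/-- The number of darts of an edge with a given property. -/
def dartCount (p : G.Dart → Prop) (e : G.edgeSet) : ℕ :=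
  ∑ d ∈ Finset.univ.filter (fun d : G.Dart => edgeOf d = e), if p d then 1 else 0

lemma filter_edgeOf (d : G.Dart) :
    Finset.univ.filter (fun d' : G.Dart => edgeOf d' = edgeOf d) = {d, d.symm} := by
  ext d'
  simp [edgeOf, Subtype.ext_iff, SimpleGraph.dart_edge_eq_iff]

lemma sum_edgeOf {M : Type*} [AddCommMonoid M] (g : G.Dart → M) (d : G.Dart) :
    ∑ d' ∈ Finset.univ.filter (fun d' : G.Dart => edgeOf d' = edgeOf d), g d' =
      g d + g d.symm := by
  rw [filter_edgeOf, Finset.sum_pair d.symm_ne.symm]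

lemma dartCount_edgeOf (p : G.Dart → Prop) (d : G.Dart) :
    dartCount p (edgeOf d) = (if p d then 1 else 0) + (if p d.symm then 1 else 0) :=
  sum_edgeOf _ d

lemma sum_fiber_edgeOf {M : Type*} [AddCommMonoid M] (g : G.Dart → M) :
    ∑ e, ∑ d ∈ Finset.univ.filter (fun d : G.Dart => edgeOf d = e), g d = ∑ d, g d :=
  Finset.sum_fiberwise _ _ _

lemma sum_mul_dartCount {R : Type*} [CommSemiring R] (p : G.Dart → Prop) (w : G.edgeSet → R) :
    ∑ e, w e * (dartCount p e : R) = ∑ d, if p d then w (edgeOf d) else 0 := by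
  rw [← sum_fiber_edgeOf]
  refine Finset.sum_congr rfl fun e _ => ?_
  unfold dartCount
  rw [Nat.cast_sum, Finset.mul_sum]
  refine Finset.sum_congr rfl fun d hd => ?_
  rw [(Finset.mem_filter.1 hd).2]
  split_ifs <;> simp

/-- The endpoints of an edge. -/
def edgeEnds (e : G.edgeSet) : Sym2 V := e.1

lemma edgeEnds_edgeOf (d : G.Dart) : edgeEnds (edgeOf d) = s(d.fst, d.snd) := rfl

lemma endInc_edgeOf (v : V) (d : G.Dart) :
    endInc edgeEnds v (edgeOf d) = (if d.fst = v then 1 else 0) + if d.snd = v then 1 else 0 := by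
  have h := d.fst_ne_snd
  unfold endInc
  rw [edgeEnds_edgeOf]
  by_cases h1 : d.fst = v
  · subst h1; simp [h.symm]
  · by_cases h2 : d.snd = v
    · subst h2; simp [h]
    · simp [h1, h2, Ne.symm h1, Ne.symm h2]

namespace PlaneEmbedding

variable (M : PlaneEmbedding G)

lemma next_fst (d : G.Dart) : (M.next d).fst = d.snd := by
  have h := M.rot_fst (M.rot.symm d.symm)
  rw [Equiv.apply_symm_apply] at h
  exact h.symm

/-- Crossing a dart and then advancing along the face turns clockwise around its origin. Functions
of the faces are carried around a vertex in this way. -/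
lemma next_symm (d : G.Dart) : M.next d.symm = M.rot.symm d := by
  change M.rot.symm d.symm.symm = _
  rw [d.symm_symm]

/-- Darts with the same origin have the same value under a function that is constant around that
origin. -/
lemma eq_of_fst_eq {β : Type*} (f : G.Dart → β) (v : V)
    (h : ∀ d, d.fst = v → f (M.next d.symm) = f d) (d d' : G.Dart) (hd : d.fst = v)
    (hd' : d'.fst = v) : f d = f d' := by
  obtain ⟨n, hn⟩ := (M.rot_sameCycle d d' (hd.trans hd'.symm)).exists_nat_pow_eq
  have key : ∀ n, ((M.rot ^ n) d).fst = v ∧ f ((M.rot ^ n) d) = f d := by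
    intro n
    induction n with
    | zero => exact ⟨hd, rfl⟩
    | succ n ih =>
      have h1 : (M.rot ^ (n + 1)) d = M.rot ((M.rot ^ n) d) := by rw [pow_succ']; rfl
      have h2 : ((M.rot ^ (n + 1)) d).fst = v := by rw [h1, M.rot_fst, ih.1]
      refine ⟨h2, ?_⟩
      have h3 := h _ h2
      rw [next_symm, h1, Equiv.symm_apply_apply] at h3
      rw [h1, ← h3, ih.2]
  rw [← hn, (key n).2]

/-- The faces of a plane embedding that are seen by a dart. -/
abbrev Face := Quotient (Equiv.Perm.SameCycle.setoid M.next)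

/-- The face on the left of a dart. -/
def faceOf (d : G.Dart) : M.Face := Quotient.mk _ d

lemma faceOf_eq {d d' : G.Dart} : M.faceOf d = M.faceOf d' ↔ M.next.SameCycle d d' :=
  Quotient.eq (r := Equiv.Perm.SameCycle.setoid M.next)

lemma faceOf_next (d : G.Dart) : M.faceOf (M.next d) = M.faceOf d :=
  M.faceOf_eq.2 (Equiv.Perm.sameCycle_apply_left.2 (Equiv.Perm.SameCycle.refl _ _))

/-- The bounded faces. -/
abbrev BoundedFace := {q : M.Face // ∀ d ∈ M.outer, M.faceOf d ≠ q}

/-- The face on the left of a dart is the given bounded face. -/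
def HasFace (f : M.BoundedFace) (d : G.Dart) : Prop := M.faceOf d = f.1

lemma mem_outer_iff {d₀ d : G.Dart} (h₀ : d₀ ∈ M.outer) :
    d ∈ M.outer ↔ M.faceOf d₀ = M.faceOf d := by
  rw [M.outer_isFace d₀ h₀ d, faceOf_eq]; rfl

lemma next_mem_outer {d : G.Dart} (h : d ∈ M.outer) : M.next d ∈ M.outer := by
  rw [M.mem_outer_iff h, faceOf_next]

lemma HasFace.not_mem_outer {f : M.BoundedFace} {d : G.Dart} (h : M.HasFace f d) :
    d ∉ M.outer := fun h' => f.2 d h' h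

lemma hasFace_next {f : M.BoundedFace} {d : G.Dart} : M.HasFace f (M.next d) ↔ M.HasFace f d := by
  unfold HasFace; rw [faceOf_next]

lemma exists_hasFace {d : G.Dart} (h : d ∉ M.outer) : ∃ f, M.HasFace f d := by
  refine ⟨⟨M.faceOf d, fun d' hd' h' => h ?_⟩, rfl⟩
  rw [M.mem_outer_iff hd', h']

lemma HasFace.unique {f f' : M.BoundedFace} {d : G.Dart} (h : M.HasFace f d)
    (h' : M.HasFace f' d) : f = f' := Subtype.ext (h.symm.trans h')

instance : Fintype M.BoundedFace := Fintype.ofFinite _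

/-- The number of sides of an edge on a bounded face. -/
def faceSides (e : G.edgeSet) (f : M.BoundedFace) : ℕ := dartCount (M.HasFace f) e

/-- The value at a dart of a function on the bounded faces, extended by zero. -/
def dartValue (k : M.BoundedFace → ZMod 2) (d : G.Dart) : ZMod 2 :=
  ∑ f, if M.HasFace f d then k f else 0

lemma sum_faceSides_mul (k : M.BoundedFace → ZMod 2) (d : G.Dart) :
    ∑ f, (M.faceSides (edgeOf d) f : ZMod 2) * k f = M.dartValue k d + M.dartValue k d.symm := by
  unfold dartValue
  rw [← Finset.sum_add_distrib]
  refine Finset.sum_congr rfl fun f _ => ?_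
  unfold faceSides
  rw [dartCount_edgeOf]
  by_cases h1 : M.HasFace f d <;> by_cases h2 : M.HasFace f d.symm <;> simp [h1, h2]
  ring

lemma dartValue_next (k : M.BoundedFace → ZMod 2) (d : G.Dart) :
    M.dartValue k (M.next d) = M.dartValue k d := by
  unfold dartValue; simp only [hasFace_next]

lemma dartValue_of_hasFace (k : M.BoundedFace → ZMod 2) {d : G.Dart} {f : M.BoundedFace}
    (h : M.HasFace f d) : M.dartValue k d = k f := by
  unfold dartValue
  rw [Finset.sum_eq_single f]
  · simp [h]
  · intro f' _ hf'
    rw [if_neg]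
    intro h'; exact hf' (HasFace.unique M h' h)
  · simp

lemma dartValue_outer (k : M.BoundedFace → ZMod 2) {d : G.Dart} (h : d ∈ M.outer) :
    M.dartValue k d = 0 := by
  unfold dartValue
  refine Finset.sum_eq_zero fun f _ => ?_
  rw [if_neg]
  exact fun h' => HasFace.not_mem_outer M h' h

/-- The boundary of a face enters a vertex as often as it leaves it: `next` maps the darts of the
face that end at `v` bijectively to those that start there. -/
lemma sum_closed (f : M.BoundedFace) (v : V) :
    ∑ e, endInc edgeEnds v e * (M.faceSides e f : ZMod 2) = 0 := by
  unfold faceSides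
  rw [sum_mul_dartCount]
  simp only [endInc_edgeOf]
  have h1 : ∑ d : G.Dart, (if M.HasFace f d then (if d.snd = v then (1 : ZMod 2) else 0) else 0) =
      ∑ d : G.Dart, (if M.HasFace f d then (if d.fst = v then (1 : ZMod 2) else 0) else 0) := by
    rw [← Equiv.sum_comp M.next (fun d : G.Dart =>
      (if M.HasFace f d then (if d.fst = v then (1 : ZMod 2) else 0) else 0))]
    simp only [hasFace_next, next_fst]
  have h2 : ∀ d : G.Dart, (if M.HasFace f d then ((if d.fst = v then (1 : ZMod 2) else 0) +
      if d.snd = v then 1 else 0) else 0) =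
      (if M.HasFace f d then (if d.fst = v then (1 : ZMod 2) else 0) else 0) +
      (if M.HasFace f d then (if d.snd = v then (1 : ZMod 2) else 0) else 0) := by
    intro d; split_ifs <;> simp
  simp only [h2, Finset.sum_add_distrib, h1]
  exact CharTwo.add_self_eq_zero _

variable {M}

lemma const_of_adj (hG : G.Connected) {β : Type*} (h : V → β)
    (hh : ∀ u v, G.Adj u v → h u = h v) (u v : V) : h u = h v := by
  obtain ⟨p⟩ := hG.preconnected u v
  induction p with
  | nil => rfl
  | cons hadj _ ih => rw [hh _ _ hadj, ih]

lemma conn_of_connected (hG : G.Connected) (h : V → ZMod 2)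
    (hh : ∀ e : G.edgeSet, ∑ v, endInc edgeEnds v e * h v = 0) (u v : V) : h u = h v := by
  refine const_of_adj hG h (fun u v huv => ?_) u v
  have := hh (edgeOf ⟨(u, v), huv⟩)
  rw [sum_endInc (edgeEnds_edgeOf _) (SimpleGraph.Dart.fst_ne_snd _)] at this
  exact CharTwo.add_eq_zero.1 this

/-- The values on the two sides of each edge agree, hence they agree all around each vertex and, by
connectedness, everywhere. On the external face the value is zero. -/
lemma inj_of_connected (hG : G.Connected) (M : PlaneEmbedding G) (k : M.BoundedFace → ZMod 2)
    (hk : ∀ e, ∑ f, (M.faceSides e f : ZMod 2) * k f = 0) : k = 0 := by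
  by_cases hne : Nonempty G.Dart
  · obtain ⟨d₀, hd₀⟩ := M.outer_nonempty hne
    have hsymm : ∀ d, M.dartValue k d.symm = M.dartValue k d := fun d => by
      have := hk (edgeOf d)
      rw [sum_faceSides_mul] at this
      exact (CharTwo.add_eq_zero.1 this).symm
    have hfst : ∀ d d' : G.Dart, d.fst = d'.fst → M.dartValue k d = M.dartValue k d' :=
      fun d d' h => M.eq_of_fst_eq (M.dartValue k) d'.fst
        (fun d _ => by rw [dartValue_next, hsymm]) d d' h rfl
    have hall : ∀ d, M.dartValue k d = 0 := by
      intro d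
      rw [← M.dartValue_outer k hd₀]
      have hex : ∀ v, ∃ d : G.Dart, d.fst = v := by
        intro v
        have : Nontrivial V := ⟨d₀.fst, d₀.snd, d₀.fst_ne_snd⟩
        obtain ⟨w, hw⟩ := hG.preconnected.exists_adj_of_nontrivial v
        exact ⟨⟨(v, w), hw⟩, rfl⟩
      choose D hD using hex
      have := const_of_adj hG (fun v => M.dartValue k (D v)) (fun u v huv => by
        rw [hfst (D u) ⟨(u, v), huv⟩ (hD u), hfst (D v) (SimpleGraph.Dart.symm ⟨(u, v), huv⟩)
          (hD v), hsymm]) d.fst d₀.fst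
      rw [hfst d (D d.fst) (hD _).symm, this, hfst _ _ (hD d₀.fst)]
    ext f
    obtain ⟨q, hq⟩ := f
    induction q using Quotient.inductionOn with
    | h d =>
      rw [← M.dartValue_of_hasFace k (d := d) (f := ⟨_, hq⟩) rfl, hall]; rfl
  · ext f
    obtain ⟨q, hq⟩ := f
    induction q using Quotient.inductionOn with
    | h d => exact absurd ⟨d⟩ hne

end PlaneEmbedding
end PlaneComplex

/-! ### Exactness modulo two from Euler's formula. -/

section PlaneComplexExact
set_option linter.unusedSectionVars false

open scoped Classical

variable {V : Type*} [Fintype V] {G : SimpleGraph V}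
namespace PlaneEmbedding

variable {M : PlaneEmbedding G}

/-- As there is a dart, the maximum with `1` in `euler` has no effect; the external face accounts
for the remaining unit. -/
lemma card_boundedFace {d₀ : G.Dart} (h₀ : d₀ ∈ M.outer) :
    Fintype.card V + Fintype.card M.BoundedFace + 1 = Fintype.card G.edgeSet + 2 := by
  have h1 : Fintype.card M.BoundedFace = Fintype.card {q : M.Face // ¬ q = M.faceOf d₀} := by
    refine Fintype.card_congr (Equiv.subtypeEquivRight fun q => ⟨fun h h' => h d₀ h₀ h'.symm,
      fun h d hd h' => h ?_⟩)
    rw [(M.mem_outer_iff h₀).1 hd, h']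
  have h2 := Fintype.card_subtype_compl (fun q : M.Face => q = M.faceOf d₀)
  rw [Fintype.card_subtype_eq] at h2
  have h3 := M.euler
  change Fintype.card V + max 1 (Nat.card M.Face) = _ at h3
  have h4 : 0 < Fintype.card M.Face := Fintype.card_pos_iff.2 ⟨M.faceOf d₀⟩
  rw [Nat.card_eq_fintype_card, Nat.card_eq_fintype_card] at h3
  omega

/-- The boundary matrix from edges to vertices. -/
def vertexMatrix : Matrix V G.edgeSet (ZMod 2) := Matrix.of (endInc edgeEnds)

variable (M) in
/-- The boundary matrix from bounded faces to edges. -/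
def faceMatrix : Matrix G.edgeSet M.BoundedFace (ZMod 2) :=
  Matrix.of fun e f => (M.faceSides e f : ZMod 2)

lemma vertexMatrix_mul_faceMatrix : vertexMatrix (G := G) * M.faceMatrix = 0 := by
  ext v f
  exact M.sum_closed f v

/-- By connectedness the kernel of the transpose consists of the constants. -/
lemma rank_vertexMatrix (hG : G.Connected) :
    (vertexMatrix (G := G)).rank + 1 = Fintype.card V := by
  have h1 : LinearMap.ker (vertexMatrix (G := G)).transpose.mulVecLin =
      Submodule.span (ZMod 2) {fun _ => 1} := by
    apply le_antisymm
    · intro h hh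
      have hc := conn_of_connected hG h fun e => congrFun (LinearMap.mem_ker.1 hh) e
      obtain ⟨v₀⟩ := hG.nonempty
      refine Submodule.mem_span_singleton.2 ⟨h v₀, ?_⟩
      ext v
      simp [hc v v₀]
    · rw [Submodule.span_le, Set.singleton_subset_iff]
      refine LinearMap.mem_ker.2 ?_
      ext e
      obtain ⟨d, rfl⟩ := exists_edgeOf e
      exact (sum_endInc (edgeEnds_edgeOf d) d.fst_ne_snd (fun _ => 1)).trans (by rfl)
  have h2 := LinearMap.finrank_range_add_finrank_ker (vertexMatrix (G := G)).transpose.mulVecLin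
  have h3 := Matrix.rank_transpose (vertexMatrix (G := G))
  rw [Matrix.rank] at h3
  rw [h3, h1, finrank_span_singleton, Module.finrank_fintype_fun_eq_card] at h2
  · exact h2
  · obtain ⟨v₀⟩ := hG.nonempty
    exact fun h => one_ne_zero (congrFun h v₀)

lemma rank_faceMatrix (hG : G.Connected) (M : PlaneEmbedding G) :
    M.faceMatrix.rank = Fintype.card M.BoundedFace := by
  rw [Matrix.rank, LinearMap.finrank_range_of_inj, Module.finrank_fintype_fun_eq_card]
  rw [← LinearMap.ker_eq_bot, LinearMap.ker_eq_bot']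
  intro k hk
  exact inj_of_connected hG M k fun e => congrFun hk e

/-- Boundaries of chains are cycles, and by Euler's formula the two spaces have the same dimension.
Without darts there is no edge to consider. -/
lemma exact_of_connected (hG : G.Connected) (M : PlaneEmbedding G) (z : G.edgeSet → ZMod 2)
    (hz : ∀ v, ∑ e, endInc edgeEnds v e * z e = 0) :
    ∃ k : M.BoundedFace → ZMod 2, ∀ e, ∑ f, (M.faceSides e f : ZMod 2) * k f = z e := by
  by_cases hne : Nonempty G.Dart
  · obtain ⟨d₀, hd₀⟩ := M.outer_nonempty hne
    have hcard := card_boundedFace hd₀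
    have hle : LinearMap.range M.faceMatrix.mulVecLin ≤
        LinearMap.ker (vertexMatrix (G := G)).mulVecLin := by
      rintro _ ⟨k, rfl⟩
      rw [LinearMap.mem_ker, Matrix.mulVecLin_apply, Matrix.mulVecLin_apply, Matrix.mulVec_mulVec,
        vertexMatrix_mul_faceMatrix, Matrix.zero_mulVec]
    have h1 := LinearMap.finrank_range_add_finrank_ker (vertexMatrix (G := G)).mulVecLin
    have h2 := rank_vertexMatrix hG
    have h3 := rank_faceMatrix hG M
    rw [Matrix.rank] at h2 h3
    rw [Module.finrank_fintype_fun_eq_card] at h1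
    have heq := Submodule.eq_of_le_of_finrank_eq hle (by omega)
    have hz' : z ∈ LinearMap.ker (vertexMatrix (G := G)).mulVecLin :=
      LinearMap.mem_ker.2 (funext hz)
    rw [← heq] at hz'
    obtain ⟨k, hk⟩ := hz'
    exact ⟨k, fun e => congrFun hk e⟩
  · refine ⟨0, fun e => ?_⟩
    obtain ⟨d, rfl⟩ := exists_edgeOf e
    exact absurd ⟨d⟩ hne

/-- The dual dimension count: coboundaries lie in the space of cocycles, and by Euler's formula both
have dimension `#V - 1`. -/
lemma coexact_of_connected (hG : G.Connected) (M : PlaneEmbedding G) (g : G.edgeSet → ZMod 2)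
    (hg : ∀ f, ∑ e, (M.faceSides e f : ZMod 2) * g e = 0) :
    ∃ h : V → ZMod 2, ∀ e, g e = ∑ v, endInc edgeEnds v e * h v := by
  by_cases hne : Nonempty G.Dart
  · obtain ⟨d₀, hd₀⟩ := M.outer_nonempty hne
    have hcard := card_boundedFace hd₀
    have hle : LinearMap.range (vertexMatrix (G := G)).transpose.mulVecLin ≤
        LinearMap.ker M.faceMatrix.transpose.mulVecLin := by
      rintro _ ⟨k, rfl⟩
      rw [LinearMap.mem_ker, Matrix.mulVecLin_apply, Matrix.mulVecLin_apply, Matrix.mulVec_mulVec,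
        ← Matrix.transpose_mul, vertexMatrix_mul_faceMatrix, Matrix.transpose_zero,
        Matrix.zero_mulVec]
    have h1 := LinearMap.finrank_range_add_finrank_ker M.faceMatrix.transpose.mulVecLin
    have h2 := rank_vertexMatrix hG
    have h3 := rank_faceMatrix hG M
    rw [← Matrix.rank_transpose, Matrix.rank] at h2 h3
    rw [Module.finrank_fintype_fun_eq_card] at h1
    have heq := Submodule.eq_of_le_of_finrank_eq hle (by omega)
    have hz' : g ∈ LinearMap.ker M.faceMatrix.transpose.mulVecLin :=
      LinearMap.mem_ker.2 (funext hg)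
    rw [← heq] at hz'
    obtain ⟨k, hk⟩ := hz'
    exact ⟨k, fun e => (congrFun hk e).symm⟩
  · refine ⟨0, fun e => ?_⟩
    obtain ⟨d, rfl⟩ := exists_edgeOf e
    exact absurd ⟨d⟩ hne

lemma sum_faceSides (d : G.Dart) (D : Finset M.BoundedFace) :
    ∑ f ∈ D, M.faceSides (edgeOf d) f =
      (if ∃ f ∈ D, M.HasFace f d then 1 else 0) +
        (if ∃ f ∈ D, M.HasFace f d.symm then 1 else 0) := by
  have h1 : ∀ d : G.Dart, ∑ f ∈ D, (if M.HasFace f d then 1 else 0) =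
      if ∃ f ∈ D, M.HasFace f d then 1 else 0 := by
    intro d
    split_ifs with h
    · obtain ⟨f, hf, hd⟩ := h
      rw [Finset.sum_eq_single f]
      · simp [hd]
      · intro f' _ hne
        rw [if_neg]
        exact fun h' => hne (HasFace.unique M h' hd)
      · exact fun h' => absurd hf h'
    · refine Finset.sum_eq_zero fun f hf => ?_
      rw [if_neg]
      exact fun h' => h ⟨f, hf, h'⟩
  rw [← h1, ← h1, ← Finset.sum_add_distrib]
  exact Finset.sum_congr rfl fun f _ => dartCount_edgeOf _ _

lemma exists_dart_of_mem {v : V} {e : G.edgeSet} (h : v ∈ edgeEnds e) :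
    ∃ d : G.Dart, d.fst = v ∧ edgeOf d = e := by
  obtain ⟨d, rfl⟩ := exists_edgeOf e
  rw [edgeEnds_edgeOf] at h
  rcases Sym2.mem_iff.1 h with h | h
  · exact ⟨d, h.symm, rfl⟩
  · exact ⟨d.symm, h.symm, edgeOf_symm d⟩

lemma fst_mem_edgeEnds (d : G.Dart) : d.fst ∈ edgeEnds (edgeOf d) := by
  rw [edgeEnds_edgeOf]; simp

/-- If the two sides of each dart at `v` agree under `p`, and `p` does not change at the corners at
`v`, then `p` is constant around `v`. -/
lemma link_aux (M : PlaneEmbedding G) (p : G.Dart → Prop) (v : V)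
    (h1 : ∀ d : G.Dart, d.fst = v → (p d ↔ p d.symm))
    (h2 : ∀ d : G.Dart, d.snd = v → (p (M.next d) ↔ p d)) :
    (∀ d : G.Dart, d.fst = v → p d) ∨ (∀ d : G.Dart, d.fst = v → ¬ p d) := by
  by_cases h : ∃ d : G.Dart, d.fst = v ∧ p d
  · obtain ⟨d, hd, hp⟩ := h
    left
    intro d' hd'
    rw [M.eq_of_fst_eq p v (fun d hd => by
      rw [h2 d.symm hd, h1 d hd]) d' d hd' hd]
    exact hp
  · right
    intro d hd hp
    exact h ⟨d, hd, hp⟩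

/-- The disc complex formed by the bounded faces of a plane embedding. -/
def complex (M : PlaneEmbedding G) (hG : G.Connected) :
    DiscComplex V G.edgeSet M.BoundedFace where
  ends := edgeEnds
  b := M.faceSides
  ends_ne e := by
    obtain ⟨d, rfl⟩ := exists_edgeOf e
    rw [edgeEnds_edgeOf]
    simp
  sum_le e := by
    obtain ⟨d, rfl⟩ := exists_edgeOf e
    rw [sum_faceSides]
    split_ifs <;> omega
  closed := M.sum_closed
  exact := exact_of_connected hG M
  inj := inj_of_connected hG M
  coexact := coexact_of_connected hG M
  conn := conn_of_connected hG
  -- If no edge at `v` has exactly one side in `D`, membership of the left face in `D` is preserved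
  -- when an edge at `v` is crossed, and so it is constant around `v`.
  link D v hD := by
    have key := link_aux M (fun d => ∃ f ∈ D, M.HasFace f d) v (fun d hd => by
      have := hD (edgeOf d) (hd ▸ fst_mem_edgeEnds d)
      rw [sum_faceSides] at this
      by_cases h1 : ∃ f ∈ D, M.HasFace f d <;> by_cases h2 : ∃ f ∈ D, M.HasFace f d.symm <;>
        simp [h1, h2] at this ⊢) (fun d _ => by simp only [hasFace_next])
    have hsw : ∀ d : G.Dart, d.fst = v →
        ((∃ f ∈ D, M.HasFace f d) ↔ ∃ f ∈ D, M.HasFace f d.symm) := by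
      intro d hd
      have := hD (edgeOf d) (hd ▸ fst_mem_edgeEnds d)
      rw [sum_faceSides] at this
      by_cases h1 : ∃ f ∈ D, M.HasFace f d <;> by_cases h2 : ∃ f ∈ D, M.HasFace f d.symm <;>
        simp [h1, h2] at this ⊢
    rcases key with h | h
    · left
      intro e he
      obtain ⟨d, hd, rfl⟩ := exists_dart_of_mem he
      have h1 := h d hd
      rw [sum_faceSides, if_pos h1, if_pos ((hsw d hd).1 h1)]
    · right
      intro e he
      obtain ⟨d, hd, rfl⟩ := exists_dart_of_mem he
      have h1 := h d hd
      rw [sum_faceSides, if_neg h1, if_neg (fun h' => h1 ((hsw d hd).2 h'))]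

end PlaneEmbedding
end PlaneComplexExact

/-! ### A chord drawn in the external face. -/

section AugmentedComplex
set_option linter.unusedSectionVars false

open scoped Classical

variable {V : Type*} [Fintype V] {G : SimpleGraph V}

namespace PlaneEmbedding

/-- A path `q 0, …, q ℓ` on the boundary of the external face, with darts `a 0, …, a (ℓ - 1)`. -/
structure IsOuterPath (M : PlaneEmbedding G) (ℓ : ℕ) (q : ℕ → V) (a : ℕ → G.Dart) : Prop where
  pos : 0 < ℓ
  inj : ∀ i ≤ ℓ, ∀ j ≤ ℓ, q i = q j → i = j
  outer : ∀ t < ℓ, a t ∈ M.outer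
  fst : ∀ t < ℓ, (a t).fst = q t
  snd : ∀ t < ℓ, (a t).snd = q (t + 1)
  next : ∀ t, t + 1 < ℓ → M.next (a t) = a (t + 1)

namespace IsOuterPath

variable {M : PlaneEmbedding G} {ℓ : ℕ} {q : ℕ → V} {a : ℕ → G.Dart}

/-- The darts of an outer path. -/
def OnPath (_ : M.IsOuterPath ℓ q a) (d : G.Dart) : Prop := ∃ t < ℓ, a t = d

variable (P : M.IsOuterPath ℓ q a)

lemma ends_ne (P : M.IsOuterPath ℓ q a) : q 0 ≠ q ℓ := fun h => by
  have := P.inj 0 (Nat.zero_le _) ℓ le_rfl h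
  have := P.pos
  omega

lemma OnPath.mem_outer {d : G.Dart} (h : P.OnPath d) : d ∈ M.outer := by
  obtain ⟨t, ht, rfl⟩ := h
  exact P.outer t ht

/-- Along the external face, the path is entered and left only at its two ends. -/
lemma onPath_next {d : G.Dart} (h0 : d.snd ≠ q 0) (h1 : d.snd ≠ q ℓ) :
    P.OnPath (M.next d) ↔ P.OnPath d := by
  constructor
  · rintro ⟨t, ht, h⟩
    have h2 := congrArg (fun d : G.Dart => d.fst) h
    simp only [M.next_fst, P.fst t ht] at h2
    cases t with
    | zero => exact absurd h2.symm h0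
    | succ t =>
      refine ⟨t, by omega, M.next.injective ?_⟩
      rw [P.next t ht, h]
  · rintro ⟨t, ht, rfl⟩
    rw [P.snd t ht] at h1
    have : t + 1 < ℓ := by
      by_contra hcon
      exact h1 (by rw [show t + 1 = ℓ by omega])
    exact ⟨t + 1, this, (P.next t this).symm⟩

lemma sum_onPath {R : Type*} [AddCommMonoid R] (w : G.Dart → R) :
    ∑ d, (if P.OnPath d then w d else 0) = ∑ t ∈ Finset.range ℓ, w (a t) := by
  rw [← Finset.sum_filter]
  have : Finset.univ.filter P.OnPath = (Finset.range ℓ).image a := by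
    ext d; simp [OnPath]
  rw [this, Finset.sum_image]
  intro i hi j hj h
  have hi := Finset.mem_range.1 (Finset.mem_coe.1 hi)
  have hj := Finset.mem_range.1 (Finset.mem_coe.1 hj)
  apply P.inj i hi.le j hj.le
  rw [← P.fst i hi, ← P.fst j hj, h]

/-- The endpoints of the edges, together with a chord between the endpoints of the path. -/
def chordEnds (_ : M.IsOuterPath ℓ q a) : Option G.edgeSet → Sym2 V
  | some e => edgeEnds e
  | none => s(q 0, q ℓ)

/-- The number of sides of an edge on a face, after adding the chord and the bounded face between
the chord and the path. -/
def chordSides : Option G.edgeSet → Option M.BoundedFace → ℕ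
  | some e, some f => M.faceSides e f
  | some e, none => dartCount P.OnPath e
  | none, some _ => 0
  | none, none => 1

lemma endInc_some (v : V) (e : G.edgeSet) :
    endInc P.chordEnds v (some e) = endInc edgeEnds v e := rfl

lemma endInc_none (v : V) : endInc P.chordEnds v none =
    (if q 0 = v then 1 else 0) + if q ℓ = v then 1 else 0 := by
  have h := P.ends_ne
  unfold endInc
  simp only [chordEnds]
  by_cases h1 : q 0 = v
  · subst h1; simp [h.symm]
  · by_cases h2 : q ℓ = v
    · subst h2; simp [h]
    · simp [h1, h2, Ne.symm h1, Ne.symm h2]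

/-- The sum telescopes along the path: path and chord have the same boundary modulo two, so together
they can bound a face. -/
lemma sum_endInc_onPath (v : V) :
    ∑ e, endInc edgeEnds v e * (dartCount P.OnPath e : ZMod 2) = endInc P.chordEnds v none := by
  rw [sum_mul_dartCount, P.sum_onPath (fun d => endInc edgeEnds v (edgeOf d)), endInc_none]
  have h1 : ∀ t ∈ Finset.range ℓ, endInc edgeEnds v (edgeOf (a t)) =
      (if q (t + 1) = v then 1 else 0) - (if q t = v then 1 else 0) := by
    intro t ht
    have ht := Finset.mem_range.1 ht
    rw [endInc_edgeOf, P.fst t ht, P.snd t ht, CharTwo.sub_eq_add, add_comm]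
  rw [Finset.sum_congr rfl h1, Finset.sum_range_sub (fun t => if q t = v then (1 : ZMod 2) else 0),
    CharTwo.sub_eq_add, add_comm]

/-- The darts that have on their left a face of the region `D`. -/
def InRegion (D : Finset (Option M.BoundedFace)) (d : G.Dart) : Prop :=
  (∃ f, some f ∈ D ∧ M.HasFace f d) ∨ (none ∈ D ∧ P.OnPath d)

/-- A dart of the path has the external face on its left, so it is never counted both for a bounded
face and for the new one. -/
lemma sum_chordSides (d : G.Dart) (D : Finset (Option M.BoundedFace)) :
    ∑ f ∈ D, P.chordSides (some (edgeOf d)) f =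
      (if P.InRegion D d then 1 else 0) + (if P.InRegion D d.symm then 1 else 0) := by
  have h0 : ∀ d : G.Dart, P.OnPath d → ¬ ∃ f ∈ D.eraseNone, M.HasFace f d := by
    rintro d hd ⟨f, _, hf⟩
    exact HasFace.not_mem_outer M hf (OnPath.mem_outer P hd)
  have h1 : ∀ d : G.Dart, (if P.InRegion D d then 1 else 0) =
      (if ∃ f ∈ D.eraseNone, M.HasFace f d then 1 else 0) +
      if none ∈ D then (if P.OnPath d then 1 else 0) else 0 := by
    intro d
    have h2 := h0 d
    unfold InRegion
    simp only [Finset.mem_eraseNone] at h2 ⊢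
    by_cases h3 : ∃ f, some f ∈ D ∧ M.HasFace f d <;> by_cases h4 : none ∈ D <;>
      by_cases h5 : P.OnPath d <;> simp_all
  have h2 : ∑ f ∈ D, P.chordSides (some (edgeOf d)) f =
      ∑ f ∈ D.eraseNone, M.faceSides (edgeOf d) f +
        if none ∈ D then dartCount P.OnPath (edgeOf d) else 0 := by
    have h3 : D = D.eraseNone.map Function.Embedding.some ∪ D.filter (· = none) := by
      ext f
      cases f <;> simp
    conv_lhs => rw [h3]
    rw [Finset.sum_union, Finset.sum_map, Finset.sum_filter]
    · congr 1
      rw [Finset.sum_ite_eq' D none]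
      rfl
    · rw [Finset.disjoint_left]
      intro f hf hf'
      simp only [Finset.mem_filter] at hf'
      obtain ⟨_, rfl⟩ := hf'
      simp at hf
  rw [h2, sum_faceSides, dartCount_edgeOf, h1, h1]
  split_ifs <;> rfl

lemma sum_chordSides_none (D : Finset (Option M.BoundedFace)) :
    ∑ f ∈ D, P.chordSides none f = if none ∈ D then 1 else 0 := by
  have : ∀ f, P.chordSides none f = if f = none then 1 else 0 := by
    intro f; cases f <;> simp [chordSides]
  simp only [this]
  rw [Finset.sum_ite_eq' D none]

lemma inRegion_next {D : Finset (Option M.BoundedFace)} {d : G.Dart}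
    (h : none ∈ D → d.snd ≠ q 0 ∧ d.snd ≠ q ℓ) :
    P.InRegion D (M.next d) ↔ P.InRegion D d := by
  unfold InRegion
  simp only [M.hasFace_next]
  by_cases hD : none ∈ D
  · rw [P.onPath_next (h hD).1 (h hD).2]
  · simp [hD]

/-- The disc complex of a plane embedding to which a chord in the external face has been added. -/
def complex (hG : G.Connected) : DiscComplex V (Option G.edgeSet) (Option M.BoundedFace) where
  ends := P.chordEnds
  b := P.chordSides
  ends_ne e := by
    cases e with
    | none => simpa [chordEnds] using P.ends_ne
    | some e => exact (M.complex hG).ends_ne e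
  sum_le e := by
    cases e with
    | none => rw [sum_chordSides_none]; simp
    | some e =>
      obtain ⟨d, rfl⟩ := exists_edgeOf e
      rw [sum_chordSides]
      split_ifs <;> omega
  closed f v := by
    rw [Fintype.sum_option]
    cases f with
    | none =>
      simp only [chordSides, endInc_some]
      rw [P.sum_endInc_onPath, Nat.cast_one, mul_one]
      exact CharTwo.add_self_eq_zero _
    | some f =>
      simp only [chordSides, endInc_some]
      rw [M.sum_closed, Nat.cast_zero, mul_zero, add_zero]
  -- The chord lies only on the new face, which must therefore have the coefficient of the chord.
  -- After its boundary is subtracted, a cycle of the original complex remains.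
  exact z hz := by
    obtain ⟨k, hk⟩ := exact_of_connected hG M
      (fun e => z (some e) + (dartCount P.OnPath e : ZMod 2) * z none) (by
        intro v
        have h1 := hz v
        rw [Fintype.sum_option] at h1
        simp only [mul_add, Finset.sum_add_distrib, ← mul_assoc, ← Finset.sum_mul]
        rw [P.sum_endInc_onPath, ← h1, add_comm]
        rfl)
    refine ⟨fun f => f.elim (z none) k, fun e => ?_⟩
    rw [Fintype.sum_option]
    cases e with
    | none => simp [chordSides]
    | some e =>
      simp only [chordSides, Option.elim]
      rw [hk]
      have := CharTwo.add_self_eq_zero ((dartCount P.OnPath e : ZMod 2) * z none)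
      linear_combination this
  inj k hk := by
    have h0 : k none = 0 := by
      have := hk none
      rw [Fintype.sum_option] at this
      simpa [chordSides] using this
    have h1 := inj_of_connected hG M (fun f => k (some f)) (fun e => by
      have := hk (some e)
      rw [Fintype.sum_option, h0, mul_zero, zero_add] at this
      exact this)
    ext f
    cases f with
    | none => exact h0
    | some f => exact congrFun h1 f
  -- The old faces provide a potential. The condition at the new face says that the value on the
  -- chord is the sum along the path, that is, the sum of the potential at the two ends.
  coexact g hg := by
    obtain ⟨h, hh⟩ := coexact_of_connected hG M (fun e => g (some e)) (fun f => by
      have := hg (some f)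
      rw [Fintype.sum_option] at this
      simpa [chordSides] using this)
    refine ⟨h, fun e => ?_⟩
    cases e with
    | some e => exact hh e
    | none =>
      have h1 := hg none
      rw [Fintype.sum_option] at h1
      simp only [chordSides, Nat.cast_one, one_mul] at h1
      rw [CharTwo.add_eq_zero.1 h1]
      simp only [hh, Finset.mul_sum]
      rw [Finset.sum_comm]
      refine Finset.sum_congr rfl fun v _ => ?_
      rw [← P.sum_endInc_onPath, Finset.sum_mul]
      exact Finset.sum_congr rfl fun e _ => by ring
  conn h hh := conn_of_connected hG h fun e => hh (some e)
  link D v hD := by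
    have hsw : ∀ d : G.Dart, d.fst = v → (P.InRegion D d ↔ P.InRegion D d.symm) := by
      intro d hd
      have := hD (some (edgeOf d)) (hd ▸ fst_mem_edgeEnds d)
      rw [sum_chordSides] at this
      by_cases h1 : P.InRegion D d <;> by_cases h2 : P.InRegion D d.symm <;>
        simp [h1, h2] at this ⊢
    -- The chord has a single side among these faces, so at its ends the hypothesis excludes the new
    -- face from `D`.
    have hend : v = q 0 ∨ v = q ℓ → none ∉ D := by
      intro h hD'
      refine hD none ?_ ?_
      · simpa [chordEnds] using h
      · rw [sum_chordSides_none, if_pos hD']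
    have key := link_aux M (P.InRegion D) v hsw (fun d hd => P.inRegion_next fun h => by
      rw [hd]
      exact ⟨fun h' => hend (Or.inl h') h, fun h' => hend (Or.inr h') h⟩)
    rcases key with h | h
    · left
      -- At each end of the path starts an external dart: the first dart of the path, or the one
      -- after its last. It could lie in the region only through the new face.
      have hall : v ≠ q 0 ∧ v ≠ q ℓ := by
        constructor
        · rintro rfl
          have := h (a 0) (P.fst 0 P.pos)
          rcases this with ⟨f, _, hf⟩ | ⟨hn, _⟩
          · exact HasFace.not_mem_outer M hf (P.outer 0 P.pos)
          · exact hend (Or.inl rfl) hn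
        · rintro rfl
          have hpos := P.pos
          have h1 := P.snd (ℓ - 1) (by omega)
          rw [show ℓ - 1 + 1 = ℓ by omega] at h1
          have := h (M.next (a (ℓ - 1))) (by rw [M.next_fst, h1])
          rcases this with ⟨f, _, hf⟩ | ⟨hn, _⟩
          · exact HasFace.not_mem_outer M hf (M.next_mem_outer (P.outer _ (by omega)))
          · exact hend (Or.inr rfl) hn
      intro e he
      cases e with
      | none =>
        rcases Sym2.mem_iff.1 he with h' | h'
        · exact absurd h' hall.1
        · exact absurd h' hall.2
      | some e =>
        obtain ⟨d, hd, rfl⟩ := exists_dart_of_mem he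
        have h1 := h d hd
        rw [sum_chordSides, if_pos h1, if_pos ((hsw d hd).1 h1)]
    · right
      intro e he
      cases e with
      | none =>
        rw [sum_chordSides_none, if_neg (hend (Sym2.mem_iff.1 he))]
      | some e =>
        obtain ⟨d, hd, rfl⟩ := exists_dart_of_mem he
        have h1 := h d hd
        rw [sum_chordSides, if_neg h1, if_neg (fun h' => h1 ((hsw d hd).2 h'))]

end IsOuterPath
end PlaneEmbedding
end AugmentedComplex

/-! ### Interior vertices of loops and of arcs. -/

section Regions
set_option linter.unusedSectionVars false

open scoped Classical

variable {V : Type*} [Fintype V] {G : SimpleGraph V}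

namespace PlaneEmbedding

/-- Real Kasteleyn phases, as signs of the edges. -/
def IsSignPhase (M : PlaneEmbedding G) (x : G.edgeSet → ℤˣ) : Prop :=
  ∀ f, ∃ n : ℕ, ∑ e, M.faceSides e f = 2 * n ∧ ∏ e, x e ^ M.faceSides e f = (-1) ^ (n + 1)

/-- A simple closed path of length at least three in the graph bounds a region, with interior
vertices `U`. -/
theorem exists_loop_interior (M : PlaneEmbedding G) (hG : G.Connected) {L : ℕ} (hL : 3 ≤ L)
    (c : ℕ → V) (hinj : ∀ i < L, ∀ j < L, c i = c j → i = j) (hclose : c L = c 0)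
    (ε : ℕ → G.edgeSet) (hε : ∀ k < L, (ε k).1 = s(c k, c (k + 1))) :
    ∃ U : Finset V, (∀ k < L, c k ∉ U) ∧
      (∀ u v, G.Adj u v → u ∈ U → v ∈ U ∨ ∃ k < L, c k = v) ∧
      ∀ x, M.IsSignPhase x → ∀ m, L = 2 * m →
        ∏ k ∈ Finset.range L, x (ε k) = (-1) ^ (m + 1 + U.card) := by
  have hc : (M.complex hG).IsSimpleCycle L c ε := by
    refine ⟨by omega, hinj, ?_, hclose, hε⟩
    intro i hi j hj hij
    have h1 := hε i hi
    rw [hij, hε j hj] at h1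
    rcases Sym2.eq_iff.1 h1 with ⟨h2, _⟩ | ⟨h2, h3⟩
    · exact (hinj j hj i hi h2).symm
    -- The same edge run through in both directions would force `L = 2`.
    · exfalso
      by_cases hi' : i + 1 < L
      · have h4 := hinj _ hj _ hi' h2
        by_cases hj' : j + 1 < L
        · have h5 := hinj _ hj' _ hi h3; omega
        · rw [show j + 1 = L by omega, hclose] at h3
          have h5 := hinj _ (by omega) _ hi h3; omega
      · rw [show i + 1 = L by omega, hclose] at h2
        have h4 := hinj _ hj _ (by omega) h2
        have h5 := hinj _ (by omega) _ hi h3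
        omega
  obtain ⟨D, U, hD, hR⟩ := hc.exists_region
  refine ⟨U, ?_, ?_, ?_⟩
  · intro k hk hU
    exact Finset.disjoint_left.1 hR.disjoint hU
      (Finset.mem_image_of_mem _ (Finset.mem_range.2 hk))
  · intro u v huv hu
    have h1 : (M.complex hG).sides D (edgeOf ⟨(u, v), huv⟩) = 2 := by
      by_contra h
      exact hR.outside (edgeOf ⟨(u, v), huv⟩) u (Sym2.mem_mk_left u v) h hu
    rcases hR.inside (edgeOf ⟨(u, v), huv⟩) v (Sym2.mem_mk_right u v) h1 with h | h
    · exact Or.inl h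
    · obtain ⟨k, hk, rfl⟩ := Finset.mem_image.1 h
      exact Or.inr ⟨k, Finset.mem_range.1 hk, rfl⟩
  · intro x hx m hm
    choose n hn hn' using hx
    exact hc.prod_phase hD hR hm x n hn hn'

namespace IsOuterPath

variable {M : PlaneEmbedding G} {ℓ : ℕ} {q : ℕ → V} {a : ℕ → G.Dart}

/-- A simple path between the endpoints of an outer path bounds, together with a chord in the
external face, a region with interior vertices `U`. -/
theorem exists_arc_interior (P : M.IsOuterPath ℓ q a) (hG : G.Connected) {L : ℕ} (hL : 2 ≤ L)
    (c : ℕ → V) (hinj : ∀ i < L, ∀ j < L, c i = c j → i = j)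
    (hends : s(c (L - 1), c 0) = s(q 0, q ℓ))
    (ε : ℕ → G.edgeSet) (hε : ∀ k, k + 1 < L → (ε k).1 = s(c k, c (k + 1))) :
    ∃ U : Finset V, (∀ k < L, c k ∉ U) ∧
      (∀ u v, G.Adj u v → u ∈ U → v ∈ U ∨ ∃ k < L, c k = v) ∧
      (∀ t < ℓ, 0 < t → q t ∈ U ∨ ∃ k < L, c k = q t) ∧
      (∀ d ∈ M.outer, ¬ P.OnPath d → d.fst ∉ U) ∧
      ∀ x, M.IsSignPhase x → ∀ (χ : ℤˣ) (r : ℕ), ℓ = 2 * r + 1 →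
        χ * ∏ t ∈ Finset.range ℓ, x (edgeOf (a t)) = (-1) ^ r → ∀ m, L = 2 * m →
        χ * ∏ k ∈ Finset.range (L - 1), x (ε k) = (-1) ^ (m + 1 + U.card) := by
  -- The path is closed by the chord, which is the edge at position `L - 1`.
  set c' : ℕ → V := fun k => if k < L then c k else c 0 with hc'
  set ε' : ℕ → Option G.edgeSet := fun k => if k + 1 < L then some (ε k) else none with hε'
  have c'lt : ∀ k < L, c' k = c k := fun k hk => by simp [hc', hk]
  have hc : (P.complex hG).IsSimpleCycle L c' ε' := by
    refine ⟨hL, ?_, ?_, ?_, ?_⟩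
    · intro i hi j hj h
      rw [c'lt i hi, c'lt j hj] at h
      exact hinj i hi j hj h
    · intro i hi j hj hij
      by_cases hi' : i + 1 < L <;> by_cases hj' : j + 1 < L
      · simp only [hε', hi', hj', if_true, Option.some.injEq] at hij
        have h1 := hε i hi'
        rw [hij, hε j hj'] at h1
        rcases Sym2.eq_iff.1 h1 with ⟨h2, _⟩ | ⟨h2, h3⟩
        · exact (hinj j hj i hi h2).symm
        · have := hinj _ hj _ hi' h2
          have := hinj _ hj' _ hi h3
          omega
      · simp [hε', hi', hj'] at hij
      · simp [hε', hi', hj'] at hij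
      · omega
    · rw [c'lt 0 (by omega)]; simp [hc']
    · intro k hk
      by_cases hk' : k + 1 < L
      · simp only [hε', hk', if_true]
        rw [c'lt k hk, c'lt _ hk']
        exact hε k hk'
      · simp only [hε', hk', if_false]
        rw [c'lt k hk]
        have h1 : c' (k + 1) = c 0 := by simp [hc', hk']
        rw [h1, show k = L - 1 by omega]
        exact hends.symm
  obtain ⟨D, U, hD, hR⟩ := hc.exists_region
  have hC : ∀ v, v ∈ (Finset.range L).image c' ↔ ∃ k < L, c k = v := by
    intro v
    rw [Finset.mem_image]
    constructor
    · rintro ⟨k, hk, rfl⟩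
      exact ⟨k, Finset.mem_range.1 hk, (c'lt k (Finset.mem_range.1 hk)).symm⟩
    · rintro ⟨k, hk, rfl⟩
      exact ⟨k, Finset.mem_range.2 hk, c'lt k hk⟩
  -- The chord belongs to the cycle, and the new face is the only one on which it has a side.
  have hnone : none ∈ D := by
    have h1 := (hD none).2 ⟨L - 1, by omega, by simp [hε']; omega⟩
    change ∑ f ∈ D, P.chordSides none f = 1 at h1
    rw [sum_chordSides_none] at h1
    by_contra h
    simp [h] at h1
  refine ⟨U, ?_, ?_, ?_, ?_, ?_⟩
  · intro k hk hU
    exact Finset.disjoint_left.1 hR.disjoint hU ((hC _).2 ⟨k, hk, rfl⟩)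
  · intro u v huv hu
    have h1 : (P.complex hG).sides D (some (edgeOf ⟨(u, v), huv⟩)) = 2 := by
      by_contra h
      exact hR.outside (some (edgeOf ⟨(u, v), huv⟩)) u (Sym2.mem_mk_left u v) h hu
    rcases hR.inside (some (edgeOf ⟨(u, v), huv⟩)) v (Sym2.mem_mk_right u v) h1 with h | h
    · exact Or.inl h
    · exact Or.inr ((hC v).1 h)
  · intro t ht ht0
    by_cases hq : ∃ k < L, c k = q t
    · exact Or.inr hq
    · left
      have hmem : q t ∈ (P.complex hG).ends (some (edgeOf (a t))) := by
        rw [← P.fst t ht]; exact fst_mem_edgeEnds (a t)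
      have hs : (P.complex hG).sides D (some (edgeOf (a t))) =
          (if P.InRegion D (a t) then 1 else 0) + (if P.InRegion D (a t).symm then 1 else 0) :=
        P.sum_chordSides (a t) D
      have hin : P.InRegion D (a t) := Or.inr ⟨hnone, t, ht, rfl⟩
      -- The dart of the outer path has the new face on its left, so its edge has a side in `D`. If
      -- that were the only one, the edge would belong to the cycle, and `q t` with it.
      have h2 : (P.complex hG).sides D (some (edgeOf (a t))) = 2 := by
        by_contra hne
        have h1 : (P.complex hG).sides D (some (edgeOf (a t))) = 1 := by
          rw [hs, if_pos hin] at hne ⊢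
          split_ifs at hne ⊢ <;> simp at hne ⊢
        obtain ⟨k, hk, hk'⟩ := (hD _).1 h1
        have hk1 : k + 1 < L := by
          by_contra h; simp [hε', h] at hk'
        simp only [hε', hk1, if_true, Option.some.injEq] at hk'
        have h3 : q t ∈ (ε k).1 := by rw [hk']; exact hmem
        rw [hε k hk1] at h3
        rcases Sym2.mem_iff.1 h3 with h4 | h4
        · exact hq ⟨k, hk, h4.symm⟩
        · exact hq ⟨k + 1, hk1, h4.symm⟩
      rcases hR.inside _ _ hmem h2 with h | h
      · exact h
      · exact absurd ((hC _).1 h) hq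
  · intro d hd hd' hU
    have hs : (P.complex hG).sides D (some (edgeOf d)) =
        (if P.InRegion D d then 1 else 0) + (if P.InRegion D d.symm then 1 else 0) :=
      P.sum_chordSides d D
    have hin : ¬ P.InRegion D d := by
      rintro (⟨f, _, hf⟩ | ⟨_, h⟩)
      · exact HasFace.not_mem_outer M hf hd
      · exact hd' h
    refine hR.outside (some (edgeOf d)) d.fst (fst_mem_edgeEnds d) ?_ hU
    rw [hs, if_neg hin]
    split_ifs <;> simp
  · intro x hx χ r hr hχ m hm
    choose n hn hn' using hx
    -- With phase `χ` on the chord, the new face has `ℓ + 1 = 2 * (r + 1)` sides, and the hypothesis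
    -- on `χ` is its Kasteleyn condition.
    have h1 := hc.prod_phase hD hR hm (fun e => e.elim χ x) (fun f => f.elim (r + 1) n) (by
      intro f
      rw [Fintype.sum_option]
      cases f with
      | some f =>
        have := hn f
        simpa [IsOuterPath.complex, chordSides] using this
      | none =>
        have h2 : ∑ e, dartCount P.OnPath e = ℓ := by
          have h3 := sum_mul_dartCount (R := ℕ) P.OnPath (fun _ => 1)
          rw [P.sum_onPath (fun _ => 1)] at h3
          simpa using h3
        simp only [IsOuterPath.complex, chordSides, Option.elim]
        omega) (by
      intro f
      rw [Fintype.prod_option]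
      cases f with
      | some f =>
        have := hn' f
        simpa [IsOuterPath.complex, chordSides] using this
      | none =>
        simp only [IsOuterPath.complex, chordSides, Option.elim, pow_one]
        rw [show r + 1 + 1 = r + 2 by ring, pow_add, neg_one_sq, mul_one, ← hχ]
        congr 1
        have h3 := P.sum_onPath (fun d => Additive.ofMul (x (edgeOf d)))
        have h4 : ∀ e, x e ^ dartCount P.OnPath e =
            ∏ d ∈ Finset.univ.filter (fun d => edgeOf d = e),
              if P.OnPath d then x (edgeOf d) else 1 := by
          intro e
          unfold dartCount
          rw [← Finset.prod_pow_eq_pow_sum]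
          refine Finset.prod_congr rfl fun d hd => ?_
          rw [(Finset.mem_filter.1 hd).2]
          split_ifs <;> simp
        simp only [h4]
        rw [Finset.prod_fiberwise]
        exact h3)
    rw [← h1, show L = L - 1 + 1 by omega, Finset.prod_range_succ, mul_comm]
    congr 1
    · refine Finset.prod_congr (by simp) fun k hk => ?_
      have := Finset.mem_range.1 hk
      have hk' : k + 1 < L := by omega
      simp [hε', hk']
    · have : ¬ (L - 1 + 1 < L) := by omega
      simp [hε', this]

end IsOuterPath
end PlaneEmbedding
end Regions

/-! ### The structure of the configurations -/

section Configurations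
set_option linter.unusedSectionVars false

variable {V : Type*} {G : SimpleGraph V} {S : Finset V}

/-- A pairing of the folded graph along its edges. -/
def IsDimerPairing [Fintype V] (G : SimpleGraph V) (S : Finset V)
    (π : Equiv.Perm (DoubledVertex S)) : Prop :=
  IsPairing π ∧ ∀ x, G.Adj x.proj (π x).proj

/-- The projected edges of a pairing. -/
def pairingEdges (π : Equiv.Perm (DoubledVertex S)) : Set (Sym2 V) :=
  Set.range fun x => s(x.proj, (π x).proj)

/-- A perfect matching is the same thing as the involution that exchanges the ends of its edges; in
this form it meets the pairings of the Pfaffian. -/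
lemma mem_configs [Fintype V] {ω : Set (Sym2 V)} :
    ω ∈ configs G S ↔ ∃ π, IsDimerPairing G S π ∧ ω = pairingEdges π := by
  unfold configs
  rw [Set.Finite.mem_toFinset, Set.mem_ofPred_eq]
  constructor
  · rintro ⟨m, ⟨hsub, huniq⟩, rfl⟩
    have hmate : ∀ x, ∃ y, s(x, y) ∈ m := by
      intro x
      obtain ⟨e, ⟨he, hx⟩, _⟩ := huniq x
      obtain ⟨y, rfl⟩ := Sym2.mem_iff_exists.1 hx
      exact ⟨y, he⟩
    choose f hf using hmate
    have hinv : ∀ x, f (f x) = x := by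
      intro x
      have h1 := (huniq (f x)).unique ⟨hf (f x), Sym2.mem_mk_left _ _⟩
        ⟨hf x, Sym2.mem_mk_right _ _⟩
      rw [Sym2.eq_swap] at h1
      exact Sym2.congr_left.1 h1
    have hadj : ∀ x, (doubledGraph G S).Adj x (f x) := fun x => hsub (hf x)
    refine ⟨⟨f, f, hinv, hinv⟩, ⟨fun x => ⟨hinv x, (hadj x).ne'⟩, fun x => hadj x⟩, ?_⟩
    ext e
    constructor
    · rintro ⟨e, he, rfl⟩
      induction e with
      | h x y =>
        refine ⟨x, ?_⟩
        have h1 := (huniq x).unique ⟨hf x, Sym2.mem_mk_left _ _⟩ ⟨he, Sym2.mem_mk_left _ _⟩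
        have h2 := Sym2.congr_right.1 h1
        simp [h2]
    · rintro ⟨x, rfl⟩
      exact ⟨_, hf x, rfl⟩
  · rintro ⟨π, ⟨hpair, hadj⟩, rfl⟩
    refine ⟨Set.range fun x => s(x, π x), ⟨?_, ?_⟩, ?_⟩
    · rintro _ ⟨x, rfl⟩
      exact hadj x
    · intro x
      refine ⟨s(x, π x), ⟨⟨x, rfl⟩, Sym2.mem_mk_left _ _⟩, ?_⟩
      rintro _ ⟨⟨y, rfl⟩, hy⟩
      rcases Sym2.mem_iff.1 hy with rfl | rfl
      · rfl
      · simp only [(hpair y).1]; exact Sym2.eq_swap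
    · ext e
      constructor
      · rintro ⟨x, rfl⟩
        exact ⟨_, ⟨x, rfl⟩, rfl⟩
      · rintro ⟨_, ⟨x, rfl⟩, rfl⟩
        exact ⟨x, rfl⟩

/-- A graph whose components are loops and doubled edges outside of `S`, and arcs that join two
vertices of `S`. -/
structure IsArcGraph (H : SimpleGraph V) (S : Finset V) : Prop where
  boundary : ∀ v ∈ S, ∃ u, ∀ w, H.Adj v w ↔ w = u
  bulk : ∀ v ∉ S, ∃ u₁ u₂, ∀ w, H.Adj v w ↔ w = u₁ ∨ w = u₂
  double : ∀ v ∉ S, ∀ u, (∀ w, H.Adj v w ↔ w = u) → u ∉ S ∧ ∀ w, H.Adj u w ↔ w = v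

lemma adj_pairingEdges [Fintype V] {π : Equiv.Perm (DoubledVertex S)} (hπ : IsDimerPairing G S π)
    {u v : V} : (SimpleGraph.fromEdgeSet (pairingEdges π)).Adj u v ↔
      ∃ x : DoubledVertex S, x.proj = u ∧ (π x).proj = v := by
  rw [SimpleGraph.fromEdgeSet_adj]
  constructor
  · rintro ⟨⟨x, hx⟩, _⟩
    rcases Sym2.eq_iff.1 hx with ⟨h1, h2⟩ | ⟨h1, h2⟩
    · exact ⟨x, h1, h2⟩
    · exact ⟨π x, h2, by rw [(hπ.1 x).1, h1]⟩
  · rintro ⟨x, rfl, rfl⟩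
    exact ⟨⟨x, rfl⟩, (hπ.2 x).ne⟩

lemma DoubledVertex.eq_boundary {x : DoubledVertex S} {v : V} (hv : v ∈ S) (hx : x.proj = v) :
    x = .boundary v hv := by
  cases x with
  | boundary w hw => cases hx; rfl
  | bulk w hw i => cases hx; exact absurd hv hw

lemma DoubledVertex.eq_bulk {x : DoubledVertex S} {v : V} (hv : v ∉ S) (hx : x.proj = v) :
    ∃ i, x = .bulk v hv i := by
  cases x with
  | boundary w hw => cases hx; exact absurd hw hv
  | bulk w hw i => cases hx; exact ⟨i, rfl⟩

lemma isArcGraph_pairingEdges [Fintype V] {π : Equiv.Perm (DoubledVertex S)}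
    (hπ : IsDimerPairing G S π) :
    IsArcGraph (SimpleGraph.fromEdgeSet (pairingEdges π)) S := by
  have hbulk : ∀ v (hv : v ∉ S), ∀ w, (SimpleGraph.fromEdgeSet (pairingEdges π)).Adj v w ↔
      w = (π (.bulk v hv 0)).proj ∨ w = (π (.bulk v hv 1)).proj := by
    intro v hv w
    rw [adj_pairingEdges hπ]
    constructor
    · rintro ⟨x, hx, rfl⟩
      obtain ⟨i, rfl⟩ := DoubledVertex.eq_bulk hv hx
      fin_cases i
      · exact Or.inl rfl
      · exact Or.inr rfl
    · rintro (rfl | rfl)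
      · exact ⟨_, rfl, rfl⟩
      · exact ⟨_, rfl, rfl⟩
  refine ⟨?_, ?_, ?_⟩
  · intro v hv
    refine ⟨(π (.boundary v hv)).proj, fun w => ?_⟩
    rw [adj_pairingEdges hπ]
    constructor
    · rintro ⟨x, hx, rfl⟩
      rw [DoubledVertex.eq_boundary hv hx]
    · rintro rfl
      exact ⟨_, rfl, rfl⟩
  · intro v hv
    exact ⟨_, _, hbulk v hv⟩
  · intro v hv u hu
    have h0 : (π (.bulk v hv 0)).proj = u := (hu _).1 ((hbulk v hv _).2 (Or.inl rfl))
    have h1 : (π (.bulk v hv 1)).proj = u := (hu _).1 ((hbulk v hv _).2 (Or.inr rfl))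
    -- Both copies of `v` have their partners over `u`. These are distinct, so `u` has two copies,
    -- and both are used up by `v`.
    have hne : π (.bulk v hv 0) ≠ π (.bulk v hv 1) := by
      intro h
      have := π.injective h
      simp at this
    have huS : u ∉ S := by
      intro h
      rw [DoubledVertex.eq_boundary h h0, DoubledVertex.eq_boundary h h1] at hne
      exact hne rfl
    refine ⟨huS, fun w => ?_⟩
    obtain ⟨i, hi⟩ := DoubledVertex.eq_bulk huS h0
    obtain ⟨j, hj⟩ := DoubledVertex.eq_bulk huS h1
    have hij : i ≠ j := by
      rintro rfl
      exact hne (hi.trans hj.symm)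
    have p0 : π (.bulk u huS i) = .bulk v hv 0 := by rw [← hi, (hπ.1 _).1]
    have p1 : π (.bulk u huS j) = .bulk v hv 1 := by rw [← hj, (hπ.1 _).1]
    have hall : ∀ k : Fin 2, (π (.bulk u huS k)).proj = v := by
      intro k
      have : k = i ∨ k = j := by omega
      rcases this with rfl | rfl
      · rw [p0]; rfl
      · rw [p1]; rfl
    rw [hbulk u huS, hall, hall, or_self]

lemma isArcGraph_of_mem_configs [Fintype V] {ω : Set (Sym2 V)} (hω : ω ∈ configs G S) :
    IsArcGraph (SimpleGraph.fromEdgeSet ω) S := by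
  obtain ⟨π, hπ, rfl⟩ := mem_configs.1 hω
  exact isArcGraph_pairingEdges hπ

lemma mem_edgeSet_of_mem_configs [Fintype V] {ω : Set (Sym2 V)} (hω : ω ∈ configs G S)
    {e : Sym2 V} (he : e ∈ ω) : e ∈ G.edgeSet := by
  obtain ⟨π, hπ, rfl⟩ := mem_configs.1 hω
  obtain ⟨x, rfl⟩ := he
  exact hπ.2 x

lemma adj_of_mem_configs [Fintype V] {ω : Set (Sym2 V)} (hω : ω ∈ configs G S) {u v : V}
    (h : (SimpleGraph.fromEdgeSet ω).Adj u v) : G.Adj u v :=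
  mem_edgeSet_of_mem_configs hω ((SimpleGraph.fromEdgeSet_adj _).1 h).1

namespace IsArcGraph

variable {H : SimpleGraph V} (hH : IsArcGraph H S)
include hH

/-- Vertices of `S` have degree one and the others degree at most two, so two distinct neighbours
exhaust the neighbours of a bulk vertex. -/
lemma two_neighbors {v a b w : V} (ha : H.Adj v a) (hb : H.Adj v b) (hab : a ≠ b)
    (hw : H.Adj v w) : v ∉ S ∧ (w = a ∨ w = b) := by
  have hv : v ∉ S := by
    intro hv
    obtain ⟨u, hu⟩ := hH.boundary v hv
    exact hab (((hu a).1 ha).trans ((hu b).1 hb).symm)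
  refine ⟨hv, ?_⟩
  obtain ⟨u₁, u₂, hu⟩ := hH.bulk v hv
  rcases (hu a).1 ha with rfl | rfl <;> rcases (hu b).1 hb with rfl | rfl <;>
    rcases (hu w).1 hw with rfl | rfl <;> simp_all

lemma boundary_unique {v a b : V} (hv : v ∈ S) (ha : H.Adj v a) (hb : H.Adj v b) : a = b := by
  obtain ⟨u, hu⟩ := hH.boundary v hv
  exact ((hu a).1 ha).trans ((hu b).1 hb).symm

omit hH in
lemma mem_support_of_reachable {s : List V} (hs : ∀ v ∈ s, ∀ w, H.Adj v w → w ∈ s) {v w : V}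
    (hv : v ∈ s) (h : H.Reachable v w) : w ∈ s := by
  obtain ⟨p⟩ := h
  induction p with
  | nil => exact hv
  | cons hadj _ ih => exact ih (hs _ hv _ hadj)

/-- An arc is closed under adjacency. -/
lemma path_closed {x y : V} (hx : x ∈ S) (hy : y ∈ S) (hxy : x ≠ y) {p : H.Walk x y}
    (hp : p.IsPath) : ∀ v ∈ p.support, ∀ w, H.Adj v w → w ∈ p.support := by
  intro v hv w hw
  obtain ⟨k, rfl, hk⟩ := SimpleGraph.Walk.mem_support_iff_exists_getVert.1 hv
  have hlen : p.length ≠ 0 := fun h => hxy (SimpleGraph.Walk.eq_of_length_eq_zero h)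
  rcases Nat.eq_zero_or_pos k with rfl | hk0
  · have h1 := p.adj_getVert_succ (i := 0) (by omega)
    rw [p.getVert_zero] at h1 hw
    rw [hH.boundary_unique hx hw h1]
    exact p.getVert_mem_support _
  · have h1 := p.adj_getVert_succ (i := k - 1) (by omega)
    rw [show k - 1 + 1 = k by omega] at h1
    rcases Nat.lt_or_ge k p.length with hlt | hge
    · have h2 := p.adj_getVert_succ hlt
      have hne : p.getVert (k - 1) ≠ p.getVert (k + 1) := by
        intro h
        have := hp.getVert_injOn (show k - 1 ≤ p.length by omega)
          (show k + 1 ≤ p.length by omega) h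
        omega
      rcases (hH.two_neighbors h1.symm h2 hne hw).2 with rfl | rfl <;>
        exact p.getVert_mem_support _
    · have hkl : k = p.length := by omega
      have hy' : p.getVert k = y := by rw [hkl, p.getVert_length]
      rw [hy'] at h1 hw
      rw [hH.boundary_unique hy hw h1.symm]
      exact p.getVert_mem_support _

lemma path_boundary {x y : V} (hxy : x ≠ y) {p : H.Walk x y}
    (hp : p.IsPath) {v : V} (hv : v ∈ p.support) (hvS : v ∈ S) : v = x ∨ v = y := by
  obtain ⟨k, rfl, hk⟩ := SimpleGraph.Walk.mem_support_iff_exists_getVert.1 hv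
  have hlen : p.length ≠ 0 := fun h => hxy (SimpleGraph.Walk.eq_of_length_eq_zero h)
  rcases Nat.eq_zero_or_pos k with rfl | hk0
  · exact Or.inl p.getVert_zero
  · have h1 := p.adj_getVert_succ (i := k - 1) (by omega)
    rw [show k - 1 + 1 = k by omega] at h1
    rcases Nat.lt_or_ge k p.length with hlt | hge
    · have h2 := p.adj_getVert_succ hlt
      have hne : p.getVert (k - 1) ≠ p.getVert (k + 1) := by
        intro h
        have := hp.getVert_injOn (show k - 1 ≤ p.length by omega)
          (show k + 1 ≤ p.length by omega) h
        omega
      exact absurd hvS (hH.two_neighbors h1.symm h2 hne h2).1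
    · right
      rw [show k = p.length by omega, p.getVert_length]

/-- A loop is closed under adjacency, and avoids `S`. -/
lemma cycle_closed {x : V} {p : H.Walk x x} (hp : p.IsCycle) :
    ∀ v ∈ p.support, v ∉ S ∧ ∀ w, H.Adj v w → w ∈ p.support := by
  intro v hv
  obtain ⟨k, rfl, hk⟩ := SimpleGraph.Walk.mem_support_iff_exists_getVert.1 hv
  have hlen := hp.three_le_length
  have key : ∃ a b, a ≠ b ∧ H.Adj (p.getVert k) a ∧ H.Adj (p.getVert k) b ∧ a ∈ p.support ∧
      b ∈ p.support := by
    have hgen : ∀ k, 0 < k → k < p.length → ∃ a b, a ≠ b ∧ H.Adj (p.getVert k) a ∧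
        H.Adj (p.getVert k) b ∧ a ∈ p.support ∧ b ∈ p.support := by
      intro k hk0 hk
      have h1 := p.adj_getVert_succ (i := k - 1) (by omega)
      rw [show k - 1 + 1 = k by omega] at h1
      exact ⟨_, _, hp.getVert_sub_one_ne_getVert_add_one hk.le, h1.symm, p.adj_getVert_succ hk,
        p.getVert_mem_support _, p.getVert_mem_support _⟩
    have hzero : ∃ a b, a ≠ b ∧ H.Adj x a ∧ H.Adj x b ∧ a ∈ p.support ∧ b ∈ p.support := by
      have h1 := p.adj_getVert_succ (i := 0) (by omega)
      have h2 := p.adj_getVert_succ (i := p.length - 1) (by omega)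
      rw [show p.length - 1 + 1 = p.length by omega, p.getVert_length] at h2
      rw [p.getVert_zero] at h1
      refine ⟨_, _, ?_, h1, h2.symm, p.getVert_mem_support _, p.getVert_mem_support _⟩
      intro h
      have := hp.getVert_injOn (show 1 ≤ 0 + 1 ∧ 0 + 1 ≤ p.length by omega)
        (show 1 ≤ p.length - 1 ∧ p.length - 1 ≤ p.length by omega) h
      omega
    rcases Nat.eq_zero_or_pos k with rfl | hk0
    · rw [p.getVert_zero]; exact hzero
    · rcases Nat.lt_or_ge k p.length with hlt | hge
      · exact hgen k hk0 hlt
      · rw [show k = p.length by omega, p.getVert_length]; exact hzero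
  obtain ⟨a, b, hab, ha, hb, hma, hmb⟩ := key
  refine ⟨(hH.two_neighbors ha hb hab ha).1, fun w hw => ?_⟩
  rcases (hH.two_neighbors ha hb hab hw).2 with rfl | rfl
  · exact hma
  · exact hmb

omit hH in
/-- The edges of one component of a graph. -/
def componentGraph (H : SimpleGraph V) (c : H.ConnectedComponent) : SimpleGraph V where
  Adj u v := H.Adj u v ∧ H.connectedComponentMk u = c
  symm := ⟨fun u v h => ⟨h.1.symm, by
    rw [← h.2]; exact (SimpleGraph.ConnectedComponent.eq.2 h.1.reachable).symm⟩⟩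
  loopless := ⟨fun u h => h.1.ne rfl⟩

/-- Each boundary vertex is joined to another one by an arc. -/
lemma exists_partner [Fintype V] {x : V} (hx : x ∈ S) : ∃ y ∈ S, y ≠ x ∧ H.Reachable x y := by
  classical
  set H' := componentGraph H (H.connectedComponentMk x) with hH'
  obtain ⟨u, hu⟩ := hH.boundary x hx
  have hdeg : H'.degree x = 1 := by
    rw [SimpleGraph.degree_eq_one_iff_existsUnique_adj]
    exact ⟨u, ⟨(hu u).2 rfl, rfl⟩, fun w hw => (hu w).1 hw.1⟩
  -- Handshake lemma: a boundary vertex has degree one, so its component contains another vertex of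
  -- odd degree. In the bulk, that vertex would be an end of a doubled edge, whose component avoids
  -- `S`.
  obtain ⟨w, hwx, hw⟩ := H'.exists_ne_odd_degree_of_exists_odd_degree x (by rw [hdeg]; exact odd_one)
  have hreach : H.Reachable x w := by
    have : 0 < H'.degree w := hw.pos
    rw [SimpleGraph.degree_pos_iff_exists_adj] at this
    obtain ⟨v, hv⟩ := this
    exact (SimpleGraph.ConnectedComponent.eq.1 hv.2).symm
  by_cases hwS : w ∈ S
  · exact ⟨w, hwS, hwx, hreach⟩
  exfalso
  have hc : H.connectedComponentMk w = H.connectedComponentMk x :=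
    SimpleGraph.ConnectedComponent.eq.2 hreach.symm
  obtain ⟨u₁, u₂, h12⟩ := hH.bulk w hwS
  by_cases hne : u₁ = u₂
  · subst hne
    simp only [or_self] at h12
    obtain ⟨h3, h4⟩ := hH.double w hwS u₁ h12
    have := mem_support_of_reachable (H := H) (s := [w, u₁]) (by
      intro v hv z hz
      simp only [List.mem_cons, List.not_mem_nil, or_false] at hv ⊢
      rcases hv with rfl | rfl
      · exact Or.inr ((h12 z).1 hz)
      · exact Or.inl ((h4 z).1 hz)) (by simp : w ∈ [w, u₁]) hreach.symm
    simp only [List.mem_cons, List.not_mem_nil, or_false] at this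
    rcases this with h | h
    · exact hwx h.symm
    · exact h3 (h ▸ hx)
  · have : H'.degree w = 2 := by
      rw [← SimpleGraph.card_neighborFinset_eq_degree]
      have : H'.neighborFinset w = {u₁, u₂} := by
        ext z
        simp only [SimpleGraph.mem_neighborFinset, Finset.mem_insert, Finset.mem_singleton,
          ← h12]
        exact ⟨fun h => h.1, fun h => ⟨h, hc⟩⟩
      rw [this, Finset.card_pair hne]
    rw [this] at hw
    exact absurd hw (by decide)

/-- A component is a loop, an arc or a doubled edge. -/
lemma trichotomy [Fintype V] (c : H.ConnectedComponent) :
    (∃ v, ∃ p : H.Walk v v, p.IsCycle ∧ v ∈ c.supp) ∨ (∃ x ∈ S, x ∈ c.supp) ∨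
      ∃ u v, u ∉ S ∧ v ∉ S ∧ H.Adj u v ∧ ∀ w, w ∈ c.supp ↔ w = u ∨ w = v := by
  by_cases h1 : ∃ x ∈ S, x ∈ c.supp
  · exact Or.inr (Or.inl h1)
  by_cases h2 : ∃ w u, w ∈ c.supp ∧ ∀ z, H.Adj w z ↔ z = u
  · obtain ⟨w, u, hw, hu⟩ := h2
    have hwS : w ∉ S := fun h => h1 ⟨w, h, hw⟩
    obtain ⟨h3, h4⟩ := hH.double w hwS u hu
    refine Or.inr (Or.inr ⟨w, u, hwS, h3, (hu u).2 rfl, fun z => ⟨fun hz => ?_, ?_⟩⟩)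
    · have hr : H.Reachable w z := SimpleGraph.ConnectedComponent.eq.1
        ((SimpleGraph.ConnectedComponent.mem_supp_iff _ _).1 hw |>.trans
        ((SimpleGraph.ConnectedComponent.mem_supp_iff _ _).1 hz).symm)
      have := mem_support_of_reachable (H := H) (s := [w, u]) (by
        intro v hv z hz
        simp only [List.mem_cons, List.not_mem_nil, or_false] at hv ⊢
        rcases hv with rfl | rfl
        · exact Or.inr ((hu z).1 hz)
        · exact Or.inl ((h4 z).1 hz)) (by simp : w ∈ [w, u]) hr
      simpa using this
    · rintro (rfl | rfl)
      · exact hw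
      · exact c.mem_supp_of_adj_mem_supp hw ((hu z).2 rfl)
  · left
    -- Without boundary vertices and vertices of degree one, the component is two-regular.
    have hcyc : (componentGraph H c).IsCycles := by
      rintro v ⟨w, hw⟩
      have hvS : v ∉ S := fun h => h1 ⟨v, h, hw.2⟩
      obtain ⟨u₁, u₂, h12⟩ := hH.bulk v hvS
      have hne : u₁ ≠ u₂ := by
        rintro rfl
        exact h2 ⟨v, u₁, hw.2, by simpa using h12⟩
      have : (componentGraph H c).neighborSet v = {u₁, u₂} := by
        ext z
        simp only [Set.mem_insert_iff, Set.mem_singleton_iff, ← h12]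
        exact ⟨fun h => h.1, fun h => ⟨h, hw.2⟩⟩
      rw [this, Set.ncard_pair hne]
    obtain ⟨v, hv⟩ := c.nonempty_supp
    have hvS : v ∉ S := fun h => h1 ⟨v, h, hv⟩
    obtain ⟨u₁, u₂, h12⟩ := hH.bulk v hvS
    obtain ⟨p, hp, _⟩ := hcyc.exists_cycle_toSubgraph_verts_eq_connectedComponentSupp
      (v := v) (c := (componentGraph H c).connectedComponentMk v) rfl
      ⟨u₁, (h12 u₁).2 (Or.inl rfl), hv⟩
    have hle : componentGraph H c ≤ H := fun _ _ h => h.1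
    exact ⟨v, p.mapLe hle, hp.mapLe hle, hv⟩

end IsArcGraph
end Configurations

/-! ### Arcs and the boundary path: the arcs do not cross. -/

section Separation
set_option linter.unusedSectionVars false

open scoped Classical

variable {V : Type*} [Fintype V] {G : SimpleGraph V} {S : Finset V}

/-- The sign `1` of a white vertex or `-1` of a black vertex. -/
def colourSign (c : Colour) : ℤˣ := if c = Colour.white then 1 else -1

lemma colourSign_of_ne {c c' : Colour} (h : c ≠ c') : colourSign c' = -colourSign c := by
  cases c <;> cases c' <;> simp_all [colourSign]

lemma Colour.eq_of_ne_of_ne {a b c : Colour} (h : a ≠ b) (h' : b ≠ c) : a = c := by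
  cases a <;> cases b <;> cases c <;> simp_all

lemma prod_alternating (f : ℕ → ℤˣ) (r : ℕ) (hf : ∀ t, t < 2 * r → f (t + 1) = -f t) :
    ∏ t ∈ Finset.range (2 * r + 1), f t = f 0 * (-1) ^ r := by
  induction r with
  | zero => simp
  | succ r ih =>
    rw [show 2 * (r + 1) + 1 = 2 * r + 1 + 1 + 1 by ring, Finset.prod_range_succ,
      Finset.prod_range_succ, ih (fun t ht => hf t (by omega)), mul_assoc,
      hf (2 * r + 1) (by omega), mul_neg, ← sq, Int.units_sq, pow_succ]
    simp

/-- A simple path between two vertices of the boundary path bounds, together with a chord in the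
external face, a region whose interior vertices `U` include the vertices of the boundary path
strictly between its ends and exclude the others. -/
theorem IsBoundaryPath.exists_interior {M : PlaneEmbedding G} (hG : G.Connected) {n : ℕ}
    {bd : Fin n → V} (hbd : IsBoundaryPath M bd) {i j : Fin n} (hij : i < j) {L : ℕ} (hL : 2 ≤ L)
    (c : ℕ → V) (hinj : ∀ i < L, ∀ j < L, c i = c j → i = j)
    (hends : s(c (L - 1), c 0) = s(bd i, bd j))
    (ε : ℕ → G.edgeSet) (hε : ∀ k, k + 1 < L → (ε k).1 = s(c k, c (k + 1))) :
    ∃ U : Finset V, (∀ k < L, c k ∉ U) ∧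
      (∀ u v, G.Adj u v → u ∈ U → v ∈ U ∨ ∃ k < L, c k = v) ∧
      (∀ k, i < k → k < j → bd k ∈ U ∨ ∃ l < L, c l = bd k) ∧
      (∀ k, (k < i ∨ j < k) → bd k ∉ U) ∧
      ∀ (col : G.Coloring Colour) (x : G.edgeSet → ℤˣ), M.IsSignPhase x → col (bd i) ≠ col (bd j) →
        (∀ k l : Fin n, (l : ℕ) = k + 1 → ∀ e : G.edgeSet, e.1 = s(bd k, bd l) →
          x e = colourSign (col (bd k))) → ∀ m, L = 2 * m →
        colourSign (col (bd i)) * ∏ k ∈ Finset.range (L - 1), x (ε k) =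
          (-1) ^ (m + 1 + U.card) := by
  obtain ⟨hbinj, e, hout, hfst, hnext⟩ := hbd
  have hlt : ∀ t, t ≤ (j : ℕ) - i → (i : ℕ) + t < n := fun t ht => by
    have := j.2; have : (i : ℕ) < j := hij; omega
  -- The indices from `i` to `j`, counted from `i`; the default value is never reached.
  set ι : ℕ → Fin n := fun t => if h : (i : ℕ) + t < n then ⟨i + t, h⟩ else i with hι
  have ιval : ∀ t, t ≤ (j : ℕ) - i → ((ι t : Fin n) : ℕ) = i + t := by
    intro t ht; simp [hι, hlt t ht]
  have hsnd : ∀ t, t + 1 ≤ (j : ℕ) - i → (e (ι t)).snd = bd (ι (t + 1)) := by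
    intro t ht
    rw [← M.next_fst, ← hfst (ι (t + 1)), hnext (ι t) (ι (t + 1)) (by
      rw [ιval _ ht, ιval t (by omega)]; ring)]
  have P : M.IsOuterPath ((j : ℕ) - i) (fun t => bd (ι t)) (fun t => e (ι t)) := by
    refine ⟨?_, ?_, fun t _ => hout _, fun t _ => hfst _, fun t ht => hsnd t ht, ?_⟩
    · have : (i : ℕ) < j := hij
      omega
    · intro s hs t ht h
      have h1 := congrArg Fin.val (hbinj h)
      rw [ιval s hs, ιval t ht] at h1
      omega
    · intro t ht
      rw [hnext (ι t) (ι (t + 1)) (by rw [ιval _ (by omega), ιval t (by omega)]; ring)]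
  have hι0 : ι 0 = i := Fin.ext (by rw [ιval 0 (by omega)]; simp)
  have hιl : ι ((j : ℕ) - i) = j := Fin.ext (by
    rw [ιval _ le_rfl]; have : (i : ℕ) < j := hij; omega)
  obtain ⟨U, h1, h2, h3, h4, h5⟩ := P.exists_arc_interior hG hL c hinj (by
    simp only [hι0, hιl]; exact hends) ε hε
  refine ⟨U, h1, h2, ?_, ?_, ?_⟩
  · intro k hik hkj
    have hik' : (i : ℕ) < k := hik
    have hkj' : (k : ℕ) < j := hkj
    have := h3 ((k : ℕ) - i) (by omega) (by omega)
    have hk : ι ((k : ℕ) - i) = k := Fin.ext (by rw [ιval _ (by omega)]; omega)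
    simpa only [hk] using this
  · intro k hk
    rw [← hfst k]
    refine h4 (e k) (hout k) ?_
    rintro ⟨t, ht, h⟩
    have h6 := congrArg (fun d : G.Dart => d.fst) h
    simp only [hfst] at h6
    have h7 := congrArg Fin.val (hbinj h6)
    rw [ιval t ht.le] at h7
    rcases hk with hk | hk
    · have : (k : ℕ) < i := hk
      omega
    · have : (j : ℕ) < k := hk
      omega
  · intro col x hx hcol halt m hm
    have hadj : ∀ t, t < (j : ℕ) - i → col (bd (ι t)) ≠ col (bd (ι (t + 1))) := by
      intro t ht
      have := (e (ι t)).adj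
      have h6 := col.valid this
      rw [hfst, hsnd t (by omega)] at h6
      exact h6
    have hpar : ∀ t, t ≤ (j : ℕ) - i → (col (bd (ι t)) = col (bd i) ↔ Even t) := by
      intro t
      induction t with
      | zero => intro _; simp [hι0]
      | succ t ih =>
        intro ht
        have h6 := hadj t (by omega)
        have h7 := ih (by omega)
        rw [Nat.even_add_one, ← h7]
        constructor
        · intro h h'
          exact h6 (h'.trans h.symm)
        · intro h
          exact (Colour.eq_of_ne_of_ne (Ne.symm h) h6).symm
    have hodd : ¬ Even ((j : ℕ) - i) := by
      rw [← hpar _ le_rfl, hιl]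
      exact hcol.symm
    rw [Nat.not_even_iff_odd] at hodd
    obtain ⟨r, hr⟩ := hodd
    refine h5 x hx (colourSign (col (bd i))) r hr ?_ m hm
    have hxe : ∀ t ∈ Finset.range ((j : ℕ) - i), x (edgeOf (e (ι t))) =
        colourSign (col (bd (ι t))) := by
      intro t ht
      have ht := Finset.mem_range.1 ht
      refine halt (ι t) (ι (t + 1)) (by rw [ιval _ (by omega), ιval t (by omega)]; ring) _ ?_
      change s((e (ι t)).fst, (e (ι t)).snd) = _
      rw [hfst, hsnd t (by omega)]
    -- The alternating phases along the path multiply to the first of them times `(-1) ^ r`, so that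
    -- first sign is the right one for the chord.
    rw [Finset.prod_congr rfl hxe, hr, prod_alternating _ r (fun t ht =>
      colourSign_of_ne (hadj t (by omega))), hι0, ← mul_assoc, ← sq, Int.units_sq, one_mul]

/-- The edges of a path, listed by position. -/
lemma exists_edges_of_adj {L : ℕ} (hL : 0 < L) (c : ℕ → V) (hc : ∀ k < L, G.Adj (c k) (c (k + 1))) :
    ∃ ε : ℕ → G.edgeSet, ∀ k < L, (ε k).1 = s(c k, c (k + 1)) := by
  refine ⟨fun k => if h : k < L then ⟨s(c k, c (k + 1)), hc k h⟩ else ⟨s(c 0, c 1), hc 0 hL⟩, ?_⟩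
  intro k hk
  simp [hk]

/-- The arcs of a configuration do not cross: an arc that starts between the ends of another one
also ends there. -/
theorem IsArcGraph.noncrossing {H : SimpleGraph V} (hH : IsArcGraph H S) (hHG : H ≤ G)
    {M : PlaneEmbedding G} (hG : G.Connected) {n : ℕ} {bd : Fin n → V} (hbd : IsBoundaryPath M bd)
    {i j k l : Fin n} (hij : i < j) (hi : bd i ∈ S) (hj : bd j ∈ S)
    (hk : bd k ∈ S) (hrij : H.Reachable (bd i) (bd j))
    (hrkl : H.Reachable (bd k) (bd l)) (hik : i < k) (hkj : k < j) :
    i < l ∧ l < j := by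
  have hne : bd i ≠ bd j := fun h => hij.ne (hbd.1 h)
  obtain ⟨p, hp⟩ := hrij.exists_isPath
  have hlen : p.length ≠ 0 := fun h => hne (SimpleGraph.Walk.eq_of_length_eq_zero h)
  obtain ⟨ε, hε⟩ := exists_edges_of_adj (G := G) (Nat.pos_of_ne_zero hlen) p.getVert
    (fun k hk => hHG (p.adj_getVert_succ hk))
  have hclosed := hH.path_closed hi hj hne hp
  have hsupp : ∀ v, (∃ l < p.length + 1, p.getVert l = v) → v ∈ p.support := by
    rintro v ⟨l, _, rfl⟩
    exact p.getVert_mem_support l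
  obtain ⟨U, h1, h2, h3, h4, _⟩ := hbd.exists_interior hG hij (L := p.length + 1) (by omega)
    p.getVert (fun a ha b hb h => hp.getVert_injOn (show a ≤ p.length by omega)
      (show b ≤ p.length by omega) h) (by
      rw [Nat.add_sub_cancel, p.getVert_length, p.getVert_zero]; exact Sym2.eq_swap) ε
    (fun k hk => hε k (by omega))
  have hknot : bd k ∉ p.support := by
    intro h
    rcases hH.path_boundary hne hp h hk with h' | h'
    · exact hik.ne' (hbd.1 h')
    · exact hkj.ne (hbd.1 h')
  have hUsupp : ∀ v, v ∈ p.support → v ∉ U := by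
    intro v hv
    obtain ⟨m, rfl, hm⟩ := SimpleGraph.Walk.mem_support_iff_exists_getVert.1 hv
    exact h1 m (by omega)
  have hkU : bd k ∈ U := by
    rcases h3 k hik hkj with h | h
    · exact h
    · exact absurd (hsupp _ h) hknot
  -- The component of `bd k` cannot leave the interior, since it would have to meet the arc from `bd
  -- i` to `bd j`, which is a different component.
  have hlU : bd l ∈ U := by
    have := IsArcGraph.mem_support_of_reachable (H := H) (s := U.toList) (by
      intro v hv w hw
      rw [Finset.mem_toList] at hv ⊢
      rcases h2 v w (hHG hw) hv with h | h
      · exact h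
      · exact absurd hv (hUsupp v (hclosed w (hsupp w h) v hw.symm))) (Finset.mem_toList.2 hkU) hrkl
    exact Finset.mem_toList.1 this
  have hli : l ≠ i := by
    rintro rfl
    exact hUsupp _ p.start_mem_support hlU
  have hlj : l ≠ j := by
    rintro rfl
    exact hUsupp _ p.end_mem_support hlU
  constructor
  · by_contra h
    exact h4 l (Or.inl (lt_of_le_of_ne (not_lt.1 h) hli)) hlU
  · by_contra h
    exact h4 l (Or.inr (lt_of_le_of_ne (not_lt.1 h) hlj.symm)) hlU

/-- Two vertices of `S` joined by an arc are the only ones in their component. -/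
lemma IsArcGraph.eq_or_eq_of_reachable {H : SimpleGraph V} (hH : IsArcGraph H S) {x y z : V}
    (hx : x ∈ S) (hy : y ∈ S) (hz : z ∈ S) (hxy : x ≠ y) (h : H.Reachable x y)
    (h' : H.Reachable x z) : z = x ∨ z = y := by
  obtain ⟨p, hp⟩ := h.exists_isPath
  exact hH.path_boundary hxy hp (IsArcGraph.mem_support_of_reachable (hH.path_closed hx hy hxy hp)
    p.start_mem_support h') hz

lemma even_card_of_involution {α : Type*} (s : Finset α) (f : α → α) (hs : ∀ x ∈ s, f x ∈ s)
    (hf : ∀ x ∈ s, f (f x) = x) (hne : ∀ x ∈ s, f x ≠ x) : Even s.card := by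
  have h : ∑ _x ∈ s, (1 : ZMod 2) = 0 :=
    Finset.sum_involution (fun x _ => f x) (fun _ _ => by decide) (fun x hx _ => hne x hx) hs hf
  rw [Finset.sum_const, nsmul_one, ZMod.natCast_eq_zero_iff_even] at h
  exact h

/-- Each vertex of `S` in between changes the colour once; the induction removes the last of them.
-/
lemma ColoursAlternate.ne_iff_even {col : G.Coloring Colour} {n : ℕ} {bd : Fin n → V}
    (h : ColoursAlternate col S bd) (m : ℕ) : ∀ i j : Fin n, i < j → bd i ∈ S → bd j ∈ S →
      (Finset.univ.filter fun k => i < k ∧ k < j ∧ bd k ∈ S).card = m →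
      (col (bd i) ≠ col (bd j) ↔ Even m) := by
  induction m with
  | zero =>
    intro i j hij hi hj hm
    rw [Finset.card_eq_zero, Finset.filter_eq_empty_iff] at hm
    simpa using h i j hij hi hj fun k h1 h2 h3 => hm (Finset.mem_univ k) ⟨h1, h2, h3⟩
  | succ m ih =>
    intro i j hij hi hj hm
    set K := Finset.univ.filter fun k => i < k ∧ k < j ∧ bd k ∈ S with hK
    have hne : K.Nonempty := Finset.card_pos.1 (by omega)
    have hmem := Finset.max'_mem K hne
    set k := K.max' hne with hk
    obtain ⟨h1, h2, h3⟩ := (Finset.mem_filter.1 hmem).2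
    have hmax : ∀ l ∈ K, l ≤ k := fun l hl => K.le_max' l hl
    have hcard : (Finset.univ.filter fun l => i < l ∧ l < k ∧ bd l ∈ S).card = m := by
      have : (Finset.univ.filter fun l => i < l ∧ l < k ∧ bd l ∈ S) = K.erase k := by
        ext l
        simp only [Finset.mem_filter, Finset.mem_univ, true_and, Finset.mem_erase, hK]
        constructor
        · rintro ⟨a, b, c⟩
          exact ⟨b.ne, a, b.trans h2, c⟩
        · rintro ⟨a, b, c, d⟩
          exact ⟨b, lt_of_le_of_ne (hmax l (Finset.mem_filter.2 ⟨Finset.mem_univ _, b, c, d⟩)) a, d⟩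
      rw [this, Finset.card_erase_of_mem hmem]; omega
    have hkj := h k j h2 h3 hj fun l h4 h5 h6 =>
      absurd (hmax l (Finset.mem_filter.2 ⟨Finset.mem_univ _, h1.trans h4, h5, h6⟩)) (not_le.2 h4)
    have := ih i k h1 hi h3 hcard
    rw [Nat.even_add_one, ← this, not_not]
    constructor
    · intro h4
      exact Colour.eq_of_ne_of_ne h4 hkj.symm
    · intro h4
      rw [h4]; exact hkj

/-- If the colours alternate along `S`, then arcs join vertices of different colours. -/
theorem ColoursAlternate.arcsBicoloured {col : G.Coloring Colour} (hG : G.Connected)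
    {M : PlaneEmbedding G} {n : ℕ} {bd : Fin n → V} (hbd : IsBoundaryPath M bd)
    (hS : ∀ v ∈ S, ∃ i, bd i = v) (h : ColoursAlternate col S bd) : ArcsBicoloured col S := by
  intro ω hω
  have hH := isArcGraph_of_mem_configs hω
  have hHG : SimpleGraph.fromEdgeSet ω ≤ G := fun u v huv => adj_of_mem_configs hω huv
  have key : ∀ i j : Fin n, i < j → bd i ∈ S → bd j ∈ S →
      (SimpleGraph.fromEdgeSet ω).Reachable (bd i) (bd j) → col (bd i) ≠ col (bd j) := by
    intro i j hij hi hj hr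
    rw [h.ne_iff_even _ i j hij hi hj rfl]
    have hex : ∀ k : Fin n, bd k ∈ S → ∃ l : Fin n, bd l ∈ S ∧ l ≠ k ∧
        (SimpleGraph.fromEdgeSet ω).Reachable (bd k) (bd l) := by
      intro k hk
      obtain ⟨y, hy, hne, hr⟩ := hH.exists_partner hk
      obtain ⟨l, rfl⟩ := hS y hy
      exact ⟨l, hy, fun h => hne (by rw [h]), hr⟩
    choose! f hf1 hf2 hf3 using hex
    -- Because arcs do not cross, they join in pairs the vertices of `S` that lie between `bd i` and
    -- `bd j`.
    refine even_card_of_involution _ f ?_ ?_ ?_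
    · intro k hk
      obtain ⟨h1, h2, h3⟩ := (Finset.mem_filter.1 hk).2
      obtain ⟨h4, h5⟩ := hH.noncrossing hHG hG hbd hij hi hj h3 hr (hf3 k h3) h1 h2

      exact Finset.mem_filter.2 ⟨Finset.mem_univ _, h4, h5, hf1 k h3⟩
    · intro k hk
      obtain ⟨_, _, h3⟩ := (Finset.mem_filter.1 hk).2
      have h4 := hf1 k h3
      rcases hH.eq_or_eq_of_reachable h3 h4 (hf1 _ h4) (fun h => hf2 k h3 (hbd.1 h).symm)
        (hf3 k h3) ((hf3 k h3).trans (hf3 _ h4)) with h5 | h5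
      · exact hbd.1 h5
      · exact absurd (hbd.1 h5) (hf2 _ h4)
    · intro k hk
      exact hf2 k (Finset.mem_filter.1 hk).2.2.2
  intro x hx y hy hxy hr
  obtain ⟨i, rfl⟩ := hS x hx
  obtain ⟨j, rfl⟩ := hS y hy
  rcases lt_trichotomy i j with h1 | h1 | h1
  · exact key i j h1 hx hy hr
  · exact absurd (by rw [h1]) hxy
  · exact (key j i h1 hy hx hr.symm).symm

end Separation

/-! ### Permutations given by cyclic lists -/

section CyclicLists

open scoped Classical

/-- The sign of a permutation, computed orbit by orbit. -/
lemma sign_eq_prod_of_orbits {X : Type*} [Fintype X] [DecidableEq X] (ρ : Equiv.Perm X) (u : X → ℤˣ)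
    (h : ∀ x, ∏ y ∈ Finset.univ.filter (fun y => ρ.SameCycle x y), u y =
      (-1) ^ ((Finset.univ.filter (fun y => ρ.SameCycle x y)).card + 1)) :
    Equiv.Perm.sign ρ = ∏ x, u x := by
  rw [Equiv.Perm.sign_of_cycleType, Equiv.Perm.cycleType_def]
  have h1 : ((-1 : ℤˣ)) ^ ((ρ.cycleFactorsFinset.val.map (Finset.card ∘ Equiv.Perm.support)).sum +
      Multiset.card (ρ.cycleFactorsFinset.val.map (Finset.card ∘ Equiv.Perm.support))) =
      ∏ g ∈ ρ.cycleFactorsFinset, (-1) ^ (g.support.card + 1) := by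
    rw [Finset.prod_pow_eq_pow_sum, Finset.sum_add_distrib]
    simp only [Finset.sum_const, smul_eq_mul, mul_one, Multiset.card_map]
    rfl
  -- The orbit of a fixed point has one element, so the hypothesis says that `u` is `1` there.
  have h2 : ∏ x, u x = ∏ x ∈ ρ.support, u x := by
    symm
    refine Finset.prod_subset (Finset.subset_univ _) fun x _ hx => ?_
    have hfix : ρ x = x := by simpa using hx
    have horb : Finset.univ.filter (fun y => ρ.SameCycle x y) = {x} := by
      ext y
      simp only [Finset.mem_filter, Finset.mem_univ, true_and, Finset.mem_singleton]
      constructor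
      · intro hy
        obtain ⟨n, hn⟩ := hy.exists_nat_pow_eq
        rw [← hn]
        exact Equiv.Perm.pow_apply_eq_self_of_apply_eq_self hfix n
      · rintro rfl
        exact Equiv.Perm.SameCycle.refl _ _
    have := h x
    rw [horb] at this
    simpa using this
  rw [h1, h2, ← Finset.prod_fiberwise_of_maps_to (t := ρ.cycleFactorsFinset)
    (g := fun x => ρ.cycleOf x)
    (fun x hx => Equiv.Perm.cycleOf_mem_cycleFactorsFinset_iff.2 hx)]
  refine Finset.prod_congr rfl fun g hg => ?_
  obtain ⟨x, hx⟩ := (Equiv.Perm.mem_cycleFactorsFinset_iff.1 hg).1.nonempty_support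
  have hgx : g = ρ.cycleOf x := (Equiv.Perm.cycle_is_cycleOf hx hg)
  have hxs : x ∈ ρ.support := Equiv.Perm.mem_cycleFactorsFinset_support_le hg hx
  have e1 : g.support = Finset.univ.filter (fun y => ρ.SameCycle x y) := by
    ext y
    rw [hgx, Equiv.Perm.mem_support_cycleOf_iff]
    simp [hxs]
  have e2 : ρ.support.filter (fun y => ρ.cycleOf y = g) =
      Finset.univ.filter (fun y => ρ.SameCycle x y) := by
    ext y
    simp only [Finset.mem_filter, Finset.mem_univ, true_and]
    constructor
    · rintro ⟨hy, hyg⟩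
      have : y ∈ (ρ.cycleOf y).support := Equiv.Perm.mem_support_cycleOf_iff.2
        ⟨Equiv.Perm.SameCycle.refl _ _, hy⟩
      rw [hyg, hgx, Equiv.Perm.mem_support_cycleOf_iff] at this
      exact this.1
    · intro hxy
      refine ⟨?_, ?_⟩
      · have : y ∈ (ρ.cycleOf x).support := Equiv.Perm.mem_support_cycleOf_iff.2 ⟨hxy, hxs⟩
        exact Equiv.Perm.support_cycleOf_le ρ x this
      · rw [hgx]; exact hxy.symm.cycleOf_eq
  rw [e2, h x, e1]

/-- The weight `F` of the two end labels is arbitrary so that the induction can absorb the first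
matrix into it; taking a further matrix for `F` closes the chain to a trace. -/
lemma sum_open_chain {ι : Type*} [Fintype ι] [DecidableEq ι] {R : Type*} [CommRing R]
    (n : ℕ) (M : Fin n → Matrix ι ι R) (F : ι → ι → R) :
    ∑ j : Fin (n + 1) → ι, (∏ k : Fin n, M k (j k.castSucc) (j k.succ)) * F (j 0) (j (Fin.last n)) =
      ∑ a, ∑ b, (List.ofFn M).prod a b * F a b := by
  induction n generalizing F with
  | zero =>
    rw [← (Equiv.funUnique (Fin 1) ι).symm.sum_comp]
    simp [Matrix.one_apply]
  | succ n ih =>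
    rw [← (Fin.consEquiv (fun _ => ι)).sum_comp, Fintype.sum_prod_type_right]
    have h1 : ∀ (j : Fin (n + 1) → ι), ∑ a, (∏ k : Fin (n + 1),
        M k (Fin.consEquiv (fun _ => ι) (a, j) k.castSucc)
          (Fin.consEquiv (fun _ => ι) (a, j) k.succ)) *
        F (Fin.consEquiv (fun _ => ι) (a, j) 0) (Fin.consEquiv (fun _ => ι) (a, j)
          (Fin.last (n + 1))) =
        (∏ k : Fin n, M k.succ (j k.castSucc) (j k.succ)) *
          (fun b c => ∑ a, M 0 a b * F a c) (j 0) (j (Fin.last n)) := by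
      intro j
      rw [Finset.mul_sum]
      refine Finset.sum_congr rfl fun a _ => ?_
      rw [Fin.prod_univ_succ]
      simp only [Fin.consEquiv_apply, Fin.castSucc_zero, Fin.cons_zero, Fin.cons_succ,
        ← Fin.succ_castSucc, ← Fin.succ_last]
      ring
    refine (Finset.sum_congr rfl fun j _ => h1 j).trans
      ((ih (fun k => M k.succ) (fun b c => ∑ a, M 0 a b * F a c)).trans ?_)
    rw [List.ofFn_succ, List.prod_cons]
    simp only [Matrix.mul_apply, Finset.mul_sum, Finset.sum_mul]
    calc _ = ∑ a, ∑ b, ∑ x, (List.ofFn fun k => M k.succ).prod a b * (M 0 x a * F x b) := rfl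
      _ = ∑ a, ∑ x, ∑ b, (List.ofFn fun k => M k.succ).prod a b * (M 0 x a * F x b) :=
        Finset.sum_congr rfl fun a _ => Finset.sum_comm
      _ = ∑ x, ∑ a, ∑ b, (List.ofFn fun k => M k.succ).prod a b * (M 0 x a * F x b) :=
        Finset.sum_comm
      _ = ∑ x, ∑ b, ∑ a, (List.ofFn fun k => M k.succ).prod a b * (M 0 x a * F x b) :=
        Finset.sum_congr rfl fun a _ => Finset.sum_comm
      _ = _ := by
        refine Finset.sum_congr rfl fun x _ => Finset.sum_congr rfl fun b _ =>
          Finset.sum_congr rfl fun a _ => by ring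

/-- The trace of a product of matrices, as a sum over closed chains of indices. -/
lemma trace_prod_ofFn {ι : Type*} [Fintype ι] [DecidableEq ι] {R : Type*} [CommRing R]
    (n : ℕ) (M : Fin (n + 1) → Matrix ι ι R) :
    (List.ofFn M).prod.trace = ∑ j : Fin (n + 1) → ι, ∏ k, M k (j k) (j (k + 1)) := by
  have h := sum_open_chain n (fun k => M k.castSucc) (fun a b => M (Fin.last n) b a)
  have h1 : ∀ j : Fin (n + 1) → ι, ∏ k, M k (j k) (j (k + 1)) =
      (∏ k : Fin n, M k.castSucc (j k.castSucc) (j k.succ)) *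
        M (Fin.last n) (j (Fin.last n)) (j 0) := by
    intro j
    rw [Fin.prod_univ_castSucc]
    simp
  simp only [h1]
  rw [h, List.ofFn_succ', List.concat_eq_append, List.prod_append, List.prod_singleton,
    Matrix.trace]
  simp [Matrix.mul_apply]

lemma trace_prod_ofFn_of_pos {ι : Type*} [Fintype ι] [DecidableEq ι] {R : Type*} [CommRing R]
    {n : ℕ} (hn : 0 < n) (M : Fin n → Matrix ι ι R) :
    (List.ofFn M).prod.trace = ∑ j : Fin n → ι,
      ∏ k : Fin n, M k (j k) (j ⟨((k : ℕ) + 1) % n, Nat.mod_lt _ hn⟩) := by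
  obtain ⟨n, rfl⟩ : ∃ k, n = k + 1 := ⟨n - 1, by omega⟩
  rw [trace_prod_ofFn]
  refine Finset.sum_congr rfl fun j _ => Finset.prod_congr rfl fun k _ => ?_
  have : k + 1 = ⟨((k : ℕ) + 1) % (n + 1), Nat.mod_lt _ hn⟩ := by
    apply Fin.ext
    simp [Fin.val_add]
  rw [this]

variable {V K : Type*}

/-- Lists without repetition that cut a set into cycles. -/
structure IsCyclePartition (κ : V → K) (l : K → List V) : Prop where
  nodup : ∀ c, (l c).Nodup
  mem_iff : ∀ c v, v ∈ l c ↔ κ v = c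

namespace IsCyclePartition

variable {κ : V → K} {l : K → List V}

lemma κ_formPerm (P : IsCyclePartition κ l) (v : V) : κ ((l (κ v)).formPerm v) = κ v := by
  rw [← P.mem_iff]
  exact List.formPerm_apply_mem_of_mem ((P.mem_iff _ _).2 rfl)

lemma κ_formPerm_inv (P : IsCyclePartition κ l) (v : V) : κ ((l (κ v)).formPerm⁻¹ v) = κ v := by
  rw [← P.mem_iff]
  by_contra h
  have h1 := List.formPerm_apply_of_notMem h
  rw [Equiv.Perm.inv_def] at h h1
  rw [Equiv.apply_symm_apply] at h1
  rw [← h1] at h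
  exact h ((P.mem_iff _ _).2 rfl)

/-- The permutation that moves each element to the next one in its list. -/
def perm (P : IsCyclePartition κ l) : Equiv.Perm V where
  toFun v := (l (κ v)).formPerm v
  invFun v := (l (κ v)).formPerm⁻¹ v
  left_inv v := by
    change (l (κ ((l (κ v)).formPerm v))).formPerm⁻¹ _ = v
    rw [P.κ_formPerm]
    exact Equiv.symm_apply_apply _ _
  right_inv v := by
    change (l (κ ((l (κ v)).formPerm⁻¹ v))).formPerm _ = v
    rw [P.κ_formPerm_inv]
    exact Equiv.apply_symm_apply _ _

lemma κ_perm (P : IsCyclePartition κ l) (v : V) : κ (P.perm v) = κ v := P.κ_formPerm v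

lemma perm_getElem (P : IsCyclePartition κ l) (c : K) (k : ℕ) (hk : k < (l c).length) :
    P.perm (l c)[k] = (l c)[(k + 1) % (l c).length]'(Nat.mod_lt _ (by omega)) := by
  have h1 : κ (l c)[k] = c := (P.mem_iff _ _).1 (List.getElem_mem hk)
  change (l (κ (l c)[k])).formPerm _ = _
  simp only [h1]
  exact List.formPerm_apply_getElem _ (P.nodup c) k hk

lemma perm_getElem_of_lt (P : IsCyclePartition κ l) (c : K) (k : ℕ) (hk : k + 1 < (l c).length) :
    P.perm (l c)[k] = (l c)[k + 1] := by
  rw [P.perm_getElem c k (by omega)]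
  simp only [Nat.mod_eq_of_lt hk]

lemma perm_getElem_last (P : IsCyclePartition κ l) (c : K) (h : 0 < (l c).length) :
    P.perm ((l c)[(l c).length - 1]'(by omega)) = (l c)[0] := by
  rw [P.perm_getElem c _ (by omega)]
  simp only [show (l c).length - 1 + 1 = (l c).length by omega, Nat.mod_self]

/-- The positions in the lists correspond to the elements. -/
def equiv (P : IsCyclePartition κ l) : (Σ c, Fin (l c).length) ≃ V where
  toFun p := (l p.1).get p.2
  invFun v := ⟨κ v, ⟨(l (κ v)).idxOf v, List.idxOf_lt_length_of_mem ((P.mem_iff _ _).2 rfl)⟩⟩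
  left_inv := by
    rintro ⟨c, k⟩
    have h1 : κ ((l c).get k) = c := (P.mem_iff _ _).1 (List.get_mem _ _)
    have h2 : (l c).idxOf ((l c).get k) = k := (P.nodup c).idxOf_getElem k.1 k.2
    have : ∀ c' (h : c' = c) (hlt : (l c').idxOf ((l c).get k) < (l c').length),
        (⟨c', ⟨(l c').idxOf ((l c).get k), hlt⟩⟩ : Σ c, Fin (l c).length) = ⟨c, k⟩ := by
      rintro c' rfl hlt
      congr 1
      exact Fin.ext h2
    exact this _ h1 _
  right_inv v := by simp

lemma prod_eq (P : IsCyclePartition κ l) [Fintype V] [Fintype K] {R : Type*} [CommMonoid R] (f : V → R) :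
    ∏ v, f v = ∏ c, ∏ k : Fin (l c).length, f (l c)[k] := by
  rw [← P.equiv.prod_comp, Fintype.prod_sigma]
  rfl

/-- A sum over labellings of products along the cycles is a product of traces. -/
theorem sum_prod_eq_prod_trace (P : IsCyclePartition κ l) [Fintype V] [Fintype K] (hpos : ∀ c, 0 < (l c).length)
    {ι R : Type*} [Fintype ι] [DecidableEq ι] [CommRing R] (N : V → Matrix ι ι R) :
    ∑ i : V → ι, ∏ v, N v (i v) (i (P.perm v)) = ∏ c, ((l c).map N).prod.trace := by
  have h1 : ∀ c, ((l c).map N).prod.trace = ∑ j : Fin (l c).length → ι,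
      ∏ k : Fin (l c).length, N (l c)[k] (j k)
        (j ⟨((k : ℕ) + 1) % (l c).length, Nat.mod_lt _ (hpos c)⟩) := by
    intro c
    have hl : (l c).map N = List.ofFn (fun k : Fin (l c).length => N (l c)[k]) := by
      apply List.ext_getElem <;> simp
    rw [hl]
    exact trace_prod_ofFn_of_pos (hpos c) _
  simp only [h1]
  rw [Finset.prod_univ_sum, Fintype.piFinset_univ,
    ← ((Equiv.arrowCongr P.equiv.symm (Equiv.refl ι)).trans
      (Equiv.piCurry (fun (c : K) (_ : Fin (l c).length) => ι))).sum_comp]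
  refine Finset.sum_congr rfl fun i _ => ?_
  rw [P.prod_eq]
  refine Finset.prod_congr rfl fun c _ => Finset.prod_congr rfl fun k _ => ?_
  have h2 := P.perm_getElem c k.1 k.2
  simp only [Fin.getElem_fin]
  rw [h2]
  rfl

end IsCyclePartition
end CyclicLists

/-! ### The components of a configuration as cyclic lists -/

section ComponentLists
set_option linter.unusedSectionVars false

open scoped Classical

variable {V : Type*} [Fintype V] {G : SimpleGraph V} {S : Finset V}

/-- The list `l` goes once around the loop `c`, or once along the arc or doubled edge `c` from its
white to its black end. -/
structure IsComponentList (col : G.Coloring Colour) (S : Finset V) (ω : Set (Sym2 V))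
    (c : Component ω) (l : List V) : Prop where
  nodup : l.Nodup
  mem_iff : ∀ v, v ∈ l ↔ (SimpleGraph.fromEdgeSet ω).connectedComponentMk v = c
  two_le : 2 ≤ l.length
  adj : ∀ k (h : k + 1 < l.length), (SimpleGraph.fromEdgeSet ω).Adj l[k] l[k + 1]
  closing : ((SimpleGraph.fromEdgeSet ω).Adj (l[l.length - 1]'(by omega)) (l[0]'(by omega)) ∧
      ∀ v ∈ l, v ∉ S) ∨
    (col (l[0]'(by omega)) = Colour.white ∧ col (l[l.length - 1]'(by omega)) = Colour.black ∧
      l[0]'(by omega) ∈ S ∧ l[l.length - 1]'(by omega) ∈ S ∧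
      ∀ v ∈ l, v ∈ S → v = l[0]'(by omega) ∨ v = l[l.length - 1]'(by omega))

lemma Connection.transport_eq_prod (Φ : Connection G S) (l : List V) :
    Φ.transport l =
      (List.ofFn fun k : Fin (l.length - 1) => Φ.mat (l[(k : ℕ)]'(by omega))
        (l[(k : ℕ) + 1]'(by omega))).prod := by
  induction l with
  | nil => simp [Connection.transport]
  | cons u l ih =>
    cases l with
    | nil => simp [Connection.transport]
    | cons v l =>
      rw [Connection.transport, ih]
      simp [List.ofFn_succ]

lemma mem_loops {ω : Set (Sym2 V)} {c : Component ω} :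
    c ∈ loops ω ↔ ∃ l, IsLoopTraversal ω c l := by
  simp [loops]

lemma mem_arcs {ω : Set (Sym2 V)} {c : Component ω} :
    c ∈ arcs S ω ↔ ∃ v ∈ S, v ∈ c.supp := by
  simp [arcs]

lemma IsArcGraph.mem_component_iff {H : SimpleGraph V} {c : H.ConnectedComponent} {l : List V}
    {x : V} (hx : x ∈ l) (hxc : x ∈ c.supp) (hl : ∀ v ∈ l, H.Reachable x v)
    (hcl : ∀ v ∈ l, ∀ w, H.Adj v w → w ∈ l) (v : V) : v ∈ l ↔ H.connectedComponentMk v = c := by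
  rw [SimpleGraph.ConnectedComponent.mem_supp_iff] at hxc
  rw [← hxc]
  constructor
  · intro hv
    exact SimpleGraph.ConnectedComponent.eq.2 (hl v hv).symm
  · intro hv
    exact IsArcGraph.mem_support_of_reachable hcl hx (SimpleGraph.ConnectedComponent.eq.1 hv).symm

lemma Colour.eq_black_of_ne_white {c : Colour} (h : c ≠ Colour.white) : c = Colour.black := by
  cases c <;> simp_all

/-- The list of a loop or arc is built from the very traversal that is chosen in `loopWeight` or
`arcWeight`. Hence the independence of the weights of that choice need not be proved. A doubled edge
is listed from its white end, where the label will be fixed. -/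
theorem exists_componentList {col : G.Coloring Colour} {ω : Set (Sym2 V)} (hω : ω ∈ configs G S)
    (hbic : ArcsBicoloured col S) (c : Component ω) :
    ∃ l, ∃ h : IsComponentList col S ω c l,
      (c ∈ loops ω ∧ c ∉ arcs S ω ∧ 3 ≤ l.length ∧ (∀ v ∈ l, v ∉ S) ∧
        ∀ Φ : Connection G S, loopWeight Φ ω c =
          (Φ.transport (l ++ [l[0]'(by have := h.two_le; omega)])).trace) ∨
      (c ∉ loops ω ∧ c ∈ arcs S ω ∧ ∃ w s b, l = w :: (s ++ [b]) ∧ w ∈ S ∧ b ∈ S ∧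
        col b = Colour.black ∧
        ∀ (Φ : Connection G S) ψ, arcWeight col Φ ψ ω c = arcValue Φ ψ w s b) ∨
      (c ∉ loops ω ∧ c ∉ arcs S ω ∧ ∃ u v, l = [u, v] ∧ col u = Colour.white ∧ u ∉ S ∧ v ∉ S) := by
  have hH := isArcGraph_of_mem_configs hω
  set H := SimpleGraph.fromEdgeSet ω with hHdef
  by_cases h : ∃ l, IsLoopTraversal ω c l
  · obtain ⟨x, p, hp, hx, hl⟩ := h.choose_spec
    have hlen := hp.three_le_length
    have hcl := hH.cycle_closed hp
    have hmem : ∀ v, v ∈ (List.range p.length).map p.getVert ↔ v ∈ p.support := by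
      intro v
      rw [SimpleGraph.Walk.mem_support_iff_exists_getVert]
      simp only [List.mem_map, List.mem_range]
      constructor
      · rintro ⟨k, hk, rfl⟩
        exact ⟨k, rfl, hk.le⟩
      · rintro ⟨k, rfl, hk⟩
        rcases hk.lt_or_eq with hk | rfl
        · exact ⟨k, hk, rfl⟩
        · exact ⟨0, by omega, by rw [p.getVert_zero, p.getVert_length]⟩
    have hS : ∀ v ∈ (List.range p.length).map p.getVert, v ∉ S :=
      fun v hv => (hcl v ((hmem v).1 hv)).1
    have hclist : IsComponentList col S ω c ((List.range p.length).map p.getVert) := by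
      refine ⟨?_, ?_, by simp; omega, ?_, Or.inl ⟨?_, hS⟩⟩
      · refine (List.nodup_map_iff_inj_on List.nodup_range).2 ?_
        intro a ha b hb hab
        rw [List.mem_range] at ha hb
        exact hp.getVert_injOn' (show a ≤ p.length - 1 by omega) (show b ≤ p.length - 1 by omega)
          hab
      · refine IsArcGraph.mem_component_iff ((hmem x).2 p.start_mem_support) hx ?_ ?_
        · intro v hv
          exact ⟨p.takeUntil v ((hmem v).1 hv)⟩
        · intro v hv w hw
          exact (hmem w).2 ((hcl v ((hmem v).1 hv)).2 w hw)
      · intro k hk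
        simp only [List.length_map, List.length_range] at hk
        simp only [List.getElem_map, List.getElem_range]
        exact p.adj_getVert_succ (by omega)
      · simp only [List.getElem_map, List.getElem_range, List.length_map, List.length_range]
        have := p.adj_getVert_succ (i := p.length - 1) (by omega)
        rw [show p.length - 1 + 1 = p.length by omega, p.getVert_length] at this
        rw [p.getVert_zero]
        exact this
    refine ⟨_, hclist, Or.inl ⟨mem_loops.2 h, ?_, by simpa using hlen, hS, fun Φ => ?_⟩⟩
    · rw [mem_arcs]
      rintro ⟨v, hv, hvc⟩
      exact hS v ((hclist.mem_iff v).2 hvc) hv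
    · rw [loopWeight, dif_pos h, ← hl]
      congr 2
      apply List.ext_getElem
      · simp
      · intro k h1 h2
        rw [SimpleGraph.Walk.support_getElem_eq_getVert]
        simp only [SimpleGraph.Walk.length_support] at h1
        rcases Nat.lt_or_ge k p.length with hk | hk
        · rw [List.getElem_append_left (by simpa using hk)]
          simp
        · rw [List.getElem_append_right (by simpa using hk)]
          simp only [List.getElem_singleton, List.getElem_map, List.getElem_range]
          rw [show k = p.length by omega, p.getVert_length, p.getVert_zero]
  have hnl : c ∉ loops ω := fun h' => h (mem_loops.1 h')
  by_cases hS : ∃ v ∈ S, v ∈ c.supp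
  · have hex : ∃ t : V × List V × V, IsArcTraversal col S ω c t.1 t.2.1 t.2.2 := by
      have key : ∃ w b, w ∈ S ∧ b ∈ S ∧ col w = Colour.white ∧ col b = Colour.black ∧
          w ∈ c.supp ∧ H.Reachable w b := by
        obtain ⟨v, hv, hvc⟩ := hS
        obtain ⟨u, hu, hne, hr⟩ := hH.exists_partner hv
        have hcol := hbic ω hω v hv u hu hne.symm hr
        have huc : u ∈ c.supp := by
          rw [SimpleGraph.ConnectedComponent.mem_supp_iff] at hvc ⊢
          rw [← hvc]
          exact SimpleGraph.ConnectedComponent.eq.2 hr.symm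
        by_cases hw : col v = Colour.white
        · exact ⟨v, u, hv, hu, hw, Colour.eq_black_of_ne_white fun h => hcol (hw.trans h.symm), hvc,
            hr⟩
        · refine ⟨u, v, hu, hv, ?_, Colour.eq_black_of_ne_white hw, huc, hr.symm⟩
          by_contra h
          exact hcol ((Colour.eq_black_of_ne_white hw).trans
            (Colour.eq_black_of_ne_white h).symm)
      obtain ⟨w, b, hw, hb, hcw, hcb, hwc, hr⟩ := key
      obtain ⟨p, hp⟩ := hr.exists_isPath
      have hne : w ≠ b := by rintro rfl; rw [hcw] at hcb; cases hcb
      refine ⟨(w, p.support.tail.dropLast, b), hw, hb, hcw, hcb, hwc, p, hp, ?_⟩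
      cases p with
      | nil => exact absurd rfl hne
      | cons ha q =>
        simp only [SimpleGraph.Walk.support_cons, List.tail_cons, List.cons.injEq, true_and]
        have h1 := List.dropLast_append_getLast q.support_ne_nil
        rw [SimpleGraph.Walk.getLast_support] at h1
        exact h1.symm
    obtain ⟨hw, hb, hcw, hcb, hwc, p, hp, hsup⟩ := hex.choose_spec
    have hwt : ∀ (Φ : Connection G S) ψ, arcWeight col Φ ψ ω c =
        arcValue Φ ψ hex.choose.1 hex.choose.2.1 hex.choose.2.2 := by
      intro Φ ψ
      rw [arcWeight, dif_pos hex]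
    generalize hex.choose.1 = w at *
    generalize hex.choose.2.1 = s at *
    generalize hex.choose.2.2 = b at *
    have hne : w ≠ b := by rintro rfl; rw [hcw] at hcb; cases hcb
    have hcl := hH.path_closed hw hb hne hp
    have hlen : p.length ≠ 0 := fun h => hne (SimpleGraph.Walk.eq_of_length_eq_zero h)
    have hsl := p.length_support
    have h0 : ∀ h, (p.support)[0]'h = w := fun h => by
      rw [SimpleGraph.Walk.support_getElem_eq_getVert, p.getVert_zero]
    have h1 : ∀ h, (p.support)[p.support.length - 1]'h = b := fun h => by
      rw [SimpleGraph.Walk.support_getElem_eq_getVert, hsl, Nat.add_sub_cancel, p.getVert_length]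
    have hclist : IsComponentList col S ω c p.support := by
      refine ⟨hp.support_nodup, ?_, by omega, ?_, Or.inr ?_⟩
      · exact IsArcGraph.mem_component_iff p.start_mem_support hwc
          (fun v hv => ⟨p.takeUntil v hv⟩) hcl
      · intro k hk
        rw [SimpleGraph.Walk.support_getElem_eq_getVert,
          SimpleGraph.Walk.support_getElem_eq_getVert]
        exact p.adj_getVert_succ (by omega)
      · rw [h0, h1]
        exact ⟨hcw, hcb, hw, hb, fun v hv hvS => hH.path_boundary hne hp hv hvS⟩
    exact ⟨_, hclist, Or.inr (Or.inl ⟨hnl, mem_arcs.2 hS, w, s, b, hsup, hw, hb, hcb, hwt⟩)⟩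
  · have hdouble : ∃ u v, col u = Colour.white ∧ u ∉ S ∧ v ∉ S ∧ H.Adj u v ∧
        ∀ w, w ∈ c.supp ↔ w = u ∨ w = v := by
      rcases hH.trichotomy c with ⟨v, p, hp, hv⟩ | h' | ⟨u, v, hu, hv, huv, hs⟩
      · exact absurd ⟨_, v, p, hp, hv, rfl⟩ h
      · exact absurd h' hS
      · by_cases hw : col u = Colour.white
        · exact ⟨u, v, hw, hu, hv, huv, hs⟩
        · refine ⟨v, u, ?_, hv, hu, huv.symm, fun w => (hs w).trans or_comm⟩
          by_contra hv
          exact col.valid (adj_of_mem_configs hω huv) ((Colour.eq_black_of_ne_white hw).trans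
            (Colour.eq_black_of_ne_white hv).symm)
    obtain ⟨u, v, hcu, hu, hv, huv, hs⟩ := hdouble
    refine ⟨[u, v], ⟨by simpa using huv.ne, ?_, by simp, ?_, Or.inl ⟨huv.symm, ?_⟩⟩,
      Or.inr (Or.inr ⟨hnl, fun h' => hS (mem_arcs.1 h'), u, v, rfl, hcu, hu, hv⟩)⟩
    · intro w
      rw [← SimpleGraph.ConnectedComponent.mem_supp_iff, hs]
      simp
    · intro k hk
      have : k = 0 := by simp at hk; omega
      subst this
      exact huv
    · intro w hw
      rcases (by simpa using hw : w = u ∨ w = v) with rfl | rfl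
      · exact hu
      · exact hv

end ComponentLists

/-! ### The circulation of a configuration, and the weights as sums over labellings -/

section Circulation
set_option linter.unusedSectionVars false

open scoped Classical

namespace IsCyclePartition

variable {V K : Type*} {κ : V → K} {l : K → List V}

lemma exists_getElem (P : IsCyclePartition κ l) (v : V) :
    ∃ k, ∃ h : k < (l (κ v)).length, (l (κ v))[k] = v :=
  List.mem_iff_getElem.1 ((P.mem_iff _ _).2 rfl)

lemma perm_of_getElem? (P : IsCyclePartition κ l) {c : K} {k : ℕ} {x y : V}
    (hx : (l c)[k]? = some x) (hy : (l c)[k + 1]? = some y) : P.perm x = y := by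
  obtain ⟨h1, rfl⟩ := List.getElem?_eq_some_iff.1 hx
  obtain ⟨h2, rfl⟩ := List.getElem?_eq_some_iff.1 hy
  exact P.perm_getElem_of_lt c k h2

lemma perm_of_getElem?_last (P : IsCyclePartition κ l) {c : K} {x y : V}
    (hx : (l c)[0]? = some x) (hy : (l c)[(l c).length - 1]? = some y) : P.perm y = x := by
  obtain ⟨h1, rfl⟩ := List.getElem?_eq_some_iff.1 hx
  obtain ⟨h2, rfl⟩ := List.getElem?_eq_some_iff.1 hy
  exact P.perm_getElem_last c h1

lemma perm_pow_getElem (P : IsCyclePartition κ l) (c : K) (k : ℕ) (hk : k < (l c).length) (j : ℕ) :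
    (P.perm ^ j) (l c)[k] = (l c)[(k + j) % (l c).length]'(Nat.mod_lt _ (by omega)) := by
  induction j with
  | zero => simp [Nat.mod_eq_of_lt hk]
  | succ j ih =>
    rw [pow_succ', Equiv.Perm.mul_apply, ih, P.perm_getElem]
    simp [Nat.add_assoc]

lemma perm_perm_eq_self_iff (P : IsCyclePartition κ l) (v : V) :
    P.perm (P.perm v) = v ↔ (l (κ v)).length ≤ 2 := by
  obtain ⟨k, hk, hv⟩ := P.exists_getElem v
  have h := P.perm_pow_getElem (κ v) k hk 2
  rw [hv] at h
  have h' : P.perm (P.perm v) = (l (κ v))[(k + 2) % (l (κ v)).length]'(Nat.mod_lt _ (by omega)) := h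
  rw [h']
  conv_lhs => rhs; rw [← hv]
  rw [(P.nodup (κ v)).getElem_inj_iff]
  clear h h' hv
  generalize (l (κ v)).length = L at *
  constructor
  · intro h
    have h1 : (k + 2) % L = (k + 0) % L := by rw [h, add_zero, Nat.mod_eq_of_lt hk]
    have h2 : 2 ≡ 0 [MOD L] := Nat.ModEq.add_left_cancel' k h1
    exact Nat.le_of_dvd (by omega) ((Nat.modEq_zero_iff_dvd).1 h2)
  · intro h
    rcases (by omega : L = 1 ∨ L = 2) with rfl | rfl <;> omega

end IsCyclePartition

variable {V : Type*} [Fintype V] {G : SimpleGraph V} {S : Finset V}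

/-- A permutation that moves the vertices along the components of the configuration `H`: around
the loops and doubled edges, and along the arcs from the white to the black end, from where it
returns to the white end. -/
structure IsCirculation (col : G.Coloring Colour) (S : Finset V) (H : SimpleGraph V)
    (τ : Equiv.Perm V) : Prop where
  col_ne : ∀ v, col (τ v) ≠ col v
  adj : ∀ v, ¬(v ∈ S ∧ col v = Colour.black) → H.Adj v (τ v)
  black_mem : ∀ v ∈ S, col v = Colour.black → τ v ∈ S
  white_mem : ∀ v, τ v ∈ S → col (τ v) = Colour.white → v ∈ S
  reachable : ∀ v, H.Reachable v (τ v)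
  neighbor : ∀ v w, H.Adj v w → w = τ v ∨ w = τ.symm v

/-- Only the step from the last entry of a list to its first may fail to be an edge; by the form of
the lists this is the return from the black to the white end of an arc. -/
theorem isCirculation {col : G.Coloring Colour} {ω : Set (Sym2 V)} (hω : ω ∈ configs G S)
    {l : Component ω → List V} (hl : ∀ c, IsComponentList col S ω c (l c))
    (P : IsCyclePartition (SimpleGraph.fromEdgeSet ω).connectedComponentMk l) :
    IsCirculation col S (SimpleGraph.fromEdgeSet ω) P.perm := by
  have hH := isArcGraph_of_mem_configs hω
  have hstep : ∀ v, (SimpleGraph.fromEdgeSet ω).Adj v (P.perm v) ∨ (v ∈ S ∧ P.perm v ∈ S ∧ col v = Colour.black ∧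
      col (P.perm v) = Colour.white) := by
    intro v
    obtain ⟨k, hk, hv⟩ := P.exists_getElem v
    have h := hl ((SimpleGraph.fromEdgeSet ω).connectedComponentMk v)
    rcases Nat.lt_or_ge (k + 1) (l ((SimpleGraph.fromEdgeSet ω).connectedComponentMk v)).length with hk1 | hk1
    · left
      have := h.adj k hk1
      rwa [← P.perm_getElem_of_lt _ k hk1, hv] at this
    · have hk2 : k = (l ((SimpleGraph.fromEdgeSet ω).connectedComponentMk v)).length - 1 := by omega
      have h0 := P.perm_getElem_last ((SimpleGraph.fromEdgeSet ω).connectedComponentMk v) (by omega)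
      have hv' : (l ((SimpleGraph.fromEdgeSet ω).connectedComponentMk v))[(l ((SimpleGraph.fromEdgeSet ω).connectedComponentMk v)).length - 1]'(by omega)
          = v := by simp only [← hk2]; exact hv
      rw [hv'] at h0
      rcases h.closing with ⟨h1, _⟩ | ⟨h1, h2, h3, h4, _⟩
      · rw [← h0, hv'] at h1
        exact Or.inl h1
      · rw [← h0] at h1 h3
        rw [hv'] at h2 h4
        exact Or.inr ⟨h4, h3, h2, h1⟩
  have hends : ∀ v ∈ S, (col v = Colour.black → P.perm v ∈ S) ∧
      (col v = Colour.white → P.perm.symm v ∈ S) := by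
    intro v hvS
    have h := hl ((SimpleGraph.fromEdgeSet ω).connectedComponentMk v)
    have h0 := P.perm_getElem_last ((SimpleGraph.fromEdgeSet ω).connectedComponentMk v) (by have := h.two_le; omega)
    rcases h.closing with ⟨_, h1⟩ | ⟨h1, h2, h3, h4, h5⟩
    · exact absurd hvS (h1 v ((P.mem_iff _ _).2 rfl))
    · rcases h5 v ((P.mem_iff _ _).2 rfl) hvS with h | h
      · rw [← h] at h1 h0
        refine ⟨fun hb => ?_, fun _ => ?_⟩
        · rw [h1] at hb; cases hb
        · rw [← h0, Equiv.symm_apply_apply]; exact h4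
      · rw [← h] at h2 h0
        refine ⟨fun _ => ?_, fun hw => ?_⟩
        · rw [h0]; exact h3
        · rw [h2] at hw; cases hw
  have hadj : ∀ v, ¬(v ∈ S ∧ col v = Colour.black) → (SimpleGraph.fromEdgeSet ω).Adj v (P.perm v) := by
    intro v hv
    rcases hstep v with h | h
    · exact h
    · exact absurd ⟨h.1, h.2.2.1⟩ hv
  have hback : ∀ v, ¬(v ∈ S ∧ col v = Colour.white) → (SimpleGraph.fromEdgeSet ω).Adj v (P.perm.symm v) := by
    intro v hv
    rcases hstep (P.perm.symm v) with h | h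
    · rw [Equiv.apply_symm_apply] at h
      exact h.symm
    · rw [Equiv.apply_symm_apply] at h
      exact absurd ⟨h.2.1, h.2.2.2⟩ hv
  refine ⟨fun v => ?_, hadj, fun v hv => (hends v hv).1, fun v hv hw => ?_, fun v => ?_,
    fun v w hw => ?_⟩
  · rcases hstep v with h | h
    · exact (col.valid (adj_of_mem_configs hω h)).symm
    · rw [h.2.2.1, h.2.2.2]; decide
  · have := (hends _ hv).2 hw
    rwa [Equiv.symm_apply_apply] at this
  · exact (SimpleGraph.ConnectedComponent.eq.1 (P.κ_perm v)).symm
  · by_cases hvS : v ∈ S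
    · by_cases hcw : col v = Colour.white
      · exact Or.inl (hH.boundary_unique hvS hw (hadj v (by simp [hcw])))
      · exact Or.inr (hH.boundary_unique hvS hw (hback v (by simp [hcw])))
    · have h1 := hadj v (by simp [hvS])
      have h2 := hback v (by simp [hvS])
      by_cases hne : P.perm v = P.perm.symm v
      · have hlen := (P.perm_perm_eq_self_iff v).1 (by rw [hne, Equiv.apply_symm_apply])
        have hκ : (SimpleGraph.fromEdgeSet ω).connectedComponentMk w = (SimpleGraph.fromEdgeSet ω).connectedComponentMk v :=
          SimpleGraph.ConnectedComponent.eq.2 hw.reachable.symm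
        have hκ' := P.κ_perm v
        have h2l := (hl ((SimpleGraph.fromEdgeSet ω).connectedComponentMk v)).two_le
        obtain ⟨a, ha, hva⟩ := P.exists_getElem v
        obtain ⟨b, hb, hwb⟩ := List.mem_iff_getElem.1 ((P.mem_iff _ _).2 hκ)
        obtain ⟨d, hd, hpd⟩ := List.mem_iff_getElem.1 ((P.mem_iff _ _).2 hκ')
        have hab : a ≠ b := by rintro rfl; exact hw.ne (hva.symm.trans hwb)
        have had : a ≠ d := by rintro rfl; exact h1.ne (hva.symm.trans hpd)
        left
        rw [← hwb, ← hpd]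
        simp only [show b = d by omega]
      · exact (hH.two_neighbors h1 h2 hne hw).2

/-- The vertex of the folded graph over `v`, in the copy `k` if `v` is in the bulk. -/
def DoubledVertex.lift (S : Finset V) (v : V) (k : Fin 2) : DoubledVertex S :=
  if h : v ∈ S then .boundary v h else .bulk v h k

lemma DoubledVertex.lift_boundary {v : V} (h : v ∈ S) (k : Fin 2) :
    lift S v k = .boundary v h := dif_pos h

lemma DoubledVertex.lift_bulk {v : V} (h : v ∉ S) (k : Fin 2) :
    lift S v k = .bulk v h k := dif_neg h

/-- The vertices at which the labels of a configuration are fixed. -/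
def IsPinned (col : G.Coloring Colour) (S : Finset V) (τ : Equiv.Perm V) (v : V) : Prop :=
  v ∈ S ∨ (col v = Colour.white ∧ τ (τ v) = v)

/-- The weight of the step from `v`, for labels `a` at `v` and `b` at the next vertex. -/
def stepWeight (col : G.Coloring Colour) (Φ : Connection G S) (ψ : V → V → Fin 2 → ℂ)
    (τ : Equiv.Perm V) (v : V) : Matrix (Fin 2) (Fin 2) ℂ := fun a b =>
  if v ∈ S ∧ col v = Colour.black then 1
  else edgeWeight Φ ψ (DoubledVertex.lift S v a) (DoubledVertex.lift S (τ v) b)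

/-- The weight of the step from `v`, cut down to the admissible labels. -/
def pinnedStepWeight (col : G.Coloring Colour) (Φ : Connection G S) (ψ : V → V → Fin 2 → ℂ)
    (τ : Equiv.Perm V) (v : V) : Matrix (Fin 2) (Fin 2) ℂ := fun a b =>
  if IsPinned col S τ v ∧ a ≠ 0 then 0 else stepWeight col Φ ψ τ v a b

section

variable {col : G.Coloring Colour} {Φ : Connection G S} {ψ : V → V → Fin 2 → ℂ}
  {τ : Equiv.Perm V} {u v : V}

lemma stepWeight_bulk (hv : v ∉ S) (hu : u ∉ S) (h : τ v = u) :
    stepWeight col Φ ψ τ v = Φ.mat v u := by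
  ext a b
  simp [stepWeight, hv, h, hu, DoubledVertex.lift_bulk, edgeWeight]

lemma stepWeight_last (hv : v ∉ S) (hu : u ∈ S) (h : τ v = u) (a b : Fin 2) :
    stepWeight col Φ ψ τ v a b = ψ v u a := by
  simp [stepWeight, hv, h, hu, DoubledVertex.lift_bulk, DoubledVertex.lift_boundary, edgeWeight]

lemma stepWeight_first (hv : v ∈ S) (hw : col v ≠ Colour.black) (hu : u ∉ S) (h : τ v = u)
    (a b : Fin 2) : stepWeight col Φ ψ τ v a b = ψ u v b := by
  simp [stepWeight, hv, hw, h, hu, DoubledVertex.lift_bulk, DoubledVertex.lift_boundary, edgeWeight]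

lemma stepWeight_boundary (hv : v ∈ S) (hu : u ∈ S) (h : τ v = u) (a b : Fin 2) :
    stepWeight col Φ ψ τ v a b = 1 := by
  simp [stepWeight, hv, h, hu, DoubledVertex.lift_boundary, edgeWeight]

lemma pinnedStepWeight_of_not (h : ¬ IsPinned col S τ v) :
    pinnedStepWeight col Φ ψ τ v = stepWeight col Φ ψ τ v := by
  ext a b
  simp [pinnedStepWeight, h]

lemma pinnedStepWeight_of (h : IsPinned col S τ v) (a b : Fin 2) :
    pinnedStepWeight col Φ ψ τ v a b = if a = 0 then stepWeight col Φ ψ τ v 0 b else 0 := by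
  by_cases ha : a = 0 <;> simp [pinnedStepWeight, h, ha]

/-- Fixing a label amounts to deleting a row of the step matrix, so the restricted sum becomes a
free sum, which splits into traces. -/
lemma sum_pinned (f : (V → Fin 2) → ℂ) (hf : ∀ i, f i = ∏ v, stepWeight col Φ ψ τ v (i v) (i (τ v))) :
    ∑ i with (∀ v, IsPinned col S τ v → i v = 0), f i =
      ∑ i : V → Fin 2, ∏ v, pinnedStepWeight col Φ ψ τ v (i v) (i (τ v)) := by
  rw [Finset.sum_filter]
  refine Finset.sum_congr rfl fun i _ => ?_
  split_ifs with h
  · rw [hf]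
    refine Finset.prod_congr rfl fun v _ => ?_
    rw [pinnedStepWeight, if_neg]
    rintro ⟨h1, h2⟩
    exact h2 (h v h1)
  · push Not at h
    obtain ⟨v, h1, h2⟩ := h
    exact (Finset.prod_eq_zero (Finset.mem_univ v)
      (by rw [pinnedStepWeight, if_pos ⟨h1, h2⟩])).symm

end

section Traces

variable {col : G.Coloring Colour} {ω : Set (Sym2 V)} {l : Component ω → List V}
  (P : IsCyclePartition (SimpleGraph.fromEdgeSet ω).connectedComponentMk l)
  (Φ : Connection G S) (ψ : V → V → Fin 2 → ℂ)

lemma not_isPinned {c : Component ω} (h3 : 3 ≤ (l c).length) {v : V} (hv : v ∈ l c) (hvS : v ∉ S) :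
    ¬ IsPinned col S P.perm v := by
  rintro (h | ⟨_, h⟩)
  · exact hvS h
  · rw [P.perm_perm_eq_self_iff, (P.mem_iff _ _).1 hv] at h
    omega

/-- No label on a loop is fixed, so the step matrices are those of the connection. -/
lemma trace_loop {c : Component ω} (h3 : 3 ≤ (l c).length) (hS : ∀ v ∈ l c, v ∉ S) :
    ((l c).map (pinnedStepWeight col Φ ψ P.perm)).prod.trace =
      (Φ.transport (l c ++ [(l c)[0]])).trace := by
  rw [Connection.transport_eq_prod]
  congr 2
  apply List.ext_getElem
  · simp
  · intro k h1 h2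
    simp only [List.length_map] at h1
    have hk := List.getElem_mem h1
    rw [List.getElem_map, List.getElem_ofFn, pinnedStepWeight_of_not (not_isPinned P h3 hk (hS _ hk))]
    simp only [List.getElem_append_left h1]
    refine stepWeight_bulk (hS _ hk) ?_ ?_
    · have := List.getElem_mem (l := l c ++ [(l c)[0]]) (n := k + 1) (by simp; omega)
      rw [List.mem_append, List.mem_singleton] at this
      rcases this with h | h
      · exact hS _ h
      · rw [h]; exact hS _ (List.getElem_mem _)
    · rw [P.perm_getElem]
      rcases Nat.lt_or_ge (k + 1) (l c).length with hk1 | hk1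
      · rw [List.getElem_append_left hk1]
        simp only [Nat.mod_eq_of_lt hk1]
      · rw [List.getElem_append_right hk1]
        simp only [List.getElem_singleton, show k + 1 = (l c).length by omega, Nat.mod_self]

lemma prod_map_stepWeight {s : List V} {z : V} (hs : ∀ v ∈ s ++ [z], v ∉ S) {c : Component ω} {k : ℕ}
    (h : ∀ j, j < (s ++ [z]).length → (l c)[k + j]? = (s ++ [z])[j]?) :
    (s.map (stepWeight col Φ ψ P.perm)).prod = Φ.transport (s ++ [z]) := by
  rw [Connection.transport_eq_prod]
  congr 1
  apply List.ext_getElem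
  · simp
  · intro j h1 h2
    simp only [List.length_map] at h1
    rw [List.getElem_map, List.getElem_ofFn]
    simp only [List.getElem_append_left h1]
    refine stepWeight_bulk (hs _ (by simp)) (hs _ (List.getElem_mem _)) ?_
    refine P.perm_of_getElem? (c := c) (k := k + j) ?_ ?_
    · rw [h j (by simp; omega), List.getElem?_append_left h1, List.getElem?_eq_getElem h1]
    · rw [add_assoc, h (j + 1) (by simp; omega), List.getElem?_eq_getElem]

/-- With the labels at both ends fixed, the first step contributes the row vector `ψ_w`, the last
bulk step the column vector `ψ_b`, and the return step a factor `1`; the trace of the product is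
then a scalar `ψᵀ φ ψ`. -/
lemma trace_arc {c : Component ω} {w b : V} {s : List V} (hl : l c = w :: (s ++ [b])) (hw : w ∈ S)
    (hb : b ∈ S) (hcb : col b = Colour.black) (hcw : col w ≠ Colour.black)
    (hs : ∀ v ∈ s, v ∉ S) :
    ((l c).map (pinnedStepWeight col Φ ψ P.perm)).prod.trace = arcValue Φ ψ w s b := by
  have hlast : ∀ a d, pinnedStepWeight col Φ ψ P.perm b a d = if a = 0 then 1 else 0 := by
    intro a d
    rw [pinnedStepWeight_of (Or.inl hb)]
    simp [stepWeight, hb, hcb]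
  rcases List.eq_nil_or_concat s with rfl | ⟨s', z, rfl⟩
  · have hwb : P.perm w = b := P.perm_of_getElem? (c := c) (k := 0) (by simp [hl]) (by simp [hl])
    have hfirst : ∀ a d, pinnedStepWeight col Φ ψ P.perm w a d = if a = 0 then 1 else 0 := by
      intro a d
      rw [pinnedStepWeight_of (Or.inl hw), stepWeight_boundary hw hb hwb]
    rw [hl, arcValue]
    simp [Matrix.trace_fin_two, Matrix.mul_apply, hlast, hfirst]
  · rw [List.concat_eq_append] at hl hs ⊢
    have hlen : 3 ≤ (l c).length := by simp [hl]
    have hne : s' ++ [z] ≠ [] := by simp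
    have hfst : ∀ a d, pinnedStepWeight col Φ ψ P.perm w a d =
        if a = 0 then ψ ((s' ++ [z]).head hne) w d else 0 := by
      intro a d
      rw [pinnedStepWeight_of (Or.inl hw), stepWeight_first hw hcw (hs _ (List.head_mem hne))]
      refine P.perm_of_getElem? (c := c) (k := 0) (by simp [hl]) ?_
      rw [hl, zero_add, List.getElem?_cons_succ, List.getElem?_append_left (by simp),
        List.head_eq_getElem, List.getElem?_eq_getElem]
    have hz : ∀ a d, pinnedStepWeight col Φ ψ P.perm z a d = ψ z b a := by
      intro a d
      rw [pinnedStepWeight_of_not (not_isPinned P hlen (by simp [hl]) (hs z (by simp))),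
        stepWeight_last (hs z (by simp)) hb]
      refine P.perm_of_getElem? (c := c) (k := s'.length + 1) ?_ ?_
      · simp [hl]
      · simp [hl]
    have hmid : (s'.map (pinnedStepWeight col Φ ψ P.perm)).prod = Φ.transport (s' ++ [z]) := by
      rw [← prod_map_stepWeight P Φ ψ (col := col) hs (c := c) (k := 1)]
      · congr 1
        refine List.map_congr_left fun v hv => ?_
        exact pinnedStepWeight_of_not (not_isPinned P hlen (by simp [hl, hv]) (hs v (by simp [hv])))
      · intro j hj
        rw [hl, add_comm, List.getElem?_cons_succ, List.getElem?_append_left hj]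
    rw [hl, arcValue, dif_neg hne, List.map_cons, List.prod_cons, List.map_append, List.prod_append,
      List.map_append, List.prod_append, hmid]
    simp only [List.map_cons, List.map_nil, List.prod_singleton, List.getLast_append_singleton]
    generalize Φ.transport (s' ++ [z]) = T
    simp [Matrix.trace_fin_two, Matrix.mul_apply, hlast, hfst, hz, dotProduct, Matrix.mulVec,
      Fin.sum_univ_two]

/-- The two matrices are inverse to each other. With the label of the white end fixed, the trace
reduces to the upper left entry of their product. -/
lemma trace_double {c : Component ω} {u v : V} (hl : l c = [u, v]) (hu : u ∉ S)
    (hv : v ∉ S) (hcu : col u = Colour.white) (hcv : col v ≠ Colour.white) (huv : G.Adj u v) :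
    ((l c).map (pinnedStepWeight col Φ ψ P.perm)).prod.trace = 1 := by
  have huv' : P.perm u = v := P.perm_of_getElem? (c := c) (k := 0) (by simp [hl]) (by simp [hl])
  have hvu' : P.perm v = u := P.perm_of_getElem?_last (c := c) (by simp [hl]) (by simp [hl])
  have h1 : ∀ a d, pinnedStepWeight col Φ ψ P.perm u a d = if a = 0 then Φ.mat u v 0 d else 0 := by
    intro a d
    rw [pinnedStepWeight_of (Or.inr ⟨hcu, by rw [huv', hvu']⟩), stepWeight_bulk hu hv huv']
  have h2 : pinnedStepWeight col Φ ψ P.perm v = Φ.mat v u := by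
    rw [pinnedStepWeight_of_not, stepWeight_bulk hv hu hvu']
    rintro (h | h)
    · exact hv h
    · exact hcv h.1
  have h3 : Φ.mat u v * Φ.mat v u = 1 := by
    rw [Connection.mat, Connection.mat, Φ.symm u v hu hv huv, ← Matrix.SpecialLinearGroup.coe_mul,
      mul_inv_cancel, Matrix.SpecialLinearGroup.coe_one]
  have h4 := congrFun (congrFun h3 0) 0
  rw [hl]
  simp only [List.map_cons, List.map_nil, List.prod_cons, List.prod_nil, mul_one,
    Matrix.trace_fin_two, Matrix.mul_apply, Fin.sum_univ_two, h1, h2] at h4 ⊢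
  simpa using h4

end Traces

/-- The sum factorises over the components into traces, and the components that are neither loops
nor arcs are doubled edges, with trace `1`. -/
theorem exists_circulation {col : G.Coloring Colour} {ω : Set (Sym2 V)} (hω : ω ∈ configs G S)
    (hbic : ArcsBicoloured col S) :
    ∃ l : Component ω → List V, (∀ c, IsComponentList col S ω c (l c)) ∧
      ∃ P : IsCyclePartition (SimpleGraph.fromEdgeSet ω).connectedComponentMk l,
        ∀ (Φ : Connection G S) (ψ : V → V → Fin 2 → ℂ),
          ∑ i : V → Fin 2 with (∀ v, IsPinned col S P.perm v → i v = 0),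
            ∏ v, stepWeight col Φ ψ P.perm v (i v) (i (P.perm v)) =
          (∏ c ∈ loops ω, loopWeight Φ ω c) * ∏ c ∈ arcs S ω, arcWeight col Φ ψ ω c := by
  choose l hl hform using fun c => exists_componentList hω hbic (col := col) c
  have P : IsCyclePartition (SimpleGraph.fromEdgeSet ω).connectedComponentMk l :=
    ⟨fun c => (hl c).nodup, fun c v => (hl c).mem_iff v⟩
  refine ⟨l, hl, P, fun Φ ψ => ?_⟩
  rw [sum_pinned _ fun i => rfl, P.sum_prod_eq_prod_trace (fun c => by have := (hl c).two_le; omega),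
    ← Finset.prod_subset (Finset.subset_univ (loops ω ∪ arcs S ω)), Finset.prod_union]
  · congr 1
    · refine Finset.prod_congr rfl fun c hc => ?_
      rcases hform c with ⟨_, _, h3, hS, h⟩ | ⟨h, _⟩ | ⟨h, _⟩
      · rw [trace_loop P Φ ψ h3 hS, h]
      · exact absurd hc h
      · exact absurd hc h
    · refine Finset.prod_congr rfl fun c hc => ?_
      rcases hform c with ⟨_, h, _⟩ | ⟨_, _, w, s, b, h1, hw, hb, hcb, h⟩ | ⟨_, h, _⟩
      · exact absurd hc h
      · have hcw : col w ≠ Colour.black := by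
          have hc := (isCirculation hω hl P).col_ne b
          rw [P.perm_of_getElem?_last (c := c) (x := w) (by simp [h1]) (by simp [h1]), hcb] at hc
          exact hc
        rw [trace_arc P Φ ψ h1 hw hb hcb hcw, h]
        intro v hv hvS
        have hnd := (hl c).nodup
        rcases (hl c).closing with ⟨_, h5⟩ | ⟨_, _, _, _, h5⟩
        · exact h5 w (by simp [h1]) hw
        · have := h5 v (by simp [h1, hv]) hvS
          simp only [h1] at hnd this
          rw [List.nodup_cons, List.nodup_append] at hnd
          simp only [List.length_cons, List.length_append, List.length_nil, zero_add,
            List.getElem_cons_zero, Nat.add_sub_cancel] at this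
          rcases this with rfl | h6
          · exact hnd.1 (by simp [hv])
          · rw [List.getElem_cons_succ, List.getElem_append_right le_rfl] at h6
            simp only [Nat.sub_self, List.getElem_cons_zero] at h6
            exact hnd.2.2.2 v hv b (by simp) h6
      · exact absurd hc h
  · refine Finset.disjoint_left.2 fun c hc hc' => ?_
    rcases hform c with ⟨_, h, _⟩ | ⟨h, _⟩ | ⟨h, _⟩
    · exact h hc'
    · exact h hc
    · exact h hc
  · intro c _ hc
    rw [Finset.mem_union, not_or] at hc
    rcases hform c with ⟨h, _⟩ | ⟨_, h, _⟩ | ⟨_, _, u, v, h1, hcu, hu, hv⟩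
    · exact absurd h hc.1
    · exact absurd h hc.2
    · have hadj : (SimpleGraph.fromEdgeSet ω).Adj u v := by
        have := (hl c).adj 0 (by simp [h1])
        simpa only [h1, List.getElem_cons_zero, List.getElem_cons_succ] using this
      have huv := adj_of_mem_configs hω hadj
      exact trace_double P Φ ψ h1 hu hv hcu (fun h => col.valid huv (hcu.trans h.symm)) huv

end Circulation

/-! ### The phases along the components -/

section Phases
set_option linter.unusedSectionVars false

open scoped Classical

namespace IsCyclePartition

variable {V K : Type*} {κ : V → K} {l : K → List V}

lemma perm_pow_length (P : IsCyclePartition κ l) (v : V) : (P.perm ^ (l (κ v)).length) v = v := by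
  obtain ⟨k, hk, hv⟩ := P.exists_getElem v
  have h := P.perm_pow_getElem (κ v) k hk (l (κ v)).length
  simp only [Nat.add_mod_right, Nat.mod_eq_of_lt hk] at h
  rwa [hv] at h

lemma κ_perm_pow (P : IsCyclePartition κ l) (v : V) (j : ℕ) : κ ((P.perm ^ j) v) = κ v := by
  induction j with
  | zero => rfl
  | succ j ih => rw [pow_succ', Equiv.Perm.mul_apply, P.κ_perm, ih]

lemma perm_pow_injOn (P : IsCyclePartition κ l) (v : V) {i j : ℕ} (hi : i < (l (κ v)).length)
    (hj : j < (l (κ v)).length) (h : (P.perm ^ i) v = (P.perm ^ j) v) : i = j := by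
  obtain ⟨k, hk, hv⟩ := P.exists_getElem v
  have h1 := P.perm_pow_getElem (κ v) k hk i
  have h2 := P.perm_pow_getElem (κ v) k hk j
  rw [hv] at h1 h2
  rw [h1, h2, (P.nodup _).getElem_inj_iff] at h
  have h3 : i ≡ j [MOD (l (κ v)).length] := Nat.ModEq.add_left_cancel' k h
  rwa [Nat.ModEq, Nat.mod_eq_of_lt hi, Nat.mod_eq_of_lt hj] at h3

lemma exists_perm_pow (P : IsCyclePartition κ l) {v w : V} (h : κ w = κ v) :
    ∃ j < (l (κ v)).length, (P.perm ^ j) v = w := by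
  obtain ⟨a, ha, hv⟩ := P.exists_getElem v
  obtain ⟨b, hb, hw⟩ := List.mem_iff_getElem.1 ((P.mem_iff _ _).2 h)
  refine ⟨(b + (l (κ v)).length - a) % (l (κ v)).length, Nat.mod_lt _ (by omega), ?_⟩
  have h1 := P.perm_pow_getElem (κ v) a ha ((b + (l (κ v)).length - a) % (l (κ v)).length)
  rw [hv] at h1
  rw [h1, ← hw]
  congr 1
  rw [Nat.add_mod_mod, show a + (b + (l (κ v)).length - a) = b + (l (κ v)).length by omega,
    Nat.add_mod_right, Nat.mod_eq_of_lt hb]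

lemma prod_pow [Fintype V] (P : IsCyclePartition κ l) {R : Type*} [CommMonoid R] (f : V → R)
    (v : V) : ∏ k ∈ Finset.range (l (κ v)).length, f ((P.perm ^ k) v) =
      ∏ w with κ w = κ v, f w := by
  refine Finset.prod_bij (fun k _ => (P.perm ^ k) v) ?_ ?_ ?_ (fun _ _ => rfl)
  · intro k _
    exact Finset.mem_filter.2 ⟨Finset.mem_univ _, P.κ_perm_pow v k⟩
  · intro i hi j hj h
    exact P.perm_pow_injOn v (Finset.mem_range.1 hi) (Finset.mem_range.1 hj) h
  · intro w hw
    obtain ⟨j, hj, h⟩ := P.exists_perm_pow (Finset.mem_filter.1 hw).2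
    exact ⟨j, Finset.mem_range.2 hj, h⟩

end IsCyclePartition

variable {V : Type*} [Fintype V] {G : SimpleGraph V} {S : Finset V}

/-- The sign of the edge between `u` and `v`. -/
def edgeSign (x : G.edgeSet → ℤˣ) (u v : V) : ℤˣ :=
  if h : G.Adj u v then x ⟨s(u, v), h⟩ else 1

lemma edgeSign_eq (x : G.edgeSet → ℤˣ) {u v : V} (e : G.edgeSet) (h : e.1 = s(u, v)) :
    edgeSign x u v = x e := by
  obtain ⟨e, he⟩ := e
  subst h
  exact dif_pos he

lemma edgeSign_comm (x : G.edgeSet → ℤˣ) (u v : V) : edgeSign x u v = edgeSign x v u := by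
  by_cases h : G.Adj u v
  · rw [edgeSign_eq x ⟨s(u, v), h⟩ rfl, edgeSign_eq x ⟨s(u, v), h⟩ Sym2.eq_swap]
  · rw [edgeSign, edgeSign, dif_neg h, dif_neg fun h' => h h'.symm]

/-- The sign of the chord that joins the black vertex `b` and the white vertex `w` of the path. -/
def chordSign {n : ℕ} (bd : Fin n → V) (b w : V) : ℤˣ :=
  if ∃ i j, i < j ∧ bd i = b ∧ bd j = w then -1 else 1

/-- The sign of the step of the circulation `τ` from `v`. -/
def stepSign (col : G.Coloring Colour) (S : Finset V) {n : ℕ} (bd : Fin n → V)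
    (x : G.edgeSet → ℤˣ) (τ : Equiv.Perm V) (v : V) : ℤˣ :=
  if v ∈ S ∧ col v = Colour.black then chordSign bd v (τ v) else edgeSign x v (τ v)

lemma colourSign_pow {col : G.Coloring Colour} {τ : Equiv.Perm V} (h : ∀ v, col (τ v) ≠ col v)
    (v : V) (k : ℕ) : colourSign (col ((τ ^ k) v)) = (-1) ^ k * colourSign (col v) := by
  induction k with
  | zero => simp
  | succ k ih =>
    rw [pow_succ', Equiv.Perm.mul_apply, colourSign_of_ne (h _).symm, ih, pow_succ]
    simp

/-- The map `τ` permutes `U` and exchanges the colours, so reindexing the product of the colour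
signs over `U` by `τ` multiplies it by `(-1) ^ #U`. -/
lemma neg_one_pow_card_of_closed {col : G.Coloring Colour} {τ : Equiv.Perm V}
    (h : ∀ v, col (τ v) ≠ col v) (U : Finset V) (hU : ∀ v ∈ U, τ v ∈ U) :
    (-1 : ℤˣ) ^ U.card = 1 := by
  have h1 : U.map τ.toEmbedding = U := by
    refine Finset.eq_of_subset_of_card_le ?_ (by simp)
    intro v hv
    obtain ⟨u, hu, rfl⟩ := Finset.mem_map.1 hv
    exact hU u hu
  have h2 : ∏ v ∈ U, colourSign (col v) = (-1) ^ U.card * ∏ v ∈ U, colourSign (col v) := by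
    conv_lhs => rw [← h1, Finset.prod_map]
    rw [← Finset.prod_const, ← Finset.prod_mul_distrib]
    refine Finset.prod_congr rfl fun v _ => ?_
    rw [neg_one_mul]
    exact colourSign_of_ne (h v).symm
  exact (mul_eq_right.1 h2.symm)

section

variable {col : G.Coloring Colour} {ω : Set (Sym2 V)} {l : Component ω → List V}

lemma even_length (hω : ω ∈ configs G S) (hl : ∀ c, IsComponentList col S ω c (l c))
    (P : IsCyclePartition (SimpleGraph.fromEdgeSet ω).connectedComponentMk l) (v : V) :
    Even (l ((SimpleGraph.fromEdgeSet ω).connectedComponentMk v)).length := by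
  have h := colourSign_pow (isCirculation hω hl P).col_ne v
    (l ((SimpleGraph.fromEdgeSet ω).connectedComponentMk v)).length
  rw [P.perm_pow_length, right_eq_mul] at h
  by_contra hodd
  rw [Nat.not_even_iff_odd] at hodd
  rw [hodd.neg_one_pow] at h
  exact absurd h (by decide)

/-- An edge leaving the interior ends on the enclosing component, so every other component that
meets the interior lies in it, and the interior is closed under the circulation. -/
lemma neg_one_pow_card_interior (hω : ω ∈ configs G S)
    (hl : ∀ c, IsComponentList col S ω c (l c))
    (P : IsCyclePartition (SimpleGraph.fromEdgeSet ω).connectedComponentMk l) (v : V)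
    {U : Finset V} (h1 : ∀ w ∈ U,
      (SimpleGraph.fromEdgeSet ω).connectedComponentMk w ≠
        (SimpleGraph.fromEdgeSet ω).connectedComponentMk v)
    (h2 : ∀ a b, G.Adj a b → a ∈ U → b ∈ U ∨
      (SimpleGraph.fromEdgeSet ω).connectedComponentMk b =
        (SimpleGraph.fromEdgeSet ω).connectedComponentMk v) : (-1 : ℤˣ) ^ U.card = 1 := by
  have hτ := isCirculation hω hl P
  refine neg_one_pow_card_of_closed hτ.col_ne U fun w hw => ?_
  obtain ⟨p⟩ := hτ.reachable w
  have key : ∀ a b, (SimpleGraph.fromEdgeSet ω).Walk a b → a ∈ U → b ∈ U := by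
    intro a b p
    induction p with
    | nil => exact id
    | cons h _ ih =>
      intro ha
      refine ih ((h2 _ _ (adj_of_mem_configs hω h) ha).resolve_right fun hb => h1 _ ha ?_)
      rw [← hb]
      exact SimpleGraph.ConnectedComponent.eq.2 h.reachable
  exact key _ _ p hw

/-- The product of the signs along a component of length `2 * m` is `(-1) ^ (m + 1)`. -/
theorem prod_stepSign {M : PlaneEmbedding G} (hG : G.Connected) {n : ℕ} {bd : Fin n → V}
    (hbd : IsBoundaryPath M bd) (hS : ∀ v ∈ S, ∃ i, bd i = v) {x : G.edgeSet → ℤˣ}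
    (hx : M.IsSignPhase x)
    (halt : ∀ k l : Fin n, (l : ℕ) = k + 1 → ∀ e : G.edgeSet, e.1 = s(bd k, bd l) →
      x e = colourSign (col (bd k))) (hω : ω ∈ configs G S)
    (hl : ∀ c, IsComponentList col S ω c (l c))
    (P : IsCyclePartition (SimpleGraph.fromEdgeSet ω).connectedComponentMk l) (v : V) {m : ℕ}
    (hm : (l ((SimpleGraph.fromEdgeSet ω).connectedComponentMk v)).length = 2 * m) :
    ∏ w with (SimpleGraph.fromEdgeSet ω).connectedComponentMk w =
      (SimpleGraph.fromEdgeSet ω).connectedComponentMk v, stepSign col S bd x P.perm w =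
      (-1) ^ (m + 1) := by
  have hτ := isCirculation hω hl P
  obtain ⟨c, hc⟩ : ∃ c, (SimpleGraph.fromEdgeSet ω).connectedComponentMk v = c := ⟨_, rfl⟩
  rw [hc] at hm ⊢
  have hlc := hl c
  have hL2 := hlc.two_le
  set w := (l c)[0]'(by omega) with hw
  have hwc : (SimpleGraph.fromEdgeSet ω).connectedComponentMk w = c :=
    (P.mem_iff _ _).1 (List.getElem_mem _)
  have hpow : ∀ k (h : k < (l c).length), (P.perm ^ k) w = (l c)[k] := by
    intro k h
    have := P.perm_pow_getElem c 0 (by omega) k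
    simp only [zero_add, Nat.mod_eq_of_lt h] at this
    exact this
  have hmem : ∀ k, (SimpleGraph.fromEdgeSet ω).connectedComponentMk ((P.perm ^ k) w) = c := by
    intro k
    rw [P.κ_perm_pow, hwc]
  have hinj : ∀ i < (l c).length, ∀ j < (l c).length, (P.perm ^ i) w = (P.perm ^ j) w → i = j := by
    intro i hi j hj h
    exact P.perm_pow_injOn w (by rwa [hwc]) (by rwa [hwc]) h
  have hloop : (P.perm ^ (l c).length) w = w := by
    have := P.perm_pow_length w
    rwa [hwc] at this
  have hprod := P.prod_pow (stepSign col S bd x P.perm) w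
  rw [hwc] at hprod
  rw [← hprod]
  have hsurj : ∀ u, (SimpleGraph.fromEdgeSet ω).connectedComponentMk u = c →
      ∃ k < (l c).length, (P.perm ^ k) w = u := by
    intro u hu
    have := P.exists_perm_pow (v := w) (w := u) (hu.trans hwc.symm)
    rwa [hwc] at this
  have hUeven : ∀ U : Finset V, (∀ k < (l c).length, (P.perm ^ k) w ∉ U) →
      (∀ u v, G.Adj u v → u ∈ U → v ∈ U ∨ ∃ k < (l c).length, (P.perm ^ k) w = v) →
      (-1 : ℤˣ) ^ U.card = 1 := by
    intro U h1 h2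
    refine neg_one_pow_card_interior hω hl P v (U := U) ?_ ?_
    · intro u hu h
      obtain ⟨k, hk, rfl⟩ := hsurj u (h.trans hc)
      exact h1 k hk hu
    · intro a b hab ha
      rcases h2 a b hab ha with h | ⟨k, _, rfl⟩
      · exact Or.inl h
      · exact Or.inr ((hmem k).trans hc.symm)
  have hnext : ∀ k, (P.perm ^ (k + 1)) w = P.perm ((P.perm ^ k) w) := by
    intro k
    rw [pow_succ', Equiv.Perm.mul_apply]
  rcases hlc.closing with ⟨_, hnS⟩ | ⟨h1, h2, h3, h4, h5⟩
  · have hnS' : ∀ k, (P.perm ^ k) w ∉ S := fun k => hnS _ ((P.mem_iff _ _).2 (hmem k))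
    have hstep : ∀ k, stepSign col S bd x P.perm ((P.perm ^ k) w) =
        edgeSign x ((P.perm ^ k) w) ((P.perm ^ (k + 1)) w) := by
      intro k
      rw [stepSign, if_neg fun h => hnS' k h.1, hnext]
    rcases Nat.lt_or_ge (l c).length 3 with hL | hL
    -- A doubled edge is run through twice; its sign is squared and `m + 1 = 2`.
    · have hL' : (l c).length = 2 := by omega
      have hm' : m = 1 := by omega
      rw [hL', Finset.prod_range_succ, Finset.prod_range_one, hstep, hstep, hm']
      rw [hL'] at hloop
      rw [show 1 + 1 = 2 from rfl, hloop, edgeSign_comm, pow_zero, Equiv.Perm.one_apply]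
      simp [Int.units_mul_self]
    · obtain ⟨ε, hε⟩ := exists_edges_of_adj (G := G) (L := (l c).length) (by omega)
        (fun k => (P.perm ^ k) w) (fun k _ => by
          rw [hnext]
          exact adj_of_mem_configs hω (hτ.adj _ fun h => hnS' k h.1))
      obtain ⟨U, hU1, hU2, hU3⟩ := M.exists_loop_interior hG hL (fun k => (P.perm ^ k) w) hinj
        (by simpa using hloop) ε hε
      have := hU3 x hx m hm
      rw [pow_add _ (m + 1), hUeven U hU1 hU2, mul_one] at this
      rw [← this]
      refine Finset.prod_congr rfl fun k hk => ?_
      rw [hstep, edgeSign_eq x (ε k) (hε k (Finset.mem_range.1 hk))]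
  · set z := (l c)[(l c).length - 1]'(by omega) with hz
    have hzp : (P.perm ^ ((l c).length - 1)) w = z := hpow _ (by omega)
    have hτz : P.perm z = w := P.perm_getElem_last c (by omega)
    have hne : w ≠ z := by
      intro h
      rw [← h, h1] at h2
      cases h2
    have hstep : ∀ k, k + 1 < (l c).length → stepSign col S bd x P.perm ((P.perm ^ k) w) =
        edgeSign x ((P.perm ^ k) w) ((P.perm ^ (k + 1)) w) := by
      intro k hk
      rw [stepSign, if_neg, hnext]
      rintro ⟨ha, hb⟩
      rcases h5 _ ((P.mem_iff _ _).2 (hmem k)) ha with h | h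
      · rw [h, h1] at hb; cases hb
      · have := hinj k (by omega) ((l c).length - 1) (by omega) (h.trans hzp.symm)
        omega
    have hlast : stepSign col S bd x P.perm ((P.perm ^ ((l c).length - 1)) w) =
        chordSign bd z w := by
      rw [hzp, stepSign, if_pos ⟨h4, h2⟩, hτz]
    obtain ⟨ε, hε⟩ := exists_edges_of_adj (G := G) (L := (l c).length - 1) (by omega)
      (fun k => (P.perm ^ k) w) (fun k hk => by
        rw [hpow k (by omega), hpow (k + 1) (by omega)]
        exact adj_of_mem_configs hω (hlc.adj k (by omega)))
    have hpr : ∏ k ∈ Finset.range (l c).length, stepSign col S bd x P.perm ((P.perm ^ k) w) =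
        chordSign bd z w * ∏ k ∈ Finset.range ((l c).length - 1), x (ε k) := by
      conv_lhs => rw [show (l c).length = (l c).length - 1 + 1 by omega, Finset.prod_range_succ]
      rw [hlast, mul_comm]
      congr 1
      refine Finset.prod_congr rfl fun k hk => ?_
      rw [Finset.mem_range] at hk
      rw [hstep k (by omega), edgeSign_eq x (ε k) (hε k hk)]
    obtain ⟨i, hi⟩ := hS w h3
    obtain ⟨j, hj⟩ := hS z h4
    -- The chord has to carry the colour sign of the end that comes first along the path. This is
    -- `-1` precisely when the black end comes first, as in `chordSign`.
    have key : ∀ i j : Fin n, i < j → s(z, w) = s(bd i, bd j) → col (bd i) ≠ col (bd j) →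
        chordSign bd z w = colourSign (col (bd i)) →
        ∏ k ∈ Finset.range (l c).length, stepSign col S bd x P.perm ((P.perm ^ k) w) =
          (-1) ^ (m + 1) := by
      intro i j hij hs hcol hch
      obtain ⟨U, hU1, hU2, _, _, hU3⟩ := hbd.exists_interior hG hij hL2 (fun k => (P.perm ^ k) w)
        hinj (by simpa only [hzp, pow_zero, Equiv.Perm.one_apply] using hs) ε
        (fun k hk => hε k (by omega))
      have := hU3 col x hx hcol halt m hm
      rw [pow_add _ (m + 1), hUeven U hU1 hU2, mul_one] at this
      rw [hpr, hch, this]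
    have hij : i ≠ j := by rintro rfl; exact hne (hi.symm.trans hj)
    rcases lt_or_gt_of_ne hij with hij | hij
    · refine key i j hij (by rw [hi, hj, Sym2.eq_swap]) (by rw [hi, hj, h1, h2]; decide) ?_
      rw [hi, h1, chordSign, if_neg]
      · rfl
      · rintro ⟨a, b, hab, ha, hb⟩
        rw [← hj] at ha
        rw [← hi] at hb
        rw [hbd.1 ha, hbd.1 hb] at hab
        exact lt_asymm hab hij
    · refine key j i hij (by rw [hi, hj]) (by rw [hi, hj, h1, h2]; decide) ?_
      rw [hj, h2, chordSign, if_pos ⟨j, i, hij, hj, hi⟩]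
      rfl

/-- The square of the circulation, on the white vertices. -/
def whiteSquare (col : G.Coloring Colour) (τ : Equiv.Perm V) (h : ∀ v, col (τ v) ≠ col v) :
    Equiv.Perm {v // col v = Colour.white} :=
  (τ ^ 2).subtypePerm fun v => by
    have : col ((τ ^ 2) v) = col v := Colour.eq_of_ne_of_ne (h _) (h _)
    rw [this]

lemma whiteSquare_pow (col : G.Coloring Colour) (τ : Equiv.Perm V) (h : ∀ v, col (τ v) ≠ col v)
    (k : ℕ) (v : {v // col v = Colour.white}) :
    ((whiteSquare col τ h ^ k) v : V) = (τ ^ (2 * k)) v := by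
  rw [whiteSquare, Equiv.Perm.subtypePerm_pow, Equiv.Perm.subtypePerm_apply, pow_mul]

lemma prod_white_mul {R : Type*} [CommMonoid R] {col : G.Coloring Colour} {τ : Equiv.Perm V}
    (h : ∀ v, col (τ v) ≠ col v) (f : V → R) :
    ∏ v : {v // col v = Colour.white}, f v * f (τ v) = ∏ v, f v := by
  rw [Finset.prod_mul_distrib, ← Fintype.prod_subtype_mul_prod_subtype (fun v => col v = Colour.white)]
  congr 1
  refine Fintype.prod_bijective (fun v : {v // col v = Colour.white} =>
    (⟨τ v, fun hv => h v (hv.trans v.2.symm)⟩ : {v // ¬ col v = Colour.white})) ⟨?_, ?_⟩ _ _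
    (fun _ => rfl)
  · intro a b hab
    exact Subtype.ext (τ.injective (congrArg Subtype.val hab))
  · intro b
    refine ⟨⟨τ.symm b, ?_⟩, Subtype.ext (τ.apply_symm_apply _)⟩
    have := h (τ.symm b)
    rw [τ.apply_symm_apply] at this
    by_contra hne
    exact b.2 (by
      rw [Colour.eq_black_of_ne_white b.2, Colour.eq_black_of_ne_white hne] at this
      exact absurd rfl this)

/-- In a component of length `2 * m` the square of the circulation has one orbit of `m` white
vertices, of sign `(-1) ^ (m + 1)`, which is also the product of the step signs along the component.
-/
theorem sign_whiteSquare {M : PlaneEmbedding G} (hG : G.Connected) {n : ℕ} {bd : Fin n → V}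
    (hbd : IsBoundaryPath M bd) (hS : ∀ v ∈ S, ∃ i, bd i = v) {x : G.edgeSet → ℤˣ}
    (hx : M.IsSignPhase x)
    (halt : ∀ k l : Fin n, (l : ℕ) = k + 1 → ∀ e : G.edgeSet, e.1 = s(bd k, bd l) →
      x e = colourSign (col (bd k))) (hω : ω ∈ configs G S)
    (hl : ∀ c, IsComponentList col S ω c (l c))
    (P : IsCyclePartition (SimpleGraph.fromEdgeSet ω).connectedComponentMk l) :
    Equiv.Perm.sign (whiteSquare col P.perm (isCirculation hω hl P).col_ne) =
      ∏ v, stepSign col S bd x P.perm v := by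
  have hτ := isCirculation hω hl P
  rw [← prod_white_mul hτ.col_ne]
  refine sign_eq_prod_of_orbits _ (fun v : {v // col v = Colour.white} =>
    stepSign col S bd x P.perm v * stepSign col S bd x P.perm (P.perm v)) fun v => ?_
  obtain ⟨m, hm⟩ := even_length hω hl P v.1
  have hm' : (l ((SimpleGraph.fromEdgeSet ω).connectedComponentMk v.1)).length = 2 * m := by omega
  have hmpos : 0 < m := by have := (hl ((SimpleGraph.fromEdgeSet ω).connectedComponentMk v.1)).two_le; omega
  set σ := whiteSquare col P.perm hτ.col_ne with hσ
  have hper : ∀ q : ℕ, (P.perm ^ (2 * m * q)) v.1 = v.1 := by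
    intro q
    rw [pow_mul]
    refine Equiv.Perm.pow_apply_eq_self_of_apply_eq_self ?_ q
    have := P.perm_pow_length v.1
    rwa [hm'] at this
  have hinj : Set.InjOn (fun j => (σ ^ j) v) (Finset.range m : Set ℕ) := by
    intro i hi j hj h
    rw [Finset.mem_coe, Finset.mem_range] at hi hj
    have h' := congrArg Subtype.val h
    simp only [hσ, whiteSquare_pow] at h'
    have := P.perm_pow_injOn v.1 (by omega) (by omega) h'
    omega
  have horb : Finset.univ.filter (fun y => σ.SameCycle v y) =
      (Finset.range m).image fun j => (σ ^ j) v := by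
    ext y
    simp only [Finset.mem_filter, Finset.mem_univ, true_and, Finset.mem_image, Finset.mem_range]
    constructor
    · intro h
      obtain ⟨k, hk⟩ := h.exists_nat_pow_eq
      refine ⟨k % m, Nat.mod_lt _ hmpos, ?_⟩
      rw [← hk]
      apply Subtype.ext
      rw [hσ, whiteSquare_pow, whiteSquare_pow]
      conv_rhs => rw [← Nat.mod_add_div k m, mul_add, ← mul_assoc, pow_add, Equiv.Perm.mul_apply,
        hper]
    · rintro ⟨j, _, rfl⟩
      exact ⟨j, by simp⟩
  rw [horb, Finset.card_image_of_injOn hinj, Finset.prod_image hinj, Finset.card_range,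
    ← prod_stepSign hG hbd hS hx halt hω hl P v.1 hm', ← P.prod_pow, hm']
  simp only [hσ, whiteSquare_pow]
  clear * -
  induction m with
  | zero => simp
  | succ m ih =>
    rw [Finset.prod_range_succ, ih, show 2 * (m + 1) = 2 * m + 1 + 1 by ring,
      Finset.prod_range_succ, Finset.prod_range_succ, mul_assoc, pow_succ', Equiv.Perm.mul_apply]

end

end Phases

/-! ### The pairings over a configuration, and their signs -/

section LabelPairings
set_option linter.unusedSectionVars false

open scoped Classical

variable {V : Type*} [Fintype V] {G : SimpleGraph V} {S : Finset V}

/-- The neighbour of `v` on the edges that the circulation runs through from white to black. -/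
def forwardMate (col : G.Coloring Colour) (τ : Equiv.Perm V) (v : V) : V :=
  if col v = Colour.white then τ v else τ.symm v

/-- The other neighbour of `v` along the circulation. -/
def backwardMate (col : G.Coloring Colour) (τ : Equiv.Perm V) (v : V) : V :=
  if col v = Colour.white then τ.symm v else τ v

lemma Colour.eq_white_of_ne_of_ne_white {a b : Colour} (h : a ≠ b) (hb : b ≠ Colour.white) :
    a = Colour.white := by
  cases a <;> cases b <;> simp_all

namespace IsCirculation

variable {col : G.Coloring Colour} {H : SimpleGraph V} {τ : Equiv.Perm V}

lemma col_symm_ne (hτ : IsCirculation col S H τ) (v : V) : col (τ.symm v) ≠ col v := by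
  have := hτ.col_ne (τ.symm v)
  rw [τ.apply_symm_apply] at this
  exact this.symm

lemma col_forward (hτ : IsCirculation col S H τ) (v : V) : col (forwardMate col τ v) ≠ col v := by
  unfold forwardMate
  split_ifs
  · exact hτ.col_ne v
  · exact hτ.col_symm_ne v

lemma col_backward (hτ : IsCirculation col S H τ) (v : V) : col (backwardMate col τ v) ≠ col v := by
  unfold backwardMate
  split_ifs
  · exact hτ.col_symm_ne v
  · exact hτ.col_ne v

lemma forward_forward (hτ : IsCirculation col S H τ) (v : V) :
    forwardMate col τ (forwardMate col τ v) = v := by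
  by_cases h : col v = Colour.white
  · have h1 : forwardMate col τ v = τ v := if_pos h
    rw [h1, forwardMate, if_neg fun h' => hτ.col_ne v (h'.trans h.symm), τ.symm_apply_apply]
  · have h1 : forwardMate col τ v = τ.symm v := if_neg h
    rw [h1, forwardMate, if_pos (Colour.eq_white_of_ne_of_ne_white (hτ.col_symm_ne v) h),
      τ.apply_symm_apply]

lemma backward_backward (hτ : IsCirculation col S H τ) (v : V) :
    backwardMate col τ (backwardMate col τ v) = v := by
  by_cases h : col v = Colour.white
  · have h1 : backwardMate col τ v = τ.symm v := if_pos h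
    rw [h1, backwardMate, if_neg fun h' => hτ.col_symm_ne v (h'.trans h.symm), τ.apply_symm_apply]
  · have h1 : backwardMate col τ v = τ v := if_neg h
    rw [h1, backwardMate, if_pos (Colour.eq_white_of_ne_of_ne_white (hτ.col_ne v) h),
      τ.symm_apply_apply]

lemma adj_forward (hτ : IsCirculation col S H τ) (v : V) : H.Adj v (forwardMate col τ v) := by
  unfold forwardMate
  split_ifs with h
  · exact hτ.adj v fun h' => by rw [h] at h'; cases h'.2
  · have h1 := hτ.adj (τ.symm v) fun h' => by
      rw [Colour.eq_white_of_ne_of_ne_white (hτ.col_symm_ne v) h] at h'; cases h'.2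
    rw [τ.apply_symm_apply] at h1
    exact h1.symm

lemma backward_mem (hτ : IsCirculation col S H τ) {v : V} (hv : v ∈ S) :
    backwardMate col τ v ∈ S := by
  unfold backwardMate
  split_ifs with h
  · exact hτ.white_mem _ (by rwa [τ.apply_symm_apply]) (by rwa [τ.apply_symm_apply])
  · exact hτ.black_mem v hv (Colour.eq_black_of_ne_white h)

lemma backward_mem_iff (hτ : IsCirculation col S H τ) {v : V} :
    backwardMate col τ v ∈ S ↔ v ∈ S :=
  ⟨fun h => by have := hτ.backward_mem h; rwa [hτ.backward_backward] at this, hτ.backward_mem⟩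

lemma adj_backward (hτ : IsCirculation col S H τ) {v : V} (hv : v ∉ S) :
    H.Adj v (backwardMate col τ v) := by
  have hv' := fun h => hv (hτ.backward_mem_iff.1 h)
  unfold backwardMate at hv' ⊢
  split_ifs with h
  · rw [if_pos h] at hv'
    have h1 := hτ.adj (τ.symm v) fun h' => hv' h'.1
    rw [τ.apply_symm_apply] at h1
    exact h1.symm
  · exact hτ.adj v fun h' => hv h'.1

lemma reachable_backward (hτ : IsCirculation col S H τ) (v : V) :
    H.Reachable v (backwardMate col τ v) := by
  unfold backwardMate
  split_ifs with h
  · have := hτ.reachable (τ.symm v)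
    rw [τ.apply_symm_apply] at this
    exact this.symm
  · exact hτ.reachable v

lemma eq_forward_or_backward (hτ : IsCirculation col S H τ) {v w : V} (h : H.Adj v w) :
    w = forwardMate col τ v ∨ w = backwardMate col τ v := by
  have := hτ.neighbor v w h
  unfold forwardMate backwardMate
  split_ifs
  · exact this
  · exact this.symm

end IsCirculation

namespace DoubledVertex

lemma proj_lift (v : V) (k : Fin 2) : (lift S v k).proj = v := by
  unfold lift
  split_ifs <;> rfl

lemma exists_lift (x : DoubledVertex S) : ∃ k, x = lift S x.proj k := by
  cases x with
  | boundary v hv => exact ⟨0, (lift_boundary hv 0).symm⟩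
  | bulk v hv k => exact ⟨k, (lift_bulk hv k).symm⟩

lemma prod_eq {R : Type*} [CommMonoid R] (f : DoubledVertex S → R) :
    ∏ x, f x = ∏ v, if v ∈ S then f (lift S v 0) else f (lift S v 0) * f (lift S v 1) := by
  rw [← Finset.prod_fiberwise_of_maps_to (t := Finset.univ) (g := proj) (fun _ _ => Finset.mem_univ _)]
  refine Finset.prod_congr rfl fun v _ => ?_
  split_ifs with hv
  · have : (Finset.univ.filter fun x : DoubledVertex S => x.proj = v) = {boundary v hv} := by
      ext x
      simp only [Finset.mem_filter, Finset.mem_univ, true_and, Finset.mem_singleton]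
      exact ⟨fun h => eq_boundary hv h, fun h => by rw [h]; rfl⟩
    rw [this, Finset.prod_singleton, lift_boundary hv]
  · have : (Finset.univ.filter fun x : DoubledVertex S => x.proj = v) =
        {bulk v hv 0, bulk v hv 1} := by
      ext x
      simp only [Finset.mem_filter, Finset.mem_univ, true_and, Finset.mem_insert,
        Finset.mem_singleton]
      constructor
      · intro h
        obtain ⟨k, rfl⟩ := eq_bulk hv h
        fin_cases k
        · exact Or.inl rfl
        · exact Or.inr rfl
      · rintro (rfl | rfl) <;> rfl
    rw [this, Finset.prod_pair (by simp), lift_bulk hv, lift_bulk hv]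

end DoubledVertex

/-- A white vertex of the folded graph. -/
def IsWhite (col : G.Coloring Colour) (x : DoubledVertex S) : Prop :=
  col x.proj = Colour.white

/-- The pairing with labels `i`: the copy `i v` of `v` is paired forwards, and the other copy, for
`v` in the bulk, backwards. -/
def labelFun (col : G.Coloring Colour) (τ : Equiv.Perm V) (i : V → Fin 2) :
    DoubledVertex S → DoubledVertex S
  | .boundary v _ => .lift S (forwardMate col τ v) (i (forwardMate col τ v))
  | .bulk v _ k => if k = i v then .lift S (forwardMate col τ v) (i (forwardMate col τ v))
      else .lift S (backwardMate col τ v) (i (backwardMate col τ v) + 1)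

lemma Fin.two_eq_or (k a : Fin 2) : k = a ∨ k = a + 1 := by
  revert k a; decide

lemma Fin.two_add_one_ne (a : Fin 2) : a + 1 ≠ a := by
  revert a; decide

section

variable {col : G.Coloring Colour} {H : SimpleGraph V} {τ : Equiv.Perm V}

lemma labelFun_forward (i : V → Fin 2) (v : V) :
    labelFun col τ i (.lift S v (i v)) =
      .lift S (forwardMate col τ v) (i (forwardMate col τ v)) := by
  by_cases hv : v ∈ S
  · rw [DoubledVertex.lift_boundary hv]; rfl
  · rw [DoubledVertex.lift_bulk hv, labelFun, if_pos rfl]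

lemma labelFun_backward (i : V → Fin 2) {v : V} (hv : v ∉ S) :
    labelFun col τ i (.lift S v (i v + 1)) =
      .lift S (backwardMate col τ v) (i (backwardMate col τ v) + 1) := by
  rw [DoubledVertex.lift_bulk hv, labelFun, if_neg (Fin.two_add_one_ne _)]

/-- A vertex of the folded graph is paired forwards or, in the bulk, backwards. -/
lemma DoubledVertex.eq_lift (i : V → Fin 2) (x : DoubledVertex S) :
    x = lift S x.proj (i x.proj) ∨ (x.proj ∉ S ∧ x = lift S x.proj (i x.proj + 1)) := by
  cases x with
  | boundary v hv => exact Or.inl (lift_boundary hv _).symm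
  | bulk v hv k =>
    rcases Fin.two_eq_or k (i v) with rfl | rfl
    · exact Or.inl (lift_bulk hv _).symm
    · exact Or.inr ⟨hv, (lift_bulk hv _).symm⟩

lemma labelFun_labelFun (hτ : IsCirculation col S H τ) (i : V → Fin 2) (x : DoubledVertex S) :
    labelFun col τ i (labelFun col τ i x) = x := by
  rcases x.eq_lift i with h | ⟨hv, h⟩
  · rw [h, labelFun_forward, labelFun_forward, hτ.forward_forward]
  · rw [h, labelFun_backward i hv, labelFun_backward i (fun h => hv (hτ.backward_mem_iff.1 h)),
      hτ.backward_backward]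

/-- The pairing with labels `i`. -/
def labelPairing (hτ : IsCirculation col S H τ) (i : V → Fin 2) : Equiv.Perm (DoubledVertex S) :=
  ⟨labelFun col τ i, labelFun col τ i, labelFun_labelFun hτ i, labelFun_labelFun hτ i⟩

lemma adj_labelPairing (hτ : IsCirculation col S H τ) (i : V → Fin 2) (x : DoubledVertex S) :
    H.Adj x.proj (labelPairing hτ i x).proj := by
  change H.Adj x.proj (labelFun col τ i x).proj
  rcases x.eq_lift i with h | ⟨hv, h⟩
  · rw [h, labelFun_forward, DoubledVertex.proj_lift, DoubledVertex.proj_lift]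
    exact hτ.adj_forward _
  · rw [h, labelFun_backward i hv, DoubledVertex.proj_lift, DoubledVertex.proj_lift]
    exact hτ.adj_backward hv

lemma isBicoloured_of_adj (hHG : H ≤ G) {π : Equiv.Perm (DoubledVertex S)}
    (h : ∀ x, π (π x) = x) (hadj : ∀ x, H.Adj x.proj (π x).proj) :
    IsBicoloured (IsWhite col) π := by
  refine ⟨fun x => ⟨h x, fun hx => ?_⟩, fun x => ?_⟩
  · have := hadj x
    rw [hx] at this
    exact this.ne rfl
  · have := col.valid (hHG (hadj x))
    unfold IsWhite
    constructor
    · intro h1 h2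
      exact this (h2.trans h1.symm)
    · intro h1
      exact Colour.eq_white_of_ne_of_ne_white this.symm h1

lemma isBicoloured_labelPairing (hτ : IsCirculation col S H τ) (hHG : H ≤ G) (i : V → Fin 2) :
    IsBicoloured (IsWhite col) (labelPairing hτ i) :=
  isBicoloured_of_adj hHG (labelFun_labelFun hτ i) (adj_labelPairing hτ i)

/-- Two points of the same colour exchange their partners, so on `W` the pairing is composed with
one transposition, of these points or of their partners. -/
lemma bicolouredSign_swap {α : Type*} [Fintype α] [LinearOrder α] {W : α → Prop}
    {π π' : Equiv.Perm α} (hπ : IsBicoloured W π) (hπ' : IsBicoloured W π') {x y : α} (hxy : x ≠ y)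
    (hW : W x ↔ W y) (h : ∀ z, π' z = Equiv.swap x y (π (Equiv.swap x y z))) :
    bicolouredSign W π' = -bicolouredSign W π := by
  by_cases hx : W x
  · have hy := hW.1 hx
    rw [bicolouredSign_comp hπ hπ' (Equiv.swap ⟨x, hx⟩ ⟨y, hy⟩), Equiv.Perm.sign_swap (by simpa using hxy)]
    · simp
    · intro w
      have h1 : ((Equiv.swap (⟨x, hx⟩ : {x // W x}) ⟨y, hy⟩) w).1 = Equiv.swap x y w.1 := by
        rw [Equiv.swap_apply_def, Equiv.swap_apply_def]
        simp only [Subtype.ext_iff]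
        split_ifs <;> rfl
      rw [h1, h, Equiv.swap_apply_of_ne_of_ne (a := x) (b := y) (x := π (Equiv.swap x y w.1))]
      · intro h2
        have h3 := hπ.2 (Equiv.swap x y w.1)
        rw [h2] at h3
        apply h3.1 hx
        rw [← h1]
        exact Subtype.property _
      · intro h2
        have h3 := hπ.2 (Equiv.swap x y w.1)
        rw [h2] at h3
        apply h3.1 hy
        rw [← h1]
        exact Subtype.property _
  · have hy := fun h => hx (hW.2 h)
    have hx' : W (π x) := (hπ.2 x).2 hx
    have hy' : W (π y) := (hπ.2 y).2 hy
    rw [bicolouredSign_comp hπ hπ' (Equiv.swap ⟨π x, hx'⟩ ⟨π y, hy'⟩),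
      Equiv.Perm.sign_swap (by simpa using hxy)]
    · simp
    · intro w
      have h1 : ((Equiv.swap (⟨π x, hx'⟩ : {x // W x}) ⟨π y, hy'⟩) w).1 =
          Equiv.swap (π x) (π y) w.1 := by
        rw [Equiv.swap_apply_def, Equiv.swap_apply_def]
        simp only [Subtype.ext_iff]
        split_ifs <;> rfl
      have h2 : Equiv.swap x y w.1 = w.1 :=
        Equiv.swap_apply_of_ne_of_ne (fun h => hx (h ▸ w.2)) (fun h => hy (h ▸ w.2))
      rw [h1, h, h2, Equiv.swap_apply_def, Equiv.swap_apply_def]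
      by_cases e1 : w.1 = π x
      · rw [if_pos e1, e1, (hπ.1 x).1, (hπ.1 y).1, if_pos rfl]
      · rw [if_neg e1]
        have e1' : ¬ π w.1 = x := fun h => e1 (by rw [← h, (hπ.1 _).1])
        rw [if_neg e1']
        by_cases e2 : w.1 = π y
        · rw [if_pos e2, e2, (hπ.1 x).1, (hπ.1 y).1, if_pos rfl]
        · have e2' : ¬ π w.1 = y := fun h => e2 (by rw [← h, (hπ.1 _).1])
          rw [if_neg e2, if_neg e2']

variable [LinearOrder (DoubledVertex S)]

/-- Changing the label at `v` amounts to exchanging its two copies. -/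
lemma bicolouredSign_labelPairing_update (hτ : IsCirculation col S H τ) (hHG : H ≤ G)
    {i j : V → Fin 2} {v : V} (hv : v ∉ S) (hj : j v = i v + 1) (hij : ∀ u, u ≠ v → j u = i u) :
    bicolouredSign (IsWhite col) (labelPairing hτ j) =
      -bicolouredSign (IsWhite col) (labelPairing hτ i) := by
  have hiv : i v = j v + 1 := by rw [hj]; generalize i v = a; revert a; decide
  have key : ∀ u, Equiv.swap (DoubledVertex.bulk v hv 0) (.bulk v hv 1) (.lift S u (j u)) =
      .lift S u (i u) := by
    intro u
    by_cases hu : u = v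
    · subst hu
      rw [DoubledVertex.lift_bulk hv, DoubledVertex.lift_bulk hv, hiv]
      rcases Fin.two_eq_or (j u) 0 with h | h <;> rw [h] <;> simp
    · rw [Equiv.swap_apply_of_ne_of_ne, hij u hu]
      · intro h
        have := congrArg DoubledVertex.proj h
        rw [DoubledVertex.proj_lift] at this
        exact hu this
      · intro h
        have := congrArg DoubledVertex.proj h
        rw [DoubledVertex.proj_lift] at this
        exact hu this
  have key' : ∀ u, Equiv.swap (DoubledVertex.bulk v hv 0) (.bulk v hv 1) (.lift S u (j u + 1)) =
      .lift S u (i u + 1) := by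
    intro u
    by_cases hu : u = v
    · subst hu
      rw [DoubledVertex.lift_bulk hv, DoubledVertex.lift_bulk hv, hiv]
      rcases Fin.two_eq_or (j u) 0 with h | h <;> rw [h] <;> simp
    · rw [Equiv.swap_apply_of_ne_of_ne, hij u hu]
      · intro h
        have := congrArg DoubledVertex.proj h
        rw [DoubledVertex.proj_lift] at this
        exact hu this
      · intro h
        have := congrArg DoubledVertex.proj h
        rw [DoubledVertex.proj_lift] at this
        exact hu this
  refine bicolouredSign_swap (isBicoloured_labelPairing hτ hHG i)
    (isBicoloured_labelPairing hτ hHG j) (x := .bulk v hv 0) (y := .bulk v hv 1) (by simp) Iff.rfl ?_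
  intro z
  change labelFun col τ j z = Equiv.swap _ _ (labelFun col τ i (Equiv.swap _ _ z))
  rcases z.eq_lift j with h | ⟨hz, h⟩
  · rw [h, key, labelFun_forward, labelFun_forward, ← key, Equiv.swap_apply_self]
  · rw [h, key', labelFun_backward _ hz, labelFun_backward _ hz, ← key', Equiv.swap_apply_self]

lemma bicolouredSign_labelPairing_eq (hτ : IsCirculation col S H τ) (hHG : H ≤ G)
    (i : V → Fin 2) (hi : ∀ v ∈ S, i v = 0) :
    bicolouredSign (IsWhite col) (labelPairing hτ i) =
      (∏ v, (-1) ^ (i v : ℕ)) * bicolouredSign (IsWhite col) (labelPairing hτ fun _ => 0) := by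
  have key : ∀ T : Finset V, (∀ v ∈ T, v ∉ S) →
      bicolouredSign (IsWhite col) (labelPairing hτ fun v => if v ∈ T then 1 else 0) =
        (-1) ^ T.card * bicolouredSign (IsWhite col) (labelPairing hτ fun _ => 0) := by
    intro T
    induction T using Finset.induction_on with
    | empty => simp
    | insert v T hv ih =>
      intro hT
      rw [bicolouredSign_labelPairing_update hτ hHG (i := fun v => if v ∈ T then 1 else 0)
        (hT v (Finset.mem_insert_self _ _)), ih fun u hu => hT u (Finset.mem_insert_of_mem hu),
        Finset.card_insert_of_notMem hv, pow_succ]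
      · ring
      · simp [hv]
      · intro u hu
        simp [hu]
  have h := key (Finset.univ.filter fun v => i v = 1) fun v hv hvS => by
    have := (Finset.mem_filter.1 hv).2
    rw [hi v hvS] at this
    exact absurd this (by decide)
  have hi' : (fun v => if v ∈ Finset.univ.filter (fun v => i v = 1) then (1 : Fin 2) else 0) = i := by
    funext v
    simp only [Finset.mem_filter, Finset.mem_univ, true_and]
    split_ifs with h
    · exact h.symm
    · generalize i v = a at *
      revert a; decide
  rw [hi'] at h
  rw [h]
  congr 1
  rw [Finset.card_filter, ← Finset.prod_pow_eq_pow_sum]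
  refine Finset.prod_congr rfl fun v _ => ?_
  generalize i v = a
  revert a; decide

/-- The pairing of the equal copies of backward mates. -/
def backwardFun (col : G.Coloring Colour) (τ : Equiv.Perm V) :
    DoubledVertex S → DoubledVertex S
  | .boundary v _ => .lift S (backwardMate col τ v) 0
  | .bulk v _ k => .lift S (backwardMate col τ v) k

lemma backwardFun_lift (v : V) (k : Fin 2) :
    backwardFun col τ (.lift S v k) = .lift S (backwardMate col τ v)
      (if v ∈ S then 0 else k) := by
  by_cases hv : v ∈ S
  · rw [DoubledVertex.lift_boundary hv, if_pos hv]; rfl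
  · rw [DoubledVertex.lift_bulk hv, if_neg hv]; rfl

lemma DoubledVertex.lift_ite (v : V) (k : Fin 2) : lift S v (if v ∈ S then 0 else k) = lift S v k := by
  by_cases hv : v ∈ S
  · rw [lift_boundary hv, lift_boundary hv]
  · rw [if_neg hv]

lemma backwardFun_lift' (hτ : IsCirculation col S H τ) (v : V) (k : Fin 2) :
    backwardFun col τ (.lift S v k) = .lift S (backwardMate col τ v) k := by
  rw [backwardFun_lift, ← DoubledVertex.lift_ite (backwardMate col τ v) k]
  simp only [hτ.backward_mem_iff]

lemma backwardFun_backwardFun (hτ : IsCirculation col S H τ) (x : DoubledVertex S) :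
    backwardFun col τ (backwardFun col τ x) = x := by
  obtain ⟨k, hk⟩ := x.exists_lift
  rw [hk, backwardFun_lift' hτ, backwardFun_lift' hτ, hτ.backward_backward]

/-- The pairing of the equal copies of backward mates. -/
def backwardPairing (hτ : IsCirculation col S H τ) : Equiv.Perm (DoubledVertex S) :=
  ⟨backwardFun col τ, backwardFun col τ, backwardFun_backwardFun hτ, backwardFun_backwardFun hτ⟩

lemma backwardPairing_lift (hτ : IsCirculation col S H τ) (v : V) (k : Fin 2) :
    backwardPairing hτ (.lift S v k) = .lift S (backwardMate col τ v) k := backwardFun_lift' hτ v k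

lemma isBicoloured_backwardPairing (hτ : IsCirculation col S H τ) :
    IsBicoloured (IsWhite col) (backwardPairing hτ) := by
  have h : ∀ x : DoubledVertex S, col (backwardPairing hτ x).proj ≠ col x.proj := by
    intro x
    obtain ⟨k, hk⟩ := x.exists_lift
    rw [hk, backwardPairing_lift, DoubledVertex.proj_lift, DoubledVertex.proj_lift]
    exact hτ.col_backward _
  refine ⟨fun x => ⟨backwardFun_backwardFun hτ x, fun hx => h x (by rw [hx])⟩, fun x => ?_⟩
  unfold IsWhite
  constructor
  · intro h1 h2
    exact h x (h1.trans h2.symm)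
  · intro h1
    exact Colour.eq_white_of_ne_of_ne_white (h x) h1

/-- The white vertices of the graph, as first copies. -/
def firstCopy (col : G.Coloring Colour) (S : Finset V) :
    {v // col v = Colour.white} ↪ {x : DoubledVertex S // IsWhite col x} where
  toFun v := ⟨.lift S v 0, by rw [IsWhite, DoubledVertex.proj_lift]; exact v.2⟩
  inj' u v h := by
    have := congrArg (fun x => x.1.proj) h
    simp only [DoubledVertex.proj_lift] at this
    exact Subtype.ext this

/-- The two pairings agree except on the first copies of the white vertices. There the one sends `v`
to `τ v`, the other to `τ⁻¹ v`; since `τ⁻¹ (τ² v) = τ v`, they differ by `τ²`. -/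
lemma bicolouredSign_labelPairing_zero (hτ : IsCirculation col S H τ) (hHG : H ≤ G) :
    bicolouredSign (IsWhite col) (labelPairing hτ fun _ => 0) =
      (Equiv.Perm.sign (whiteSquare col τ hτ.col_ne) : ℤ) *
        bicolouredSign (IsWhite col) (backwardPairing hτ) := by
  have hsign : Equiv.Perm.sign ((whiteSquare col τ hτ.col_ne).viaEmbedding (firstCopy col S)) =
      Equiv.Perm.sign (whiteSquare col τ hτ.col_ne) := by
    convert Equiv.Perm.sign_extendDomain (whiteSquare col τ hτ.col_ne)
      (Equiv.ofInjective (firstCopy col S) (firstCopy col S).2)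
    unfold Equiv.Perm.viaEmbedding
    congr!
  rw [← hsign]
  refine bicolouredSign_comp (isBicoloured_backwardPairing hτ) (isBicoloured_labelPairing hτ hHG _)
    ((whiteSquare col τ hτ.col_ne).viaEmbedding (firstCopy col S)) ?_
  intro w
  by_cases hw : w ∈ Set.range (firstCopy col S)
  · obtain ⟨v, rfl⟩ := hw
    rw [Equiv.Perm.viaEmbedding_apply]
    change backwardPairing hτ (.lift S _ 0) = labelFun col τ (fun _ => 0) (.lift S v 0)
    rw [backwardPairing_lift, labelFun_forward (fun _ => 0), forwardMate, if_pos v.2, backwardMate,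
      if_pos (whiteSquare col τ hτ.col_ne v).2]
    change DoubledVertex.lift S (τ.symm ((τ ^ 2) v)) 0 = _
    rw [pow_two, Equiv.Perm.mul_apply, τ.symm_apply_apply]
  · rw [Equiv.Perm.viaEmbedding_apply_of_notMem _ _ _ hw]
    change backwardPairing hτ w.1 = labelFun col τ (fun _ => 0) w.1
    rcases DoubledVertex.eq_lift (fun _ => 0) w.1 with h | ⟨hv, h⟩
    · exact absurd ⟨⟨w.1.proj, w.2⟩, Subtype.ext h.symm⟩ hw
    · rw [h, backwardPairing_lift, labelFun_backward (fun _ => 0) hv]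

end

end LabelPairings

/-! ### The sign of the pairing of equal copies -/

section ReferenceSign
set_option linter.unusedSectionVars false

open scoped Classical

variable {V : Type*} [Fintype V] {G : SimpleGraph V} {S : Finset V}
  {col : G.Coloring Colour} {H : SimpleGraph V} {τ : Equiv.Perm V} {n : ℕ} {bd : Fin n → V}
  [LinearOrder (DoubledVertex S)]

namespace IsFoldedOrder

/-- The two copies of a vertex are neighbours in the order, so nothing separates them. -/
lemma copy_lt_iff (hord : IsFoldedOrder col S bd) {u v : V} (hu : u ∉ S) (hv : v ∉ S) (huv : u ≠ v)
    (j k j' k' : Fin 2) :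
    DoubledVertex.bulk u hu j < DoubledVertex.bulk v hv k ↔
      DoubledVertex.bulk u hu j' < DoubledVertex.bulk v hv k' := by
  have hne : ∀ a b, DoubledVertex.bulk u hu a ≠ DoubledVertex.bulk v hv b := by
    intro a b h
    exact huv (congrArg DoubledVertex.proj h)
  have h1 : ∀ b, DoubledVertex.bulk u hu 0 < DoubledVertex.bulk v hv b ↔
      DoubledVertex.bulk u hu 1 < DoubledVertex.bulk v hv b := by
    intro b
    constructor
    · intro h
      exact lt_of_le_of_ne (not_lt.1 fun h' => (hord.copies_covBy u hu).2 h h') (hne _ _)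
    · exact (hord.copies_covBy u hu).1.trans
  have h2 : ∀ a, DoubledVertex.bulk u hu a < DoubledVertex.bulk v hv 0 ↔
      DoubledVertex.bulk u hu a < DoubledVertex.bulk v hv 1 := by
    intro a
    constructor
    · exact fun h => h.trans (hord.copies_covBy v hv).1
    · intro h
      exact lt_of_le_of_ne (not_lt.1 fun h' => (hord.copies_covBy v hv).2 h' h) (hne _ _)
  have key : ∀ a b, DoubledVertex.bulk u hu a < DoubledVertex.bulk v hv b ↔
      DoubledVertex.bulk u hu 0 < DoubledVertex.bulk v hv 0 := by
    intro a b
    rcases Fin.two_eq_or a 0 with rfl | rfl <;> rcases Fin.two_eq_or b 0 with rfl | rfl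
    · rfl
    · exact (h2 0).symm
    · exact (h1 0).symm
    · exact (h1 1).symm.trans (h2 0).symm
  rw [key, key j' k']

lemma not_bulk_lt_boundary (hord : IsFoldedOrder col S bd) {u v : V} (hu : u ∉ S) (hv : v ∈ S)
    (k : Fin 2) : ¬ DoubledVertex.bulk u hu k < DoubledVertex.boundary v hv :=
  lt_asymm (hord.boundary_lt_bulk v hv u hu k)

lemma boundary_lt_iff (hord : IsFoldedOrder col S bd) {i j : Fin n} (hi : bd i ∈ S)
    (hj : bd j ∈ S) :
    DoubledVertex.boundary (bd i) hi < DoubledVertex.boundary (bd j) hj ↔ i < j := by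
  refine ⟨fun h => ?_, hord.boundary_lt_boundary i j hi hj⟩
  rcases lt_trichotomy i j with h' | rfl | h'
  · exact h'
  · exact absurd h (lt_irrefl _)
  · exact absurd h (lt_asymm (hord.boundary_lt_boundary j i hj hi h'))

end IsFoldedOrder

lemma backwardPairing_boundary (hτ : IsCirculation col S H τ) {v : V} (hv : v ∈ S) :
    backwardPairing hτ (.boundary v hv) = .boundary (backwardMate col τ v) (hτ.backward_mem hv) := by
  rw [← DoubledVertex.lift_boundary hv 0, backwardPairing_lift, DoubledVertex.lift_boundary]

lemma backwardPairing_bulk (hτ : IsCirculation col S H τ) {v : V} (hv : v ∉ S) (k : Fin 2) :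
    backwardPairing hτ (.bulk v hv k) =
      .bulk (backwardMate col τ v) (fun h => hv (hτ.backward_mem_iff.1 h)) k := by
  rw [← DoubledVertex.lift_bulk hv k, backwardPairing_lift, DoubledVertex.lift_bulk]

/-- In the pairing of equal copies, two crossing chords are in the bulk, and start at white
vertices. -/
lemma bulk_of_crossing {M : PlaneEmbedding G} (hG : G.Connected) (hbd : IsBoundaryPath M bd)
    (hS : ∀ v ∈ S, ∃ i, bd i = v) (hord : IsFoldedOrder col S bd) (hH : IsArcGraph H S)
    (hHG : H ≤ G) (hτ : IsCirculation col S H τ) {x y : DoubledVertex S} (h1 : x < y)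
    (h2 : y < backwardPairing hτ x) (h3 : backwardPairing hτ x < backwardPairing hτ y) :
    ∃ u, ∃ hu : u ∉ S, ∃ j, ∃ v, ∃ hv : v ∉ S, ∃ k, x = .bulk u hu j ∧ y = .bulk v hv k ∧
      col u = Colour.white ∧ col v = Colour.white := by
  cases x with
  | boundary u hu =>
    exfalso
    rw [backwardPairing_boundary hτ hu] at h2 h3
    cases y with
    | bulk v hv k => exact hord.not_bulk_lt_boundary _ _ _ h2
    | boundary v hv =>
      rw [backwardPairing_boundary hτ hv] at h3
      obtain ⟨i, rfl⟩ := hS u hu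
      obtain ⟨k, rfl⟩ := hS v hv
      have hju := hτ.reachable_backward (bd i)
      have hlv := hτ.reachable_backward (bd k)
      have hjS := hτ.backward_mem hu
      have hlS := hτ.backward_mem hv
      obtain ⟨j, hj⟩ := hS _ hjS
      obtain ⟨l, hl⟩ := hS _ hlS
      simp only [← hj, ← hl] at h2 h3 hju hlv
      rw [← hj] at hjS
      rw [← hl] at hlS
      have e1 := (hord.boundary_lt_iff hu hv).1 h1
      have e2 := (hord.boundary_lt_iff hv hjS).1 h2
      have e3 := (hord.boundary_lt_iff hjS hlS).1 h3
      -- The chords on the boundary join the two ends of an arc, so a crossing would be a crossing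
      -- of arcs.
      have := hH.noncrossing hHG hG hbd (e1.trans e2) hu hjS hv hju hlv e1 e2
      exact lt_asymm this.2 e3
  | bulk u hu j =>
    rw [backwardPairing_bulk hτ hu] at h2 h3
    cases y with
    | boundary v hv => exact absurd h1 (hord.not_bulk_lt_boundary _ _ _)
    | bulk v hv k =>
      rw [backwardPairing_bulk hτ hv] at h3
      have hwhite : ∀ {u : V} (hu : u ∉ S) (hu' : backwardMate col τ u ∉ S) (j : Fin 2),
          DoubledVertex.bulk u hu j < DoubledVertex.bulk (backwardMate col τ u) hu' j →
          col u = Colour.white := by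
        intro u hu hu' j h
        by_contra hw
        exact lt_asymm h (hord.white_lt_black _ _ _ _ _ _
          (Colour.eq_white_of_ne_of_ne_white (hτ.col_backward u) hw)
          (Colour.eq_black_of_ne_white hw))
      exact ⟨u, hu, j, v, hv, k, rfl, rfl, hwhite hu _ j (h1.trans h2), hwhite hv _ k (h2.trans h3)⟩

/-- The two chords over a same pair of bulk vertices cross once, because the copies appear in the
same order at both ends. Whether chords over distinct pairs cross does not depend on the copies, so
these crossings are even in number. -/
lemma neg_one_pow_crossings_backwardPairing {M : PlaneEmbedding G} (hG : G.Connected)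
    (hbd : IsBoundaryPath M bd) (hS : ∀ v ∈ S, ∃ i, bd i = v) (hord : IsFoldedOrder col S bd)
    (hH : IsArcGraph H S) (hHG : H ≤ G) (hτ : IsCirculation col S H τ) :
    (-1 : ℤ) ^ crossings (backwardPairing hτ) =
      (-1) ^ (Finset.univ.filter fun v => col v = Colour.white ∧ v ∉ S).card := by
  set C := Finset.univ.filter fun q : DoubledVertex S × DoubledVertex S =>
    q.1 < q.2 ∧ q.2 < backwardPairing hτ q.1 ∧ backwardPairing hτ q.1 < backwardPairing hτ q.2
    with hC
  have hcr : crossings (backwardPairing hτ) = C.card := rfl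
  rw [hcr, ← Finset.card_filter_add_card_filter_not (s := C) (fun q => q.1.proj = q.2.proj), pow_add]
  have hsame : (C.filter fun q => q.1.proj = q.2.proj).card =
      (Finset.univ.filter fun v => col v = Colour.white ∧ v ∉ S).card := by
    symm
    refine Finset.card_bij (fun v _ => (DoubledVertex.lift S v 0, DoubledVertex.lift S v 1)) ?_ ?_ ?_
    · intro v hv
      obtain ⟨hw, hvS⟩ := (Finset.mem_filter.1 hv).2
      have hvS' : backwardMate col τ v ∉ S := fun h => hvS (hτ.backward_mem_iff.1 h)
      have hb : col (backwardMate col τ v) = Colour.black :=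
        Colour.eq_black_of_ne_white fun h => hτ.col_backward v (h.trans hw.symm)
      refine Finset.mem_filter.2 ⟨Finset.mem_filter.2 ⟨Finset.mem_univ _, ?_⟩,
        by simp only [DoubledVertex.proj_lift]⟩
      simp only [DoubledVertex.lift_bulk hvS, backwardPairing_bulk hτ hvS]
      exact ⟨(hord.copies_covBy _ _).1, hord.white_lt_black _ _ _ _ _ _ hw hb,
        (hord.copies_covBy _ _).1⟩
    · intro u _ v _ h
      have := congrArg (fun q => q.1.proj) h
      simpa only [DoubledVertex.proj_lift] using this
    · rintro ⟨x, y⟩ hq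
      obtain ⟨hq, hp⟩ := Finset.mem_filter.1 hq
      obtain ⟨h1, h2, h3⟩ := (Finset.mem_filter.1 hq).2
      obtain ⟨u, hu, j, v, hv, k, rfl, rfl, hcu, _⟩ := bulk_of_crossing hG hbd hS hord hH hHG hτ h1 h2 h3
      obtain rfl : u = v := hp
      refine ⟨u, Finset.mem_filter.2 ⟨Finset.mem_univ _, hcu, hu⟩, ?_⟩
      have hjk : j = 0 ∧ k = 1 := by
        have h01 := (hord.copies_covBy u hu).1
        rcases Fin.two_eq_or j 0 with rfl | rfl <;> rcases Fin.two_eq_or k 0 with rfl | rfl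
        · exact absurd h1 (lt_irrefl _)
        · exact ⟨rfl, rfl⟩
        · exact absurd h1 (lt_asymm h01)
        · exact absurd h1 (lt_irrefl _)
      rw [hjk.1, hjk.2, DoubledVertex.lift_bulk hu, DoubledVertex.lift_bulk hu]
  have hdiff : Even (C.filter fun q => ¬ q.1.proj = q.2.proj).card := by
    -- Switching the copy of the first chord preserves the crossing.
    refine even_card_of_involution _
      (fun q => (match q.1 with
        | .boundary v hv => .boundary v hv
        | .bulk v hv k => .bulk v hv (k + 1), q.2)) ?_ ?_ ?_
    all_goals
      rintro ⟨x, y⟩ hq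
      obtain ⟨hq, hp⟩ := Finset.mem_filter.1 hq
      obtain ⟨h1, h2, h3⟩ := (Finset.mem_filter.1 hq).2
      obtain ⟨u, hu, j, v, hv, k, rfl, rfl, hcu, hcv⟩ :=
        bulk_of_crossing hG hbd hS hord hH hHG hτ h1 h2 h3
    · have hp' : u ≠ v := hp
      refine Finset.mem_filter.2 ⟨Finset.mem_filter.2 ⟨Finset.mem_univ _, ?_, ?_, ?_⟩, hp⟩
      · exact (hord.copy_lt_iff hu hv hp' _ _ _ _).1 h1
      · dsimp only at h2 ⊢
        rw [backwardPairing_bulk hτ] at h2 ⊢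
        refine (hord.copy_lt_iff hv _ ?_ _ _ _ _).1 h2
        rintro h
        exact hτ.col_backward u (by rw [← h, hcv, hcu])
      · dsimp only at h3 ⊢
        rw [backwardPairing_bulk hτ, backwardPairing_bulk hτ] at h3 ⊢
        refine (hord.copy_lt_iff _ _ ?_ _ _ _ _).1 h3
        intro h
        exact hp' (by rw [← hτ.backward_backward u, h, hτ.backward_backward])
    · dsimp only
      congr 2
      generalize j = a
      revert a; decide
    · intro h
      have h4 := congrArg Prod.fst h
      simp only [DoubledVertex.bulk.injEq, true_and] at h4
      exact Fin.two_add_one_ne j h4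
  rw [hsame, hdiff.neg_one_pow, mul_one]

/-- In the bulk the white vertices come first, so only chords on the boundary can start at a black
vertex; they do so when the black end of the arc comes before the white one. -/
lemma prod_colour_backwardPairing {M : PlaneEmbedding G} (hbd : IsBoundaryPath M bd)
    (hS : ∀ v ∈ S, ∃ i, bd i = v) (hord : IsFoldedOrder col S bd) (hτ : IsCirculation col S H τ) :
    ∏ x ∈ Finset.univ.filter (fun x => x < backwardPairing hτ x),
        (if IsWhite col x then (1 : ℤ) else -1) =
      ∏ v, if v ∈ S ∧ col v = Colour.black then (chordSign bd v (τ v) : ℤ) else 1 := by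
  rw [Finset.prod_filter, DoubledVertex.prod_eq]
  refine Finset.prod_congr rfl fun v _ => ?_
  by_cases hv : v ∈ S
  · rw [if_pos hv, DoubledVertex.lift_boundary hv, backwardPairing_boundary hτ hv]
    by_cases hc : col v = Colour.white
    · have h1 : IsWhite col (DoubledVertex.boundary v hv) := hc
      rw [if_pos h1, if_neg (show ¬(v ∈ S ∧ col v = Colour.black) from fun h => by rw [hc] at h; cases h.2)]
      simp
    · have h1 : ¬ IsWhite col (DoubledVertex.boundary v hv) := hc
      have h2 : backwardMate col τ v = τ v := if_neg hc
      have h3 : v ∈ S ∧ col v = Colour.black := ⟨hv, Colour.eq_black_of_ne_white hc⟩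
      rw [if_neg h1, if_pos h3, chordSign]
      have hτv := hτ.backward_mem hv
      simp only [h2] at hτv ⊢
      obtain ⟨i, rfl⟩ := hS v hv
      obtain ⟨j, hj⟩ := hS _ hτv
      have key : (DoubledVertex.boundary (bd i) hv < DoubledVertex.boundary (τ (bd i)) hτv) ↔
          ∃ a b, a < b ∧ bd a = bd i ∧ bd b = τ (bd i) := by
        simp only [← hj]
        rw [hord.boundary_lt_iff]
        constructor
        · intro h
          exact ⟨i, j, h, rfl, rfl⟩
        · rintro ⟨a, b, h, ha, hb⟩
          rwa [hbd.1 ha, hbd.1 hb] at h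
      by_cases h : ∃ a b, a < b ∧ bd a = bd i ∧ bd b = τ (bd i)
      · rw [if_pos (key.2 h), if_pos h]; rfl
      · rw [if_neg fun h' => h (key.1 h'), if_neg h]; rfl
  · rw [if_neg hv, if_neg (show ¬(v ∈ S ∧ col v = Colour.black) from fun h => hv h.1)]
    have hone : ∀ k : Fin 2, (if DoubledVertex.lift S v k < backwardPairing hτ (DoubledVertex.lift S v k)
        then if IsWhite col (DoubledVertex.lift S v k) then (1 : ℤ) else -1 else 1) = 1 := by
      intro k
      rw [DoubledVertex.lift_bulk hv, backwardPairing_bulk hτ hv]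
      by_cases hc : col v = Colour.white
      · have h1 : IsWhite col (DoubledVertex.bulk v hv k) := hc
        rw [if_pos h1, ite_self]
      · rw [if_neg]
        exact lt_asymm (hord.white_lt_black _ _ _ _ _ _
          (Colour.eq_white_of_ne_of_ne_white (hτ.col_backward v) hc)
          (Colour.eq_black_of_ne_white hc))
    rw [hone, hone, one_mul]

theorem bicolouredSign_backwardPairing {M : PlaneEmbedding G} (hG : G.Connected)
    (hbd : IsBoundaryPath M bd) (hS : ∀ v ∈ S, ∃ i, bd i = v) (hord : IsFoldedOrder col S bd)
    (hH : IsArcGraph H S) (hHG : H ≤ G) (hτ : IsCirculation col S H τ) :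
    bicolouredSign (IsWhite col) (backwardPairing hτ) =
      (-1) ^ (Finset.univ.filter fun v => col v = Colour.white ∧ v ∉ S).card *
        ∏ v, if v ∈ S ∧ col v = Colour.black then (chordSign bd v (τ v) : ℤ) else 1 := by
  rw [bicolouredSign, neg_one_pow_crossings_backwardPairing hG hbd hS hord hH hHG hτ]
  congr 1
  rw [← prod_colour_backwardPairing hbd hS hord hτ]

end ReferenceSign

/-! ### The part of the Pfaffian that comes from one configuration -/

section Fibres
set_option linter.unusedSectionVars false

open scoped Classical

variable {V : Type*} [Fintype V] {G : SimpleGraph V} {S : Finset V}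
  {col : G.Coloring Colour} {τ : Equiv.Perm V} {ω : Set (Sym2 V)}

lemma DoubledVertex.lift_inj {v : V} (hv : v ∉ S) {a b : Fin 2} (h : lift S v a = lift S v b) :
    a = b := by
  rw [lift_bulk hv, lift_bulk hv] at h
  simpa using h

lemma DoubledVertex.lift_of_mem {v : V} (hv : v ∈ S) (a b : Fin 2) : lift S v a = lift S v b := by
  rw [lift_boundary hv, lift_boundary hv]

lemma pairingEdges_labelPairing (hω : ω ∈ configs G S)
    (hτ : IsCirculation col S (SimpleGraph.fromEdgeSet ω) τ) (i : V → Fin 2) :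
    pairingEdges (labelPairing hτ i) = ω := by
  have hH := isArcGraph_of_mem_configs hω
  ext e
  constructor
  · rintro ⟨x, rfl⟩
    exact ((SimpleGraph.fromEdgeSet_adj _).1 (adj_labelPairing hτ i x)).1
  · intro he
    have hG := mem_edgeSet_of_mem_configs hω he
    induction e with
    | h u v =>
      have huv : (SimpleGraph.fromEdgeSet ω).Adj u v :=
        (SimpleGraph.fromEdgeSet_adj _).2 ⟨he, SimpleGraph.Adj.ne hG⟩
      by_cases hf : v = forwardMate col τ u
      · refine ⟨.lift S u (i u), ?_⟩
        change s((DoubledVertex.lift S u (i u)).proj, (labelFun col τ i (.lift S u (i u))).proj) = _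
        rw [labelFun_forward, DoubledVertex.proj_lift, DoubledVertex.proj_lift, ← hf]
      · have hb := (hτ.eq_forward_or_backward huv).resolve_left hf
        have hu : u ∉ S := fun h => hf (hH.boundary_unique h huv (hτ.adj_forward u))
        refine ⟨.lift S u (i u + 1), ?_⟩
        change s((DoubledVertex.lift S u (i u + 1)).proj,
          (labelFun col τ i (.lift S u (i u + 1))).proj) = _
        rw [labelFun_backward i hu, DoubledVertex.proj_lift, DoubledVertex.proj_lift, ← hb]

/-- On a doubled edge, changing the labels of both ends gives the same pairing again. Fixing the
label of the white end removes this ambiguity; it is the only one. -/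
lemma isPinned_of_forward_eq_backward {v : V}
    (h : forwardMate col τ v = backwardMate col τ v)
    (hτ : IsCirculation col S (SimpleGraph.fromEdgeSet ω) τ) :
    (col v = Colour.white → IsPinned col S τ v) ∧
      (col v ≠ Colour.white → IsPinned col S τ (forwardMate col τ v)) := by
  constructor
  · intro hw
    rw [forwardMate, backwardMate, if_pos hw, if_pos hw] at h
    exact Or.inr ⟨hw, by rw [h, τ.apply_symm_apply]⟩
  · intro hw
    rw [forwardMate, backwardMate, if_neg hw, if_neg hw] at h
    rw [forwardMate, if_neg hw]
    exact Or.inr ⟨Colour.eq_white_of_ne_of_ne_white (hτ.col_symm_ne v) hw,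
      by rw [τ.apply_symm_apply, h]⟩

lemma labelPairing_injOn (hτ : IsCirculation col S (SimpleGraph.fromEdgeSet ω) τ) {i j : V → Fin 2}
    (hi : ∀ v, IsPinned col S τ v → i v = 0) (hj : ∀ v, IsPinned col S τ v → j v = 0)
    (h : labelPairing hτ i = labelPairing hτ j) : i = j := by
  have h' : ∀ x, labelFun col τ i x = labelFun col τ j x := fun x => Equiv.congr_fun h x
  funext v
  by_cases hp : IsPinned col S τ v
  · rw [hi v hp, hj v hp]
  have hv : v ∉ S := fun h => hp (Or.inl h)
  by_cases hfb : forwardMate col τ v = backwardMate col τ v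
  · have hw : col v ≠ Colour.white := fun hw => hp ((isPinned_of_forward_eq_backward hfb hτ).1 hw)
    have hp' := (isPinned_of_forward_eq_backward hfb hτ).2 hw
    have h1 := h' (.lift S (forwardMate col τ v) (i (forwardMate col τ v)))
    have h2 : i (forwardMate col τ v) = j (forwardMate col τ v) := by rw [hi _ hp', hj _ hp']
    rw [labelFun_forward, h2, labelFun_forward, hτ.forward_forward] at h1
    exact DoubledVertex.lift_inj hv h1
  · rcases Fin.two_eq_or (i v) (j v) with h1 | h1
    · exact h1
    · exfalso
      have h2 := h' (.lift S v (i v))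
      rw [labelFun_forward, h1, labelFun_backward j hv] at h2
      have := congrArg DoubledVertex.proj h2
      rw [DoubledVertex.proj_lift, DoubledVertex.proj_lift] at this
      exact hfb this

/-- For each white `v`, some copy of it is paired with a copy of its forward mate; the labels record
these copies. The remaining copies then have only backward mates left. -/
lemma exists_labelPairing_eq (hτ : IsCirculation col S (SimpleGraph.fromEdgeSet ω) τ)
    {π : Equiv.Perm (DoubledVertex S)} (hπ : IsDimerPairing G S π) (hπω : ω = pairingEdges π) :
    ∃ i : V → Fin 2, (∀ v, IsPinned col S τ v → i v = 0) ∧ labelPairing hτ i = π := by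
  have hadj : ∀ u v, (SimpleGraph.fromEdgeSet ω).Adj u v ↔
      ∃ k, (π (.lift S u k)).proj = v := by
    intro u v
    rw [hπω, adj_pairingEdges hπ]
    constructor
    · rintro ⟨x, rfl, rfl⟩
      obtain ⟨k, hk⟩ := x.exists_lift
      exact ⟨k, by rw [← hk]⟩
    · rintro ⟨k, rfl⟩
      exact ⟨_, DoubledVertex.proj_lift _ _, rfl⟩
  have hex : ∀ v, ∃ k l : Fin 2, col v = Colour.white →
      (π (.lift S v k) = .lift S (forwardMate col τ v) l ∧ (IsPinned col S τ v → k = 0) ∧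
        (IsPinned col S τ (forwardMate col τ v) → l = 0)) := by
    intro v
    by_cases hw : col v = Colour.white
    · have h1 : ∃ k, (π (.lift S v k)).proj = forwardMate col τ v ∧ (IsPinned col S τ v → k = 0) := by
        obtain ⟨k, hk⟩ := (hadj _ _).1 (hτ.adj_forward v)
        by_cases hp : IsPinned col S τ v
        · refine ⟨0, ?_, fun _ => rfl⟩
          rcases hp with hp | ⟨_, hp⟩
          · rwa [DoubledVertex.lift_of_mem hp 0 k]
          · have hfb : forwardMate col τ v = backwardMate col τ v := by
              rw [forwardMate, backwardMate, if_pos hw, if_pos hw, Equiv.eq_symm_apply, hp]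
            rcases hτ.eq_forward_or_backward ((hadj v _).2 ⟨0, rfl⟩) with h | h
            · exact h
            · rw [h, hfb]
        · exact ⟨k, hk, fun h => absurd h hp⟩
      obtain ⟨k, hk, hk0⟩ := h1
      obtain ⟨l, hl⟩ := (π (.lift S v k)).exists_lift
      rw [hk] at hl
      by_cases hp : IsPinned col S τ (forwardMate col τ v)
      · have hfS : forwardMate col τ v ∈ S := by
          rcases hp with hp | ⟨hp, _⟩
          · exact hp
          · exact absurd (hp.trans hw.symm) (hτ.col_forward v)
        exact ⟨k, 0, fun _ => ⟨hl.trans (DoubledVertex.lift_of_mem hfS _ _), hk0, fun _ => rfl⟩⟩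
      · exact ⟨k, l, fun _ => ⟨hl, hk0, fun h => absurd h hp⟩⟩
    · exact ⟨0, 0, fun h => absurd h hw⟩
  choose k l hkl using hex
  -- The label of a black vertex is read off at its forward mate, which is white.
  set i : V → Fin 2 := fun v => if col v = Colour.white then k v else l (forwardMate col τ v) with hi
  have iw : ∀ v, col v = Colour.white → i v = k v := fun v hv => if_pos hv
  have ib : ∀ v, col v ≠ Colour.white → i v = l (forwardMate col τ v) := fun v hv => if_neg hv
  have hforward : ∀ v, π (.lift S v (i v)) = .lift S (forwardMate col τ v) (i (forwardMate col τ v)) := by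
    intro v
    by_cases hw : col v = Colour.white
    · rw [iw v hw, ib _ fun h => hτ.col_forward v (h.trans hw.symm), hτ.forward_forward]
      exact (hkl v hw).1
    · have hw' := Colour.eq_white_of_ne_of_ne_white (hτ.col_forward v) hw
      have h := (hkl _ hw').1
      rw [hτ.forward_forward] at h
      rw [ib v hw, iw _ hw', ← h, (hπ.1 _).1]
  refine ⟨i, fun v hv => ?_, Equiv.ext fun x => ?_⟩
  · by_cases hw : col v = Colour.white
    · rw [iw v hw]
      exact (hkl v hw).2.1 hv
    · rw [ib v hw]
      refine (hkl _ (Colour.eq_white_of_ne_of_ne_white (hτ.col_forward v) hw)).2.2 ?_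
      rwa [hτ.forward_forward]
  · change labelFun col τ i x = π x
    rcases x.eq_lift i with h | ⟨hv, h⟩
    · rw [h, labelFun_forward, hforward]
    · set v := x.proj with hvdef
      rw [h, labelFun_backward i hv]
      have hy := (π x).eq_lift i
      rw [h] at hy
      have hnbr : (SimpleGraph.fromEdgeSet ω).Adj v (π (.lift S v (i v + 1))).proj :=
        (hadj _ _).2 ⟨_, rfl⟩
      set w := (π (.lift S v (i v + 1))).proj with hwdef
      -- A labelled copy is already taken by a labelled copy, so the partner is an unlabelled one.
      rcases hy with hy | ⟨_, hy⟩
      · exfalso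
        have h1 := hforward w
        rw [← hy, (hπ.1 _).1] at h1
        have h2 := congrArg DoubledVertex.proj h1
        rw [DoubledVertex.proj_lift, DoubledVertex.proj_lift] at h2
        rw [← h2] at h1
        exact Fin.two_add_one_ne _ (DoubledVertex.lift_inj hv h1)
      · have hwb : w = backwardMate col τ v := by
          rcases hτ.eq_forward_or_backward hnbr with h1 | h1
          · obtain ⟨k', hk'⟩ := (hadj _ _).1 (hτ.adj_backward hv)
            rcases Fin.two_eq_or k' (i v) with rfl | rfl
            · rw [hforward, DoubledVertex.proj_lift] at hk'
              rw [h1, hk']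
            · exact hk'
          · exact h1
        rw [hy, hwb]

section Weights

variable {ξ : V → V → ℂ} {Φ : Connection G S} {ψ : V → V → Fin 2 → ℂ}

lemma kasteleynMatrix_antisymm (x y : DoubledVertex S) :
    kasteleynMatrix col ξ Φ ψ x y = -kasteleynMatrix col ξ Φ ψ y x := by
  unfold kasteleynMatrix
  by_cases h : (doubledGraph G S).Adj x y
  · have hc : col x.proj ≠ col y.proj := col.valid h
    rw [if_pos h, if_pos h.symm]
    by_cases hw : col x.proj = Colour.white
    · rw [if_pos hw, if_neg fun h' => hc (hw.trans h'.symm), neg_neg]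
    · rw [if_neg hw, if_pos (Colour.eq_white_of_ne_of_ne_white hc.symm hw)]
  · rw [if_neg h, if_neg fun h' => h h'.symm, neg_zero]

lemma kasteleynMatrix_lift {u v : V} (huv : G.Adj u v) (hu : col u = Colour.white) (a b : Fin 2) :
    kasteleynMatrix col ξ Φ ψ (.lift S u a) (.lift S v b) =
      edgePhase col ξ u v * edgeWeight Φ ψ (.lift S u a) (.lift S v b) := by
  have h : (doubledGraph G S).Adj (.lift S u a) (.lift S v b) := by
    change G.Adj _ _
    rwa [DoubledVertex.proj_lift, DoubledVertex.proj_lift]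
  rw [kasteleynMatrix, if_pos h, DoubledVertex.proj_lift, DoubledVertex.proj_lift, if_pos hu,
    edgePhase, if_pos hu]

lemma edgePhase_comm {u v : V} (huv : G.Adj u v) : edgePhase col ξ u v = edgePhase col ξ v u := by
  have hc := col.valid huv
  unfold edgePhase
  by_cases hw : col u = Colour.white
  · rw [if_pos hw, if_neg fun h' => hc (hw.trans h'.symm)]
  · rw [if_neg hw, if_pos (Colour.eq_white_of_ne_of_ne_white hc.symm hw)]

/-- For determinant one the inverse is the adjugate. This is the only place where `SL₂` matters for
the loops and arcs: it turns an edge run through from black to white into the connection in the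
direction of travel. -/
lemma Connection.mat_swap (Φ : Connection G S) {u v : V} (hu : u ∉ S) (hv : v ∉ S) (huv : G.Adj u v)
    (a b : Fin 2) : Φ.mat v u (b + 1) (a + 1) = (-1) ^ (a : ℕ) * (-1) ^ (b : ℕ) * Φ.mat u v a b := by
  rw [Connection.mat, Connection.mat, Φ.symm u v hu hv huv]
  rw [Matrix.SpecialLinearGroup.coe_inv, Matrix.adjugate_fin_two]
  fin_cases a <;> fin_cases b <;> simp

/-- The sign of the labels of the two ends of the backward edge from `v`. -/
lemma prod_label_sign (hτ : IsCirculation col S (SimpleGraph.fromEdgeSet ω) τ) (i : V → Fin 2)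
    (hi : ∀ v ∈ S, i v = 0) :
    ∏ v, (if v ∉ S ∧ col v ≠ Colour.white then
      (-1 : ℂ) ^ (i v : ℕ) * (-1) ^ (i (τ v) : ℕ) else 1) = ∏ v, (-1) ^ (i v : ℕ) := by
  have h1 : ∏ v, (-1 : ℂ) ^ (i v : ℕ) =
      (∏ v, if col v ≠ Colour.white then (-1 : ℂ) ^ (i v : ℕ) else 1) *
        ∏ v, if col v = Colour.white then (-1 : ℂ) ^ (i v : ℕ) else 1 := by
    rw [← Finset.prod_mul_distrib]
    refine Finset.prod_congr rfl fun v _ => ?_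
    by_cases h : col v = Colour.white <;> simp [h]
  -- Each white label is moved to the preceding black vertex. Black vertices of `S` give nothing,
  -- because they and their successors lie in `S` and have label zero.
  rw [h1, ← Equiv.prod_comp τ (fun v => if col v = Colour.white then (-1 : ℂ) ^ (i v : ℕ) else 1),
    ← Finset.prod_mul_distrib]
  refine Finset.prod_congr rfl fun v _ => ?_
  by_cases h : col v = Colour.white
  · have h2 : col (τ v) ≠ Colour.white := fun h' => hτ.col_ne v (h'.trans h.symm)
    simp [h, h2]
  · have h2 : col (τ v) = Colour.white := Colour.eq_white_of_ne_of_ne_white (hτ.col_ne v) h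
    by_cases hv : v ∈ S
    · have := hi _ (hτ.black_mem v hv (Colour.eq_black_of_ne_white h))
      simp [hv, hi v hv, this]
    · simp [h, h2, hv]

lemma prod_kasteleynMatrix_labelPairing (hω : ω ∈ configs G S)
    (hτ : IsCirculation col S (SimpleGraph.fromEdgeSet ω) τ) (i : V → Fin 2) {x : G.edgeSet → ℤˣ}
    (hx : ∀ u v, G.Adj u v → edgePhase col ξ u v = ((edgeSign x u v : ℤ) : ℂ)) :
    ∏ w : {x : DoubledVertex S // IsWhite col x},
        kasteleynMatrix col ξ Φ ψ w.1 (labelPairing hτ i w.1) =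
      ∏ v, stepWeight col Φ ψ τ v (i v) (i (τ v)) *
        ((if v ∈ S ∧ col v = Colour.black then 1 else ((edgeSign x v (τ v) : ℤ) : ℂ)) *
          if v ∉ S ∧ col v ≠ Colour.white then
            (-1 : ℂ) ^ (i v : ℕ) * (-1) ^ (i (τ v) : ℕ) else 1) := by
  have hHG : SimpleGraph.fromEdgeSet ω ≤ G := fun u v h => adj_of_mem_configs hω h
  set f : DoubledVertex S → ℂ := fun y => if IsWhite col y then
    kasteleynMatrix col ξ Φ ψ y (labelPairing hτ i y) else 1 with hf
  have h1 : ∏ w : {x : DoubledVertex S // IsWhite col x},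
      kasteleynMatrix col ξ Φ ψ w.1 (labelPairing hτ i w.1) = ∏ y, f y := by
    rw [hf, ← Finset.prod_filter, Finset.prod_subtype _ (p := IsWhite col) (by simp)]
  have h2 : ∏ y, f y = ∏ v, ((if col v = Colour.white then
      kasteleynMatrix col ξ Φ ψ (.lift S v (i v)) (.lift S (τ v) (i (τ v))) else 1) *
      if v ∉ S ∧ col v = Colour.white then
        kasteleynMatrix col ξ Φ ψ (.lift S v (i v + 1)) (.lift S (τ.symm v) (i (τ.symm v) + 1))
      else 1) := by
    rw [DoubledVertex.prod_eq]
    refine Finset.prod_congr rfl fun v _ => ?_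
    have e1 : f (.lift S v (i v)) = if col v = Colour.white then
        kasteleynMatrix col ξ Φ ψ (.lift S v (i v)) (.lift S (τ v) (i (τ v))) else 1 := by
      simp only [hf, IsWhite, DoubledVertex.proj_lift]
      split_ifs with hw
      · change kasteleynMatrix col ξ Φ ψ _ (labelFun col τ i _) = _
        rw [labelFun_forward, forwardMate, if_pos hw]
      · rfl
    have e2 : v ∉ S → f (.lift S v (i v + 1)) = if v ∉ S ∧ col v = Colour.white then
        kasteleynMatrix col ξ Φ ψ (.lift S v (i v + 1)) (.lift S (τ.symm v) (i (τ.symm v) + 1))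
        else 1 := by
      intro hv
      simp only [hf, IsWhite, DoubledVertex.proj_lift, hv, not_false_eq_true, true_and]
      split_ifs with hw
      · change kasteleynMatrix col ξ Φ ψ _ (labelFun col τ i _) = _
        rw [labelFun_backward i hv, backwardMate, if_pos hw]
      · rfl
    by_cases hv : v ∈ S
    · rw [if_pos hv, DoubledVertex.lift_of_mem hv 0 (i v), e1, if_neg (show ¬(v ∉ S ∧
        col v = Colour.white) from fun h => h.1 hv), mul_one]
    · rw [if_neg hv, ← e1, ← e2 hv]
      rcases Fin.two_eq_or (i v) 0 with h | h <;> rw [h]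
      · rfl
      · exact mul_comm _ _
  -- The backward edge at a white vertex is attributed to the black vertex that precedes it, so that
  -- each vertex carries the weight of its own step.
  rw [h1, h2, Finset.prod_mul_distrib, ← Equiv.prod_comp τ (fun v => if v ∉ S ∧ col v = Colour.white then
        kasteleynMatrix col ξ Φ ψ (.lift S v (i v + 1)) (.lift S (τ.symm v) (i (τ.symm v) + 1))
      else 1), ← Finset.prod_mul_distrib]
  refine Finset.prod_congr rfl fun v _ => ?_
  simp only [τ.symm_apply_apply]
  by_cases hw : col v = Colour.white
  · have h3 : col (τ v) ≠ Colour.white := fun h' => hτ.col_ne v (h'.trans hw.symm)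
    have h4 : ¬(v ∈ S ∧ col v = Colour.black) := fun h => by rw [hw] at h; cases h.2
    have hadj := hHG (hτ.adj v h4)
    rw [if_pos hw, if_neg fun h => h3 h.2, if_neg h4, if_neg fun h => h.2 hw,
      kasteleynMatrix_lift hadj hw, stepWeight, if_neg h4, hx _ _ hadj]
    ring
  · have h3 : col (τ v) = Colour.white := Colour.eq_white_of_ne_of_ne_white (hτ.col_ne v) hw
    have hb := Colour.eq_black_of_ne_white hw
    by_cases hv : v ∈ S
    · have h4 : v ∈ S ∧ col v = Colour.black := ⟨hv, hb⟩
      rw [if_neg hw, if_neg fun h => h.1 (hτ.black_mem v hv hb), if_pos h4, if_neg fun h => h.1 hv,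
        stepWeight, if_pos h4]
      ring
    · have h4 : ¬(v ∈ S ∧ col v = Colour.black) := fun h => hv h.1
      have hτv : τ v ∉ S := fun h => hv (hτ.white_mem v h h3)
      have h5 : τ v ∉ S ∧ col (τ v) = Colour.white := ⟨hτv, h3⟩
      have h6 : v ∉ S ∧ col v ≠ Colour.white := ⟨hv, hw⟩
      have hadj := hHG (hτ.adj v h4)
      rw [if_neg hw, if_pos h5, if_neg h4, if_pos h6, kasteleynMatrix_lift hadj.symm h3,
        stepWeight_bulk hv hτv rfl, edgePhase_comm hadj.symm, hx _ _ hadj,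
        DoubledVertex.lift_bulk hv, DoubledVertex.lift_bulk hτv]
      change _ * (_ * Φ.mat (τ v) v (i (τ v) + 1) (i v + 1)) = _
      rw [Φ.mat_swap hv hτv hadj]
      ring

/-- The contribution of a labelled pairing to the Pfaffian. -/
theorem labelPairing_term [LinearOrder (DoubledVertex S)] {M : PlaneEmbedding G} (hG : G.Connected)
    {n : ℕ} {bd : Fin n → V} (hbd : IsBoundaryPath M bd) (hS : ∀ v ∈ S, ∃ i, bd i = v)
    (hord : IsFoldedOrder col S bd) {x : G.edgeSet → ℤˣ}
    (hx : ∀ u v, G.Adj u v → edgePhase col ξ u v = ((edgeSign x u v : ℤ) : ℂ))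
    (hxM : M.IsSignPhase x)
    (halt : ∀ k l : Fin n, (l : ℕ) = k + 1 → ∀ e : G.edgeSet, e.1 = s(bd k, bd l) →
      x e = colourSign (col (bd k))) (hω : ω ∈ configs G S)
    {l : Component ω → List V} (hl : ∀ c, IsComponentList col S ω c (l c))
    (P : IsCyclePartition (SimpleGraph.fromEdgeSet ω).connectedComponentMk l)
    (hτ : IsCirculation col S (SimpleGraph.fromEdgeSet ω) P.perm)
    (i : V → Fin 2) (hi : ∀ v ∈ S, i v = 0) :
    (-1) ^ crossings (labelPairing hτ i) *
        ∏ y ∈ Finset.univ.filter (fun y => y < labelPairing hτ i y),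
          kasteleynMatrix col ξ Φ ψ y (labelPairing hτ i y) =
      (-1) ^ (Finset.univ.filter fun v => col v = Colour.white ∧ v ∉ S).card *
        ∏ v, stepWeight col Φ ψ P.perm v (i v) (i (P.perm v)) := by
  have hH := isArcGraph_of_mem_configs hω
  have hHG : SimpleGraph.fromEdgeSet ω ≤ G := fun u v h => adj_of_mem_configs hω h
  rw [pfaffian_term_eq (isBicoloured_labelPairing hτ hHG i) _ kasteleynMatrix_antisymm,
    prod_kasteleynMatrix_labelPairing hω hτ i hx, bicolouredSign_labelPairing_eq hτ hHG i hi,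
    bicolouredSign_labelPairing_zero hτ hHG,
    bicolouredSign_backwardPairing hG hbd hS hord hH hHG hτ,
    sign_whiteSquare hG hbd hS hxM halt hω hl P, Finset.prod_mul_distrib, Finset.prod_mul_distrib,
    prod_label_sign hτ i hi]
  have h1 : (∏ v, stepSign col S bd x P.perm v : ℤˣ) =
      (∏ v, if v ∈ S ∧ col v = Colour.black then chordSign bd v (P.perm v) else 1) *
      ∏ v, if v ∈ S ∧ col v = Colour.black then 1 else edgeSign x v (P.perm v) := by
    rw [← Finset.prod_mul_distrib]
    refine Finset.prod_congr rfl fun v _ => ?_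
    unfold stepSign
    split_ifs <;> simp
  rw [h1]
  set A : ℤˣ := ∏ v, if v ∈ S ∧ col v = Colour.black then chordSign bd v (P.perm v) else 1 with hA
  set B : ℤˣ := ∏ v, if v ∈ S ∧ col v = Colour.black then 1 else edgeSign x v (P.perm v) with hB
  have hA' : (∏ v, if v ∈ S ∧ col v = Colour.black then (chordSign bd v (P.perm v) : ℤ) else 1) =
      (A : ℤ) := by
    rw [hA, Units.coe_prod]
    refine Finset.prod_congr rfl fun v _ => ?_
    split_ifs <;> rfl
  have hB' : (∏ v, if v ∈ S ∧ col v = Colour.black then (1 : ℂ)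
      else ((edgeSign x v (P.perm v) : ℤ) : ℂ)) = ((B : ℤ) : ℂ) := by
    rw [hB, Units.coe_prod, Int.cast_prod]
    refine Finset.prod_congr rfl fun v _ => ?_
    split_ifs <;> simp
  rw [hA', hB']
  have hAA : ((A : ℤ) : ℂ) * ((A : ℤ) : ℂ) = 1 := by
    rw [← Int.cast_mul, ← Units.val_mul, Int.units_mul_self]; simp
  have hBB : ((B : ℤ) : ℂ) * ((B : ℤ) : ℂ) = 1 := by
    rw [← Int.cast_mul, ← Units.val_mul, Int.units_mul_self]; simp
  have hee : (∏ v, (-1 : ℂ) ^ (i v : ℕ)) * ∏ v, (-1 : ℂ) ^ (i v : ℕ) = 1 := by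
    rw [← Finset.prod_mul_distrib]
    refine Finset.prod_eq_one fun v _ => ?_
    rw [← mul_pow]; simp
  push_cast
  set a := ((A : ℤ) : ℂ)
  set b := ((B : ℤ) : ℂ)
  set e := ∏ v, (-1 : ℂ) ^ (i v : ℕ)
  set N := (Finset.univ.filter fun v => col v = Colour.white ∧ v ∉ S).card
  set w := ∏ v, stepWeight col Φ ψ P.perm v (i v) (i (P.perm v))
  -- The chord signs `a`, the edge phases `b` and the label signs `e` each occur twice: in the sign
  -- of the pairing and in the entries of the matrix, or, for `a`, in the reference pairing and in
  -- the sign of `τ²`.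
  calc _ = (a * a) * (b * b) * (e * e) * ((-1) ^ N * w) := by ring
    _ = _ := by rw [hAA, hBB, hee]; ring

/-- The circulation maps the black bulk vertices bijectively to the white ones, so the division by
two is exact. -/
lemma card_white_bulk {H : SimpleGraph V} (hτ : IsCirculation col S H τ) :
    (Fintype.card V - S.card) / 2 =
      (Finset.univ.filter fun v => col v = Colour.white ∧ v ∉ S).card := by
  have h1 : Fintype.card V - S.card = (Finset.univ.filter fun v => v ∉ S).card := by
    rw [← Finset.card_compl]
    congr 1
    ext v
    simp
  have h2 : (Finset.univ.filter fun v => ¬ col v = Colour.white ∧ v ∉ S).card =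
      (Finset.univ.filter fun v => col v = Colour.white ∧ v ∉ S).card := by
    refine Finset.card_bij (fun v _ => τ v) ?_ (fun _ _ _ _ h => τ.injective h) ?_
    · intro v hv
      obtain ⟨hw, hv⟩ := (Finset.mem_filter.1 hv).2
      have hw' := Colour.eq_white_of_ne_of_ne_white (hτ.col_ne v) hw
      exact Finset.mem_filter.2 ⟨Finset.mem_univ _, hw', fun h => hv (hτ.white_mem v h hw')⟩
    · intro v hv
      obtain ⟨hw, hv⟩ := (Finset.mem_filter.1 hv).2
      have hw' : col (τ.symm v) ≠ Colour.white := fun h => hτ.col_symm_ne v (h.trans hw.symm)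
      refine ⟨τ.symm v, Finset.mem_filter.2 ⟨Finset.mem_univ _, hw', fun h => hv ?_⟩,
        τ.apply_symm_apply v⟩
      have := hτ.black_mem _ h (Colour.eq_black_of_ne_white hw')
      rwa [τ.apply_symm_apply] at this
  have h3 := Finset.card_filter_add_card_filter_not (s := Finset.univ.filter fun v => v ∉ S)
    (fun v => col v = Colour.white)
  rw [Finset.filter_filter, Finset.filter_filter] at h3
  simp only [and_comm (a := _ ∉ S)] at h3
  rw [h1]
  omega

/-- Kenyon's formula with arcs, for real phases. -/
theorem pfaffian_kasteleynMatrix [LinearOrder (DoubledVertex S)] {M : PlaneEmbedding G}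
    (hG : G.Connected) {n : ℕ} {bd : Fin n → V} (hbd : IsBoundaryPath M bd)
    (hS : ∀ v ∈ S, ∃ i, bd i = v) (hord : IsFoldedOrder col S bd) {x : G.edgeSet → ℤˣ}
    (hx : ∀ u v, G.Adj u v → edgePhase col ξ u v = ((edgeSign x u v : ℤ) : ℂ))
    (hxM : M.IsSignPhase x)
    (halt : ∀ k l : Fin n, (l : ℕ) = k + 1 → ∀ e : G.edgeSet, e.1 = s(bd k, bd l) →
      x e = colourSign (col (bd k))) (hbic : ArcsBicoloured col S) (Φ : Connection G S)
    (ψ : V → V → Fin 2 → ℂ) :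
    pfaffian (kasteleynMatrix col ξ Φ ψ) =
      (-1) ^ ((Fintype.card V - S.card) / 2) * loopArcSum col Φ ψ := by
  rw [pfaffian, loopArcSum]
  set t : Equiv.Perm (DoubledVertex S) → ℂ := fun π => (-1) ^ crossings π *
    ∏ y ∈ Finset.univ.filter (fun y => y < π y), kasteleynMatrix col ξ Φ ψ y (π y) with ht
  have h1 : ∑ π with IsPairing π, t π = ∑ π with IsDimerPairing G S π, t π := by
    symm
    refine Finset.sum_subset (fun π hπ => ?_) fun π hπ hπ' => ?_
    · exact Finset.mem_filter.2 ⟨Finset.mem_univ _, (Finset.mem_filter.1 hπ).2.1⟩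
    · have hp := (Finset.mem_filter.1 hπ).2
      have hnot : ¬ ∀ x, G.Adj x.proj (π x).proj := fun h =>
        hπ' (Finset.mem_filter.2 ⟨Finset.mem_univ _, hp, h⟩)
      push Not at hnot
      obtain ⟨y, hy⟩ := hnot
      -- The product runs over left ends, so the pair that is not an edge is represented by its left
      -- end.
      have key : ∃ z, z < π z ∧ ¬ G.Adj z.proj (π z).proj := by
        rcases lt_or_gt_of_ne (hp y).2 with h | h
        · exact ⟨π y, by rwa [(hp y).1], by rw [(hp y).1]; exact fun h' => hy h'.symm⟩
        · exact ⟨y, h, hy⟩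
      obtain ⟨z, hz, hadj⟩ := key
      rw [ht]
      dsimp only
      rw [Finset.prod_eq_zero (Finset.mem_filter.2 ⟨Finset.mem_univ z, hz⟩), mul_zero]
      exact if_neg hadj
  rw [h1, ← Finset.sum_fiberwise_of_maps_to (t := configs G S) (g := pairingEdges)
    (fun π hπ => mem_configs.2 ⟨π, (Finset.mem_filter.1 hπ).2, rfl⟩), Finset.mul_sum]
  refine Finset.sum_congr rfl fun ω hω => ?_
  -- The remaining pairings are grouped by their projections. Over a fixed `ω` they correspond to
  -- the labellings that vanish at the pinned vertices.
  obtain ⟨l, hl, P, hsum⟩ := exists_circulation hω hbic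
  have hτ := isCirculation hω hl P
  have hHG : SimpleGraph.fromEdgeSet ω ≤ G := fun u v h => adj_of_mem_configs hω h
  rw [← hsum Φ ψ, card_white_bulk hτ, Finset.mul_sum]
  symm
  refine Finset.sum_bij (fun i _ => labelPairing hτ i) ?_ ?_ ?_ ?_
  · intro i _
    refine Finset.mem_filter.2 ⟨Finset.mem_filter.2 ⟨Finset.mem_univ _,
      (isBicoloured_labelPairing hτ hHG i).1, fun y => hHG (adj_labelPairing hτ i y)⟩, ?_⟩
    exact pairingEdges_labelPairing hω hτ i
  · intro i hi j hj h
    exact labelPairing_injOn hτ (Finset.mem_filter.1 hi).2 (Finset.mem_filter.1 hj).2 h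
  · intro π hπ
    obtain ⟨hπ, hπω⟩ := Finset.mem_filter.1 hπ
    obtain ⟨i, hi, h⟩ := exists_labelPairing_eq hτ (Finset.mem_filter.1 hπ).2 hπω.symm
    exact ⟨i, Finset.mem_filter.2 ⟨Finset.mem_univ _, hi⟩, h⟩
  · intro i hi
    exact (labelPairing_term hG hbd hS hord hx hxM halt hω hl P hτ i fun v hv =>
      (Finset.mem_filter.1 hi).2 v (Or.inl hv)).symm

end Weights
end Fibres

/-! ### Kasteleyn phases along the bounded faces -/

section KasteleynPhases
set_option linter.unusedSectionVars false

open scoped Classical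

variable {V : Type*} [Fintype V] {G : SimpleGraph V} {S : Finset V} {col : G.Coloring Colour}

lemma prod_pow_dartCount {R : Type*} [CommMonoid R] (p : G.Dart → Prop) (w : G.edgeSet → R) :
    ∏ e, w e ^ dartCount p e = ∏ d, if p d then w (edgeOf d) else 1 := by
  rw [← Finset.prod_fiberwise_of_maps_to (t := Finset.univ) (g := edgeOf)
    (fun _ _ => Finset.mem_univ _)]
  refine Finset.prod_congr rfl fun e _ => ?_
  unfold dartCount
  rw [← Finset.prod_pow_eq_pow_sum]
  refine Finset.prod_congr rfl fun d hd => ?_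
  rw [(Finset.mem_filter.1 hd).2]
  split_ifs <;> simp

namespace PlaneEmbedding

variable (M : PlaneEmbedding G)

/-- A product over the darts of a face, along the boundary of the face. -/
lemma prod_hasFace {R : Type*} [CommMonoid R] {f : M.BoundedFace} {d : G.Dart} (hd : M.HasFace f d)
    (g : G.Dart → R) :
    ∏ d', (if M.HasFace f d' then g d' else 1) =
      ∏ k ∈ Finset.range (Function.minimalPeriod M.next d), g ((M.next ^ k) d) := by
  rw [← Finset.prod_filter]
  have hpos : 0 < Function.minimalPeriod M.next d :=
    Function.minimalPeriod_pos_of_mem_periodicPts (by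
      obtain ⟨k, hk, h⟩ := isOfFinOrder_iff_pow_eq_one.1 (isOfFinOrder_of_finite M.next)
      refine ⟨k, hk, ?_⟩
      rw [Function.IsPeriodicPt, Function.IsFixedPt, Equiv.Perm.iterate_eq_pow, h]
      rfl)
  symm
  refine Finset.prod_bij (fun k _ => (M.next ^ k) d) ?_ ?_ ?_ (fun _ _ => rfl)
  · intro k _
    refine Finset.mem_filter.2 ⟨Finset.mem_univ _, ?_⟩
    induction k with
    | zero => exact hd
    | succ k ih => rw [pow_succ', Equiv.Perm.mul_apply, M.hasFace_next]; exact ih (by simp_all; omega)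
  · intro i hi j hj h
    rw [← Equiv.Perm.iterate_eq_pow, ← Equiv.Perm.iterate_eq_pow] at h
    exact Function.iterate_injOn_Iio_minimalPeriod (Finset.mem_range.1 hi) (Finset.mem_range.1 hj) h
  · intro d' hd'
    have hd' : M.HasFace f d' := (Finset.mem_filter.1 hd').2
    have hsame : M.next.SameCycle d d' := M.faceOf_eq.1 (hd.trans hd'.symm)
    obtain ⟨n, hn⟩ := hsame.exists_nat_pow_eq
    refine ⟨n % Function.minimalPeriod M.next d, Finset.mem_range.2 (Nat.mod_lt _ hpos), ?_⟩
    rw [← hn, ← Equiv.Perm.iterate_eq_pow, ← Equiv.Perm.iterate_eq_pow,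
      Function.iterate_mod_minimalPeriod_eq]

lemma colourSign_next_pow (col : G.Coloring Colour) (d : G.Dart) (k : ℕ) :
    colourSign (col ((M.next ^ k) d).fst) = (-1) ^ k * colourSign (col d.fst) := by
  induction k with
  | zero => simp
  | succ k ih =>
    rw [pow_succ', Equiv.Perm.mul_apply, M.next_fst,
      colourSign_of_ne (col.valid ((M.next ^ k) d).adj), ih, pow_succ]
    simp

/-- The colours alternate around a face, so its boundary length is even and the hypothesis applies;
products over the sides of edges become products along the orbit of a dart. -/
lemma isSignPhase_of_forall_period (col : G.Coloring Colour) {x : G.edgeSet → ℤˣ}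
    (h : ∀ d ∉ M.outer, ∀ n, Function.minimalPeriod M.next d = 2 * n →
      ∏ k ∈ Finset.range (2 * n), x (edgeOf ((M.next ^ k) d)) = (-1) ^ (n + 1)) :
    M.IsSignPhase x := by
  intro f
  obtain ⟨d, hd⟩ : ∃ d, M.HasFace f d := by
    obtain ⟨q, hq⟩ := f
    obtain ⟨d, rfl⟩ := Quotient.exists_rep q
    exact ⟨d, rfl⟩
  have hout := HasFace.not_mem_outer M hd
  have heven : Even (Function.minimalPeriod M.next d) := by
    have h1 := M.colourSign_next_pow col d (Function.minimalPeriod M.next d)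
    rw [← Equiv.Perm.iterate_eq_pow, Function.iterate_minimalPeriod, right_eq_mul] at h1
    by_contra hodd
    rw [Nat.not_even_iff_odd] at hodd
    rw [hodd.neg_one_pow] at h1
    exact absurd h1 (by decide)
  obtain ⟨n, hn⟩ := heven
  rw [← two_mul] at hn
  refine ⟨n, ?_, ?_⟩
  · have h1 := sum_mul_dartCount (M.HasFace f) (fun _ => (1 : ℕ))
    simp only [one_mul, Nat.cast_id] at h1
    -- The darts of the face are counted by the multiplicative form of the same reindexing.
    have h2 := M.prod_hasFace hd (fun _ => Multiplicative.ofAdd 1)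
    have h3 := congrArg Multiplicative.toAdd h2
    rw [toAdd_prod] at h3
    simp only [apply_ite Multiplicative.toAdd, toAdd_ofAdd, toAdd_one, Finset.prod_const,
      toAdd_pow, Finset.card_range, hn] at h3
    unfold faceSides
    rw [h1, h3]
    simp
  · unfold faceSides
    rw [prod_pow_dartCount, M.prod_hasFace hd (fun d => x (edgeOf d)), hn]
    exact h d hout n hn

end PlaneEmbedding

lemma Int.units_complex_injective {a b : ℤˣ} (h : ((a : ℤ) : ℂ) = ((b : ℤ) : ℂ)) : a = b :=
  Units.ext (Int.cast_injective h)

lemma IsRealPhase.exists_sign {ξ : V → V → ℂ} (h : IsRealPhase col ξ) :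
    ∃ x : G.edgeSet → ℤˣ, ∀ u v, G.Adj u v → edgePhase col ξ u v = ((edgeSign x u v : ℤ) : ℂ) := by
  have hex : ∀ e : G.edgeSet, ∃ s : ℤˣ, ∀ u v, e.1 = s(u, v) → edgePhase col ξ u v = ((s : ℤ) : ℂ) := by
    rintro ⟨e, he⟩
    induction e with
    | h u v =>
      have huv : G.Adj u v := he
      have : ∃ s : ℤˣ, edgePhase col ξ u v = ((s : ℤ) : ℂ) := by
        rcases h u v huv with h | h
        · exact ⟨1, by rw [h]; simp⟩
        · exact ⟨-1, by rw [h]; simp⟩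
      obtain ⟨s, hs⟩ := this
      refine ⟨s, fun a b hab => ?_⟩
      rcases Sym2.eq_iff.1 hab with ⟨rfl, rfl⟩ | ⟨rfl, rfl⟩
      · exact hs
      · rw [← hs, edgePhase_comm huv]
  choose x hx using hex
  refine ⟨x, fun u v huv => ?_⟩
  rw [edgeSign_eq x ⟨s(u, v), huv⟩ rfl]
  exact hx _ u v rfl

/-- Kenyon's formula with arcs. -/
theorem pfaffian_eq_of_isKasteleyn [LinearOrder (DoubledVertex S)] {M : PlaneEmbedding G}
    (hG : G.Connected) {n : ℕ} {bd : Fin n → V} (hbd : IsBoundaryPath M bd)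
    (hS : ∀ v ∈ S, ∃ i, bd i = v) (hord : IsFoldedOrder col S bd) (hbic : ArcsBicoloured col S)
    {ξ : V → V → ℂ} (hξ : IsKasteleyn M col ξ) (hreal : IsRealPhase col ξ)
    (halt : AlternatesAlong col ξ bd) (Φ : Connection G S) (ψ : V → V → Fin 2 → ℂ) :
    pfaffian (kasteleynMatrix col ξ Φ ψ) =
      (-1) ^ ((Fintype.card V - S.card) / 2) * loopArcSum col Φ ψ := by
  obtain ⟨x, hx⟩ := hreal.exists_sign
  have hdart : ∀ d : G.Dart, edgePhase col ξ d.fst d.snd = ((x (edgeOf d) : ℤ) : ℂ) := by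
    intro d
    rw [hx _ _ d.adj, edgeSign_eq x (edgeOf d) rfl]
  refine pfaffian_kasteleynMatrix hG hbd hS hord hx ?_ ?_ hbic Φ ψ
  · refine M.isSignPhase_of_forall_period col fun d hd m hm => ?_
    have h := hξ.2 d hd m hm
    apply Int.units_complex_injective
    -- For signs quotients are products, so the alternating quotient is the product over the whole
    -- boundary.
    have hsq : ∀ a b : ℤˣ, ((a : ℤ) : ℂ) / ((b : ℤ) : ℂ) = ((a * b : ℤˣ) : ℤ) := by
      intro a b
      rcases Int.units_eq_one_or a with rfl | rfl <;> rcases Int.units_eq_one_or b with rfl | rfl <;>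
        simp
    simp only [hdart, hsq] at h
    have hpair : ∀ m : ℕ, ∏ k ∈ Finset.range (2 * m), x (edgeOf ((M.next ^ k) d)) =
        ∏ k ∈ Finset.range m, (x (edgeOf ((M.next ^ (2 * k)) d)) *
          x (edgeOf ((M.next ^ (2 * k + 1)) d))) := by
      intro m
      induction m with
      | zero => simp
      | succ m ih =>
        rw [show 2 * (m + 1) = 2 * m + 1 + 1 by ring, Finset.prod_range_succ,
          Finset.prod_range_succ, Finset.prod_range_succ, ih, mul_assoc]
    rw [hpair, Units.coe_prod, Int.cast_prod, h]
    simp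
  · intro k l hkl e he
    apply Int.units_complex_injective
    rw [← edgeSign_eq x e he, ← hx _ _ (by have := e.2; rwa [he] at this), halt k l hkl]
    unfold colourSign
    split_ifs <;> simp

end KasteleynPhases

/-! ### Discrete holomorphy -/

section Holomorphy
set_option linter.unusedSectionVars false

open scoped Classical

variable {V : Type*} [Fintype V] {G : SimpleGraph V} {S : Finset V} {col : G.Coloring Colour}

/-- The Pfaffian of a matrix whose rows and columns are rescaled. -/
lemma pfaffian_rescale {α : Type*} [Fintype α] [LinearOrder α] (A B : Matrix α α ℂ) (D : α → ℂ)
    (h : ∀ x y, B x y = D x * D y * A x y) : pfaffian B = (∏ x, D x) * pfaffian A := by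
  unfold pfaffian
  rw [Finset.mul_sum]
  refine Finset.sum_congr rfl fun π hπ => ?_
  have hp : IsPairing π := (Finset.mem_filter.1 hπ).2
  -- Each index lies in exactly one pair, as left or as right end.
  have h1 : ∏ x, D x = ∏ x ∈ Finset.univ.filter (fun x => x < π x), D x * D (π x) := by
    rw [Finset.prod_mul_distrib, ← Finset.prod_filter_mul_prod_filter_not Finset.univ
      (fun x => x < π x)]
    congr 1
    refine Finset.prod_bij (fun x _ => π x) ?_ (fun _ _ _ _ h => π.injective h) ?_ ?_
    · intro x hx
      refine Finset.mem_filter.2 ⟨Finset.mem_univ _, ?_⟩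
      rw [(hp x).1]
      exact lt_of_le_of_ne (not_lt.1 (Finset.mem_filter.1 hx).2) (hp x).2
    · intro y hy
      refine ⟨π y, Finset.mem_filter.2 ⟨Finset.mem_univ _, ?_⟩, (hp y).1⟩
      rw [(hp y).1]
      exact lt_asymm (Finset.mem_filter.1 hy).2
    · intro x _
      rw [(hp x).1]
  rw [h1, mul_left_comm, ← Finset.prod_mul_distrib]
  congr 1
  exact Finset.prod_congr rfl fun x _ => h x _

lemma kasteleynMatrix_rescale {ξ ζ : V → V → ℂ} (D : V → ℂ)
    (h : ∀ w b, G.Adj w b → col w = Colour.white → ζ w b = D w * D b * ξ w b) (Φ : Connection G S)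
    (ψ : V → V → Fin 2 → ℂ) (x y : DoubledVertex S) :
    kasteleynMatrix col ζ Φ ψ x y = D x.proj * D y.proj * kasteleynMatrix col ξ Φ ψ x y := by
  unfold kasteleynMatrix
  by_cases hadj : (doubledGraph G S).Adj x y
  · have hxy : G.Adj x.proj y.proj := hadj
    rw [if_pos hadj, if_pos hadj]
    by_cases hw : col x.proj = Colour.white
    · rw [if_pos hw, if_pos hw, h _ _ hxy hw]
      ring
    · rw [if_neg hw, if_neg hw, h _ _ hxy.symm
        (Colour.eq_white_of_ne_of_ne_white (col.valid hxy.symm) hw)]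
      ring
  · rw [if_neg hadj, if_neg hadj, mul_zero]

/-- The phases `b - w`, multiplied by powers of `i` that make them real. -/
def rotatedPhase (pos : V → GaussianInt) (w b : V) : ℂ :=
  holomorphyPhase pos w b * (Complex.I ^ (pos w).im / Complex.I ^ (pos b).im)

lemma toComplex_gaussI : GaussianInt.toComplex gaussI = Complex.I := by
  rw [gaussI, GaussianInt.toComplex_def₂]
  apply Complex.ext <;> simp

/-- On a horizontal edge `b - w` is real and the heights agree. On a vertical one the heights differ
by one, and the power of `i` cancels the factor `i` or `-i`. -/
lemma IsLatticeEmbedding.isRealPhase {M : PlaneEmbedding G} {pos : V → GaussianInt}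
    (h : IsLatticeEmbedding M pos) : IsRealPhase col (rotatedPhase pos) := by
  have key : ∀ u v, G.Adj u v → rotatedPhase pos u v = 1 ∨ rotatedPhase pos u v = -1 := by
    intro u v huv
    have h1 := h.adj u v huv
    obtain ⟨z, hz⟩ : ∃ z, z = pos v - pos u := ⟨_, rfl⟩
    rw [← hz] at h1
    have h2 : rotatedPhase pos u v = GaussianInt.toComplex z * Complex.I ^ (-z.im) := by
      rw [rotatedPhase, holomorphyPhase, ← zpow_sub₀ Complex.I_ne_zero, hz, map_sub]
      congr 2
      simp
    rw [h2]
    have h3 : z.re * z.re + z.im * z.im = 1 := by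
      rw [Zsqrtd.norm_def] at h1
      linarith
    have hre : -1 ≤ z.re ∧ z.re ≤ 1 := by constructor <;> nlinarith
    have him : -1 ≤ z.im ∧ z.im ≤ 1 := by constructor <;> nlinarith
    obtain ⟨a, b⟩ := z
    simp only at h3 hre him ⊢
    obtain ⟨ha, ha'⟩ := hre
    obtain ⟨hb, hb'⟩ := him
    clear h1 h2 hz
    interval_cases a <;> interval_cases b <;> simp_all [GaussianInt.toComplex_def]
  intro u v huv
  unfold edgePhase
  split_ifs
  · exact key u v huv
  · exact key v u huv.symm

section Faces

variable {M : PlaneEmbedding G} {pos : V → GaussianInt}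

lemma direction_ne_zero (h : IsLatticeEmbedding M pos) (d : G.Dart) : direction pos d ≠ 0 := by
  intro h0
  have := h.adj _ _ d.adj
  rw [direction] at h0
  rw [h0] at this
  simp at this

lemma gaussI_sq : gaussI * gaussI = -1 := by
  ext <;> simp [gaussI]

/-- Four left turns have directions of sum zero, so the boundary closes up; it does not close after
two steps, as the direction is then reversed and nonzero. -/
lemma next_pow_four (h : IsLatticeEmbedding M pos) (hs : IsSimplyConnectedLattice M pos) {d : G.Dart}
    (hd : d ∉ M.outer) : (M.next ^ 4) d = d ∧ (M.next ^ 2) d ≠ d ∧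
      direction pos ((M.next ^ 1) d) = gaussI * direction pos d ∧
      direction pos ((M.next ^ 2) d) = -direction pos d ∧
      direction pos ((M.next ^ 3) d) = -(gaussI * direction pos d) := by
  have hout : ∀ k, (M.next ^ k) d ∉ M.outer := by
    intro k
    induction k with
    | zero => exact hd
    | succ k ih =>
      obtain ⟨f, hf⟩ := M.exists_hasFace ih
      rw [pow_succ', Equiv.Perm.mul_apply]
      exact PlaneEmbedding.HasFace.not_mem_outer M (M.hasFace_next.2 hf)
  have hstep : ∀ k, direction pos ((M.next ^ (k + 1)) d) = gaussI * direction pos ((M.next ^ k) d) := by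
    intro k
    rw [pow_succ', Equiv.Perm.mul_apply]
    exact hs _ (hout k)
  have h1 : direction pos ((M.next ^ 1) d) = gaussI * direction pos d := hstep 0
  have h2 : direction pos ((M.next ^ 2) d) = -direction pos d := by
    rw [hstep 1, h1, ← mul_assoc, gaussI_sq, neg_one_mul]
  have h3 : direction pos ((M.next ^ 3) d) = -(gaussI * direction pos d) := by
    rw [hstep 2, h2, mul_neg]
  have h4 : direction pos ((M.next ^ 4) d) = direction pos d := by
    rw [hstep 3, h3, mul_neg, ← mul_assoc, gaussI_sq, neg_one_mul, neg_neg]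
  have hfst : ∀ k, pos ((M.next ^ (k + 1)) d).fst = pos ((M.next ^ k) d).fst +
      direction pos ((M.next ^ k) d) := by
    intro k
    rw [pow_succ', Equiv.Perm.mul_apply, M.next_fst, direction]
    ring
  have hclose : pos ((M.next ^ 4) d).fst = pos d.fst := by
    rw [hfst 3, hfst 2, hfst 1, hfst 0, h1, h2, h3, pow_zero, Equiv.Perm.one_apply]
    ring
  refine ⟨?_, fun h' => ?_, h1, h2, h3⟩
  · have e1 : ((M.next ^ 4) d).fst = d.fst := h.injective hclose
    have e2 : ((M.next ^ 4) d).snd = d.snd := by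
      apply h.injective
      rw [direction, direction, hclose] at h4
      exact sub_left_injective h4
    exact SimpleGraph.Dart.ext _ _ (Prod.ext e1 e2)
  · rw [h'] at h2
    have h5 := direction_ne_zero h d
    apply h5
    have h6 : direction pos d + direction pos d = 0 := by rw [← sub_neg_eq_add, ← h2, sub_self]
    have h7 := congrArg Zsqrtd.re h6
    have h8 := congrArg Zsqrtd.im h6
    simp only [Zsqrtd.re_add, Zsqrtd.im_add, Zsqrtd.re_zero, Zsqrtd.im_zero] at h7 h8
    exact Zsqrtd.ext (by simp; omega) (by simp; omega)

lemma minimalPeriod_next (h : IsLatticeEmbedding M pos) (hs : IsSimplyConnectedLattice M pos)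
    {d : G.Dart} (hd : d ∉ M.outer) : Function.minimalPeriod M.next d = 4 := by
  obtain ⟨h4, h2, _⟩ := next_pow_four h hs hd
  have hdvd : Function.minimalPeriod M.next d ∣ 2 ^ 2 := by
    apply Function.IsPeriodicPt.minimalPeriod_dvd
    rw [Function.IsPeriodicPt, Function.IsFixedPt, Equiv.Perm.iterate_eq_pow]
    exact h4
  have hnot : ¬ Function.minimalPeriod M.next d ∣ 2 := by
    intro hdvd
    apply h2
    have := (Function.isPeriodicPt_minimalPeriod M.next d).trans_dvd hdvd
    rwa [Function.IsPeriodicPt, Function.IsFixedPt, Equiv.Perm.iterate_eq_pow] at this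
  obtain ⟨k, hk, hk'⟩ := (Nat.dvd_prime_pow Nat.prime_two).1 hdvd
  rw [hk'] at hnot ⊢
  interval_cases k
  · simp at hnot
  · simp at hnot
  · rfl

end Faces

/-- Signs of the vertices that turn the given signs of the edges into alternating ones along the
path. -/
lemma exists_gauge {M : PlaneEmbedding G} {n : ℕ} {bd : Fin n → V} (hbd : IsBoundaryPath M bd)
    {ξ : V → V → ℂ} (hξ : IsRealPhase col ξ) :
    ∃ s : V → ℂ, (∀ v, s v = 1 ∨ s v = -1) ∧ ∀ i j : Fin n, (j : ℕ) = i + 1 →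
      s (bd i) * s (bd j) * edgePhase col ξ (bd i) (bd j) =
        if col (bd i) = Colour.white then 1 else -1 := by
  obtain ⟨hinj, e, _, hfst, hnext⟩ := hbd
  have hadj : ∀ i j : Fin n, (j : ℕ) = i + 1 → G.Adj (bd i) (bd j) := by
    intro i j hij
    have h1 := (e i).adj
    rwa [hfst, ← M.next_fst, ← hnext i j hij, hfst] at h1
  -- The sign by which the phase of the `k`-th edge of the path must be corrected. The partial
  -- products `T` satisfy `T k * T (k + 1) = t k`, so they can serve as vertex signs.
  set t : ℕ → ℂ := fun k => if h : k + 1 < n then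
    edgePhase col ξ (bd ⟨k, by omega⟩) (bd ⟨k + 1, h⟩) *
      (if col (bd ⟨k, by omega⟩) = Colour.white then 1 else -1) else 1 with ht
  have ht1 : ∀ k, t k = 1 ∨ t k = -1 := by
    intro k
    simp only [ht]
    split_ifs with h hw
    · rw [mul_one]
      exact hξ _ _ (hadj _ _ rfl)
    · rcases hξ _ _ (hadj ⟨k, by omega⟩ ⟨k + 1, h⟩ rfl) with h1 | h1 <;> rw [h1] <;> simp
    · exact Or.inl rfl
  set T : ℕ → ℂ := fun k => ∏ j ∈ Finset.range k, t j with hT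
  have hT1 : ∀ k, T k = 1 ∨ T k = -1 := by
    intro k
    induction k with
    | zero => exact Or.inl rfl
    | succ k ih =>
      have : T (k + 1) = T k * t k := Finset.prod_range_succ _ _
      rw [this]
      rcases ih with h1 | h1 <;> rcases ht1 k with h2 | h2 <;> rw [h1, h2] <;> simp
  refine ⟨fun v => if h : ∃ i, bd i = v then T h.choose else 1, fun v => ?_, fun i j hij => ?_⟩
  · dsimp only
    split_ifs
    · exact hT1 _
    · exact Or.inl rfl
  · have hs : ∀ i : Fin n, (if h : ∃ k, bd k = bd i then T h.choose else (1 : ℂ)) = T i := by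
      intro i
      have h : ∃ k, bd k = bd i := ⟨i, rfl⟩
      rw [dif_pos h, hinj h.choose_spec]
    dsimp only
    rw [hs, hs, hij]
    have h1 : T (i + 1) = T i * t i := Finset.prod_range_succ _ _
    have hlt : (i : ℕ) + 1 < n := hij ▸ j.2
    have h2 : t i = edgePhase col ξ (bd i) (bd j) *
        (if col (bd i) = Colour.white then 1 else -1) := by
      have hj : j = ⟨i + 1, hlt⟩ := Fin.ext hij
      rw [hj]
      exact dif_pos hlt
    have h3 : T i * T i = 1 := by rcases hT1 i with h | h <;> rw [h] <;> simp
    have h4 : edgePhase col ξ (bd i) (bd j) * edgePhase col ξ (bd i) (bd j) = 1 := by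
      rcases hξ _ _ (hadj i j hij) with h | h <;> rw [h] <;> simp
    rw [h1, h2]
    calc _ = (T i * T i) * (edgePhase col ξ (bd i) (bd j) * edgePhase col ξ (bd i) (bd j)) *
          (if col (bd i) = Colour.white then 1 else -1) := by ring
      _ = _ := by rw [h3, h4]; simp

lemma edgePhase_gauge (s : V → ℂ) (ξ : V → V → ℂ) (u v : V) :
    edgePhase col (fun w b => s w * s b * ξ w b) u v = s u * s v * edgePhase col ξ u v := by
  unfold edgePhase
  split_ifs
  · rfl
  · ring

/-- Each vertex of a square lies on one edge of the numerator and one of the denominator, so vertex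
factors cancel. If `δ` is the direction of the first edge, then from a white vertex the values of `b
- w` are `δ, -iδ, -δ, iδ`, with alternating quotient `-1`; starting from a black vertex gives the
same result. -/
lemma isKasteleyn_gauge {M : PlaneEmbedding G} {pos : V → GaussianInt}
    (h : IsLatticeEmbedding M pos) (hs : IsSimplyConnectedLattice M pos) {s : V → ℂ}
    (hs1 : ∀ v, s v = 1 ∨ s v = -1) :
    IsKasteleyn M col (fun w b => s w * s b * rotatedPhase pos w b) := by
  have hs0 : ∀ v, s v ≠ 0 := fun v => by rcases hs1 v with h | h <;> rw [h] <;> simp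
  have hreal := h.isRealPhase (col := col)
  refine ⟨fun u v huv => ?_, fun d hd n hn => ?_⟩
  · rw [edgePhase_gauge, norm_mul, norm_mul]
    rcases hs1 u with h1 | h1 <;> rcases hs1 v with h2 | h2 <;> rcases hreal u v huv with h3 | h3 <;>
      rw [h1, h2, h3] <;> simp
  · rw [minimalPeriod_next h hs hd] at hn
    obtain rfl : n = 2 := by omega
    obtain ⟨h4, _, e1, e2, e3⟩ := next_pow_four h hs hd
    have hsnd : ∀ k, ((M.next ^ k) d).snd = ((M.next ^ (k + 1)) d).fst := by
      intro k
      rw [pow_succ', Equiv.Perm.mul_apply, M.next_fst]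
    have hcol : ∀ k, col ((M.next ^ (k + 1)) d).fst ≠ col ((M.next ^ k) d).fst := by
      intro k
      rw [← hsnd]
      exact (col.valid ((M.next ^ k) d).adj).symm
    have hphase : ∀ k, holomorphyPhase pos ((M.next ^ k) d).fst ((M.next ^ (k + 1)) d).fst =
        GaussianInt.toComplex (direction pos ((M.next ^ k) d)) := by
      intro k
      rw [holomorphyPhase, direction, map_sub, hsnd]
    have hphase' : ∀ k, holomorphyPhase pos ((M.next ^ (k + 1)) d).fst ((M.next ^ k) d).fst =
        -GaussianInt.toComplex (direction pos ((M.next ^ k) d)) := by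
      intro k
      rw [← hphase, holomorphyPhase, holomorphyPhase, neg_sub]
    have hδ : GaussianInt.toComplex (direction pos d) ≠ 0 := by
      rw [Ne, GaussianInt.toComplex_eq_zero]
      exact direction_ne_zero h d
    have hI := Complex.I_ne_zero
    have hg : ∀ k : ℤ, Complex.I ^ k ≠ 0 := fun k => zpow_ne_zero k hI
    have p0 := hphase 0
    have p1 := hphase 1
    have p2 := hphase 2
    have p3 := hphase 3
    have q0 := hphase' 0
    have q1 := hphase' 1
    have q2 := hphase' 2
    have q3 := hphase' 3
    rw [e1] at p1 q1
    rw [e2] at p2 q2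
    rw [e3] at p3 q3
    simp only [map_neg, map_mul, toComplex_gaussI, zero_add, pow_zero, Equiv.Perm.one_apply,
      Nat.reduceAdd, h4, neg_neg] at p0 p1 p2 p3 q0 q1 q2 q3
    have c1 := hcol 0
    have c2 := hcol 1
    have c3 := hcol 2
    simp only [zero_add, pow_zero, Equiv.Perm.one_apply, Nat.reduceAdd] at c1 c2 c3
    rw [Finset.prod_range_succ, Finset.prod_range_one]
    simp only [edgePhase_gauge, hsnd, mul_zero, mul_one, zero_add, Nat.reduceAdd, pow_zero,
      Equiv.Perm.one_apply, h4]
    have hsnd0 : d.snd = ((M.next ^ 1) d).fst := hsnd 0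
    rw [hsnd0]
    have s0 := hs0 d.fst
    have s1 := hs0 ((M.next ^ 1) d).fst
    have s2 := hs0 ((M.next ^ 2) d).fst
    have s3 := hs0 ((M.next ^ 3) d).fst
    have g0 := hg (pos d.fst).im
    have g1 := hg (pos ((M.next ^ 1) d).fst).im
    have g2 := hg (pos ((M.next ^ 2) d).fst).im
    have g3 := hg (pos ((M.next ^ 3) d).fst).im
    generalize ((M.next ^ 1) d).fst = u₁ at *
    generalize ((M.next ^ 2) d).fst = u₂ at *
    generalize ((M.next ^ 3) d).fst = u₃ at *
    generalize d.fst = u₀ at *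
    by_cases hw : col u₀ = Colour.white
    · have w1 : col u₁ ≠ Colour.white := fun h' => c1 (h'.trans hw.symm)
      have w2 := Colour.eq_white_of_ne_of_ne_white c2 w1
      have w3 : col u₃ ≠ Colour.white := fun h' => c3 (h'.trans w2.symm)
      simp only [edgePhase, if_pos hw, if_pos w2, if_neg w1, if_neg w3, rotatedPhase, p0, p2, q1, q3]
      field_simp
      simp [Complex.I_sq]
    · have w1 := Colour.eq_white_of_ne_of_ne_white c1 hw
      have w2 : col u₂ ≠ Colour.white := fun h' => c2 (h'.trans w1.symm)
      have w3 := Colour.eq_white_of_ne_of_ne_white c3 w2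
      simp only [edgePhase, if_pos w1, if_pos w3, if_neg hw, if_neg w2, rotatedPhase, p1, p3, q0, q2]
      field_simp
      simp [Complex.I_sq]

/-- Kenyon's formula with arcs, for the phases of discrete holomorphy. -/
theorem exists_pfaffian_eq_of_lattice [LinearOrder (DoubledVertex S)] {M : PlaneEmbedding G}
    (hG : G.Connected) {n : ℕ} {bd : Fin n → V} (hbd : IsBoundaryPath M bd)
    (hS : ∀ v ∈ S, ∃ i, bd i = v) (hord : IsFoldedOrder col S bd) (hbic : ArcsBicoloured col S)
    {pos : V → GaussianInt} (h : IsLatticeEmbedding M pos) (hs : IsSimplyConnectedLattice M pos) :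
    ∃ c : ℂ, ‖c‖ = 1 ∧ ∀ (Φ : Connection G S) (ψ : V → V → Fin 2 → ℂ),
      pfaffian (kasteleynMatrix col (holomorphyPhase pos) Φ ψ) = c * loopArcSum col Φ ψ := by
  obtain ⟨s, hs1, halt⟩ := exists_gauge hbd (h.isRealPhase (col := col))
  set ξ : V → V → ℂ := fun w b => s w * s b * rotatedPhase pos w b with hξ
  have hK : IsKasteleyn M col ξ := isKasteleyn_gauge h hs hs1
  have hreal : IsRealPhase col ξ := by
    intro u v huv
    rw [hξ, edgePhase_gauge]
    rcases hs1 u with h1 | h1 <;> rcases hs1 v with h2 | h2 <;>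
      rcases h.isRealPhase (col := col) u v huv with h3 | h3 <;> rw [h1, h2, h3] <;> simp
  have hA : AlternatesAlong col ξ bd := by
    intro i j hij
    rw [hξ, edgePhase_gauge]
    exact halt i j hij
  -- This undoes the vertex factors in `ξ`: the signs `s` are their own inverses, and the powers of
  -- `i` enter with opposite exponents at white and at black vertices.
  set D : V → ℂ := fun v => s v * (if col v = Colour.white then Complex.I ^ (-(pos v).im)
    else Complex.I ^ (pos v).im) with hD
  have hDnorm : ∀ v, ‖D v‖ = 1 := by
    intro v
    rw [hD]
    dsimp only
    rw [norm_mul]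
    split_ifs <;> rcases hs1 v with h1 | h1 <;> rw [h1] <;> simp
  have hscale : ∀ w b, G.Adj w b → col w = Colour.white →
      holomorphyPhase pos w b = D w * D b * ξ w b := by
    intro w b hwb hw
    have hb : col b ≠ Colour.white := fun hb => col.valid hwb (hw.trans hb.symm)
    simp only [hD, hξ, rotatedPhase, if_pos hw, if_neg hb]
    have hI := Complex.I_ne_zero
    have g0 : Complex.I ^ (pos w).im ≠ 0 := zpow_ne_zero _ hI
    have g1 : Complex.I ^ (pos b).im ≠ 0 := zpow_ne_zero _ hI
    have hss : ∀ v, s v * s v = 1 := fun v => by rcases hs1 v with h1 | h1 <;> rw [h1] <;> simp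
    rw [zpow_neg]
    calc holomorphyPhase pos w b = (s w * s w) * (s b * s b) * holomorphyPhase pos w b := by
          rw [hss, hss]; ring
      _ = _ := by field_simp
  refine ⟨(∏ y : DoubledVertex S, D y.proj) * (-1) ^ ((Fintype.card V - S.card) / 2), ?_,
    fun Φ ψ => ?_⟩
  · rw [norm_mul, norm_prod, Finset.prod_eq_one fun y _ => hDnorm _]
    simp
  · rw [pfaffian_rescale _ _ (fun y => D y.proj) (kasteleynMatrix_rescale D hscale Φ ψ),
      pfaffian_eq_of_isKasteleyn hG hbd hS hord hbic hK hreal hA Φ ψ, mul_assoc]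

end Holomorphy
end FoldedDimer
end

theorem proposition2p1 {V : Type*} [Fintype V] (G : SimpleGraph V) (hG : G.Connected)
    (col : G.Coloring FoldedDimer.Colour) (M : FoldedDimer.PlaneEmbedding G)
    {n : ℕ} (bd : Fin n → V) (hbd : FoldedDimer.IsBoundaryPath M bd)
    (S : Finset V) (hS : ∀ v ∈ S, ∃ i, bd i = v)
    [LinearOrder (FoldedDimer.DoubledVertex S)]
    (hord : FoldedDimer.IsFoldedOrder col S bd) :
    (FoldedDimer.ColoursAlternate col S bd → FoldedDimer.ArcsBicoloured col S) ∧
    (FoldedDimer.ArcsBicoloured col S →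
      (∀ ξ : V → V → ℂ, FoldedDimer.IsKasteleyn M col ξ → FoldedDimer.IsRealPhase col ξ →
        FoldedDimer.AlternatesAlong col ξ bd →
        ∀ (Φ : FoldedDimer.Connection G S) (ψ : V → V → Fin 2 → ℂ),
          FoldedDimer.pfaffian (FoldedDimer.kasteleynMatrix col ξ Φ ψ) =
            (-1) ^ ((Fintype.card V - S.card) / 2) * FoldedDimer.loopArcSum col Φ ψ) ∧
      (∀ pos : V → GaussianInt, FoldedDimer.IsLatticeEmbedding M pos →
        FoldedDimer.IsSimplyConnectedLattice M pos →
        ∃ c : ℂ, ‖c‖ = 1 ∧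
          ∀ (Φ : FoldedDimer.Connection G S) (ψ : V → V → Fin 2 → ℂ),
            FoldedDimer.pfaffian
                (FoldedDimer.kasteleynMatrix col (FoldedDimer.holomorphyPhase pos) Φ ψ) =
              c * FoldedDimer.loopArcSum col Φ ψ)) :=
  ⟨fun h => FoldedDimer.ColoursAlternate.arcsBicoloured hG hbd hS h, fun hbic =>
    ⟨fun _ hξ hreal halt Φ ψ =>
      FoldedDimer.pfaffian_eq_of_isKasteleyn hG hbd hS hord hbic hξ hreal halt Φ ψ,
    fun _ h hs => FoldedDimer.exists_pfaffian_eq_of_lattice hG hbd hS hord hbic h hs⟩⟩
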